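/- **Setting.** Let $P$ be a simple polygon with $n\ge 3$ vertices with integer coordinates, given in order along $\partial P$, let $q\in P$ be a point with integer coordinates that lies on no line through two vertices of $P$ (weak general position), and let $k\in\mathbb N$. Edge $i$ of $P$ joins vertex $i$ to the next vertex. For $\theta\in[0,2\pi)$ let $r_\theta$ be the ray from $q$ with angle $\theta$. A vertex $v$ is *critical* if its two incident edges lie on the same side of the ray from $q$ through $v$; it is an *end* vertex if they lie to the right of the ray and a *start* vertex if they lie to the left. Let $c$ be the number of critical vertices. On a ray $r_\theta$ through a critical vertex $v$, let $e_\theta(j)$ be the $j$-th edge of $P$ that meets $r_\theta$, counted from $q$; both edges incident to $v$ are counted, in the order in which they are met by the neighbouring rays that meet both of them ($r_{\theta-\varepsilon}$ if $v$ is an end vertex, $r_{\theta+\varepsilon}$ if it is a start vertex, $\varepsilon>0$ small). The *$k$-visibility region* $V_k(P,q)$ is the set of points $p\in P$ such that the open segment $qp$ is properly crossed by $\partial P$ at most $k$ times (touching the boundary at a critical vertex is not a crossing). Let $k$ be even. If $r_\theta$ passes through a critical vertex that belongs to $V_k(P,q)$, the segment of $r_\theta$ between $e_\theta(k+2)$ and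 $e_\theta(k+3)$, if these edges exist, is a *window*; its type is CCW if $V_k(P,q)$ lies to the left of $r_\theta$ along the window, and CW otherwise. Its two endpoints are represented by the triples $(\theta,j,\text{type})$, where $j$ is the index of $e_\theta(k+2)$ and of $e_\theta(k+3)$, respectively. $W_k(P,q)$ is the set of all these triples; for odd $k$, $W_k(P,q):=W_{k-1}(P,q)$. **Model.** The input (the numbers $n$ and $k$, and the coordinates of $q$ and of the vertices) is stored in a randomly accessible read-only array, one number per word. The workspace consists of words that can be read and written; the output goes to a write-only sequence of words. Adding, subtracting, multiplying or comparing two workspace words, loading a constant, reading an input word and writing an output word take one unit of time each. An angle $\theta$ is written as the index of the (unique) vertex that lies on $r_\theta$. **Theorem.** There are a single program and an absolute constant $C$ such that for all $P$, $q$ and $k$ as above the program terminates and reports exactly the elements of $W_k(P,q)$, each of them once, in $O(kn+cn)$ time if $c\ge 1$ (and in $O(kn+n)$ time if $c=0$), using a constant number of words of workspace. If every input number has at most $b$ bits, then $Cb$ bits suffice for every word of the workspace (so these are words of $O(\log n)$ bits when the input words have $O(\log n)$ bits). The constants do not depend on $n$, $k$, $c$, $P$, $q$ or $b$. -/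

import Mathlib

open Filter Topology

namespace KVis

/-! ### The plane, polygons, rays -/

/-- A point with integer coordinates, as a point of the plane `ℂ`. -/
def toPlane (a : ℤ × ℤ) : ℂ := ⟨(a.1 : ℝ), (a.2 : ℝ)⟩

/-- The polygon in the plane with the given vertices (edge `i` joins vertex `i` to the next one). -/
def polygon {n : ℕ} (V : Fin n → ℤ × ℤ) : Polygon ℂ n := ⟨fun i => toPlane (V i)⟩

/-- A simple polygon: distinct vertices, and two distinct edges meet at most in the endpoint that
cyclically consecutive edges share. -/
def IsSimple {n : ℕ} (P : Polygon ℂ n) : Prop :=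
  3 ≤ n ∧ Function.Injective P.vertices ∧
    ∀ i j : Fin n, i ≠ j → ∀ x ∈ P.edgeSet ℝ i ∩ P.edgeSet ℝ j,
      (j = finRotate n i ∧ x = P j) ∨ (i = finRotate n j ∧ x = P i)

/-- Weak general position: `q` is on no line through two vertices. -/
def WeakGeneralPosition {n : ℕ} (P : Polygon ℂ n) (q : ℂ) : Prop :=
  ∀ i j : Fin n, i ≠ j → q ∉ line[ℝ, P i, P j]

/-- The point at distance `t` from `q` in the direction of angle `θ`. -/
noncomputable def polarPoint (q : ℂ) (θ t : ℝ) : ℂ := q + t * Complex.exp (θ * Complex.I)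

/-- The closed ray `r_θ` from `q`. -/
def ray (q : ℂ) (θ : ℝ) : Set ℂ := {z | ∃ t : ℝ, 0 ≤ t ∧ z = polarPoint q θ t}

/-- The angle in `[0, 2π)` of the ray from `q` through `z`. -/
noncomputable def angle (q z : ℂ) : ℝ := toIcoMod Real.two_pi_pos 0 (Complex.arg (z - q))

/-- The planar cross product: positive iff `b` is to the left of `a`, negative iff to the right. -/
def cross (a b : ℂ) : ℝ := a.re * b.im - a.im * b.re

/-- Edge `e` meets the ray `r_θ` from `q`. -/
def Meets {n : ℕ} (P : Polygon ℂ n) (q : ℂ) (θ : ℝ) (e : Fin n) : Prop :=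
  (P.edgeSet ℝ e ∩ ray q θ).Nonempty

/-- The closed region bounded by the polygon (even-odd rule): the boundary, together with the points
from which every ray that avoids all vertices meets an odd number of edges. -/
def region {n : ℕ} (P : Polygon ℂ n) : Set ℂ :=
  {p | p ∈ P.boundary ℝ ∨
    ∀ θ : ℝ, (∀ i, P i ∉ ray p θ) → Odd {e : Fin n | Meets P p θ e}.ncard}

/-! ### Critical vertices -/

/-- An end vertex: both incident edges lie to the right of the ray from `q` through the vertex. -/
def IsEnd {n : ℕ} (P : Polygon ℂ n) (q : ℂ) (i : Fin n) : Prop :=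
  cross (P i - q) (P ((finRotate n).symm i) - q) < 0 ∧ cross (P i - q) (P (finRotate n i) - q) < 0

/-- A start vertex: both incident edges lie to the left of the ray from `q` through the vertex. -/
def IsStart {n : ℕ} (P : Polygon ℂ n) (q : ℂ) (i : Fin n) : Prop :=
  0 < cross (P i - q) (P ((finRotate n).symm i) - q) ∧ 0 < cross (P i - q) (P (finRotate n i) - q)

/-- A critical vertex: both incident edges lie on the same side of the ray through it. -/
def IsCritical {n : ℕ} (P : Polygon ℂ n) (q : ℂ) (i : Fin n) : Prop :=
  IsEnd P q i ∨ IsStart P q i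

/-- The number of critical vertices. -/
noncomputable def numCritical {n : ℕ} (P : Polygon ℂ n) (q : ℂ) : ℕ :=
  {i : Fin n | IsCritical P q i}.ncard

/-! ### The `k`-visibility region -/

/-- The `k`-visibility region `V_k(P,q)`: the points `p` of the region such that the segment `qp`,
without its endpoints, is crossed by the boundary at most `k` times. At a critical vertex the
boundary touches the segment without crossing it. -/
def visRegion {n : ℕ} (P : Polygon ℂ n) (q : ℂ) (k : ℕ) : Set ℂ :=
  {p | p ∈ region P ∧
    {x | x ∈ openSegment ℝ q p ∧ x ∈ P.boundary ℝ ∧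
      ∀ i, IsCritical P q i → x ≠ P i}.encard ≤ (k : ℕ∞)}

/-! ### Edge lists of the rays through critical vertices -/

/-- On the ray `r_θ`, edge `a` is met strictly closer to `q` than edge `b`. -/
def Before {n : ℕ} (P : Polygon ℂ n) (q : ℂ) (θ : ℝ) (a b : Fin n) : Prop :=
  ∃ s t : ℝ, 0 ≤ s ∧ s < t ∧ polarPoint q θ s ∈ P.edgeSet ℝ a ∧ polarPoint q θ t ∈ P.edgeSet ℝ b

/-- Edge `a` precedes edge `b` in the edge list of the ray through the critical vertex `i`: it is
met first, or both are incident to the vertex and `a` is met first on the neighbouring rays on the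
side on which these two edges lie. -/
def Precedes {n : ℕ} (P : Polygon ℂ n) (q : ℂ) (i a b : Fin n) : Prop :=
  Before P q (angle q (P i)) a b ∨
    (P i ∈ P.edgeSet ℝ a ∧ P i ∈ P.edgeSet ℝ b ∧
      ((IsEnd P q i ∧ ∀ᶠ ε : ℝ in 𝓝[>] 0, Before P q (angle q (P i) - ε) a b) ∨
        (IsStart P q i ∧ ∀ᶠ ε : ℝ in 𝓝[>] 0, Before P q (angle q (P i) + ε) a b)))

/-- `e` is the `j`-th edge `e_θ(j)` (counted from `1`) of the ray through the critical vertex `i`;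
both edges incident to that vertex are counted. -/
def IsNthEdge {n : ℕ} (P : Polygon ℂ n) (q : ℂ) (i : Fin n) (j : ℕ) (e : Fin n) : Prop :=
  Meets P q (angle q (P i)) e ∧
    {a : Fin n | Meets P q (angle q (P i)) a ∧ Precedes P q i a e}.ncard + 1 = j

/-! ### Windows -/

inductive WindowType
  | ccw
  | cw

/-- The part of the ray `r_θ` strictly between edges `a` and `b`. -/
def openWindow {n : ℕ} (P : Polygon ℂ n) (q : ℂ) (θ : ℝ) (a b : Fin n) : Set ℂ :=
  {x | ∃ s u t : ℝ, 0 ≤ s ∧ s < u ∧ u < t ∧ polarPoint q θ s ∈ P.edgeSet ℝ a ∧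
    polarPoint q θ t ∈ P.edgeSet ℝ b ∧ x = polarPoint q θ u}

/-- `V_k(P,q)` lies to the left of the part of `r_θ` between edges `a` and `b`: near each of its
points, all points strictly to the left of `r_θ` are in `V_k(P,q)`. -/
def RegionOnLeft {n : ℕ} (P : Polygon ℂ n) (q : ℂ) (k : ℕ) (θ : ℝ) (a b : Fin n) : Prop :=
  ∀ x ∈ openWindow P q θ a b,
    ∀ᶠ z in 𝓝[{z | 0 < cross (Complex.exp (θ * Complex.I)) (z - q)}] x, z ∈ visRegion P q k

/-- The critical vertex `i` is `k`-visible and edges `a`, `b` are `e_θ(k+2)`, `e_θ(k+3)` on the ray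
through it, so that there is a window between them. -/
def HasWindow {n : ℕ} (P : Polygon ℂ n) (q : ℂ) (k : ℕ) (i a b : Fin n) : Prop :=
  IsCritical P q i ∧ P i ∈ visRegion P q k ∧ IsNthEdge P q i (k + 2) a ∧ IsNthEdge P q i (k + 3) b

/-- The window endpoints for even `k`, as triples (angle of the ray, index of the edge that contains
the endpoint, type). The type is `ccw` if `V_k(P,q)` lies to the left of the ray, else `cw`. -/
def windowEndpointsEven {n : ℕ} (P : Polygon ℂ n) (q : ℂ) (k : ℕ) :
    Set (ℝ × Fin n × WindowType) :=
  {w | ∃ i a b : Fin n, HasWindow P q k i a b ∧ w.1 = angle q (P i) ∧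
    (w.2.1 = a ∨ w.2.1 = b) ∧
    (w.2.2 = WindowType.ccw ↔ RegionOnLeft P q k (angle q (P i)) a b)}

/-- The set `W_k(P,q)`; for odd `k` it is `W_{k-1}(P,q)`. -/
def windowEndpoints {n : ℕ} (P : Polygon ℂ n) (q : ℂ) (k : ℕ) : Set (ℝ × Fin n × WindowType) :=
  windowEndpointsEven P q (2 * (k / 2))

/-! ### The machine

A word machine with finitely many work registers, a randomly accessible read-only input array and a
write-only output. Registers hold signed `w`-bit words; an operation whose result does not fit is
not executable. Every elementary operation and every test takes one unit of time. -/

/-- The integer `x` fits in `w` bits (and a sign). -/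
def Fits (w : ℕ) (x : ℤ) : Prop := |x| < 2 ^ w

inductive ArithOp
  | add
  | sub
  | mul

def ArithOp.eval : ArithOp → ℤ → ℤ → ℤ
  | .add, x, y => x + y
  | .sub, x, y => x - y
  | .mul, x, y => x * y

/-- Programs with `R` registers. -/
inductive Prog (R : ℕ)
  /-- `r := c` for a literal `c` -/
  | const (r : Fin R) (c : ℤ)
  /-- `r := a op b` for registers `a`, `b` -/
  | arith (op : ArithOp) (r a b : Fin R)
  /-- `r := input[a]` for a register `a` -/
  | read (r a : Fin R)
  /-- append the content of register `a` to the output -/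
  | emit (a : Fin R)
  | seq (p p' : Prog R)
  /-- `if a < b then p else p'` for registers `a`, `b` -/
  | ifLt (a b : Fin R) (p p' : Prog R)
  /-- `while a < b do p` for registers `a`, `b` -/
  | whileLt (a b : Fin R) (p : Prog R)

/-- The content of the registers (the whole workspace) and the output written so far. -/
structure State (R : ℕ) where
  reg : Fin R → ℤ
  out : List ℤ

def State.init (R : ℕ) : State R := ⟨fun _ => 0, []⟩

def State.set {R : ℕ} (s : State R) (r : Fin R) (x : ℤ) : State R :=
  ⟨Function.update s.reg r x, s.out⟩

/-- `Exec A w p s t s'`: with input array `A` and words of `w` bits, program `p` started in state `s`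
terminates in state `s'` after exactly `t` time units. -/
inductive Exec {R : ℕ} (A : List ℤ) (w : ℕ) : Prog R → State R → ℕ → State R → Prop
  | const {s : State R} {r : Fin R} {c : ℤ} (h : Fits w c) :
      Exec A w (.const r c) s 1 (s.set r c)
  | arith {s : State R} {op : ArithOp} {r a b : Fin R} (h : Fits w (op.eval (s.reg a) (s.reg b))) :
      Exec A w (.arith op r a b) s 1 (s.set r (op.eval (s.reg a) (s.reg b)))
  | read {s : State R} {r a : Fin R} {m : ℕ} {x : ℤ} (ha : s.reg a = (m : ℤ))
      (hx : A[m]? = some x) (h : Fits w x) :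
      Exec A w (.read r a) s 1 (s.set r x)
  | emit {s : State R} {a : Fin R} :
      Exec A w (.emit a) s 1 ⟨s.reg, s.out ++ [s.reg a]⟩
  | seq {p p' : Prog R} {s s' s'' : State R} {t t' : ℕ} (h : Exec A w p s t s')
      (h' : Exec A w p' s' t' s'') :
      Exec A w (.seq p p') s (t + t') s''
  | ifTrue {a b : Fin R} {p p' : Prog R} {s s' : State R} {t : ℕ} (hc : s.reg a < s.reg b)
      (h : Exec A w p s t s') :
      Exec A w (.ifLt a b p p') s (t + 1) s'
  | ifFalse {a b : Fin R} {p p' : Prog R} {s s' : State R} {t : ℕ} (hc : ¬ s.reg a < s.reg b)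
      (h : Exec A w p' s t s') :
      Exec A w (.ifLt a b p p') s (t + 1) s'
  | whileTrue {a b : Fin R} {p : Prog R} {s s' s'' : State R} {t t' : ℕ}
      (hc : s.reg a < s.reg b) (h : Exec A w p s t s')
      (h' : Exec A w (.whileLt a b p) s' t' s'') :
      Exec A w (.whileLt a b p) s (t + t' + 1) s''
  | whileFalse {a b : Fin R} {p : Prog R} {s : State R} (hc : ¬ s.reg a < s.reg b) :
      Exec A w (.whileLt a b p) s 1 s

/-! ### Input and output format -/

/-- The input array `n, k, q, V 0, …, V (n-1)`, a point taking two words. -/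
def inputArray {n : ℕ} (V : Fin n → ℤ × ℤ) (q : ℤ × ℤ) (k : ℕ) : List ℤ :=
  [(n : ℤ), (k : ℤ), q.1, q.2] ++ (List.ofFn V).flatMap (fun a => [a.1, a.2])

/-- The three words that report a window endpoint: the index of the vertex whose angle is `θ`, the
index of the edge, and the type. -/
def reportWords {n : ℕ} : Fin n × Fin n × WindowType → List ℤ
  | (i, e, WindowType.ccw) => [(i : ℤ), (e : ℤ), 1]
  | (i, e, WindowType.cw) => [(i : ℤ), (e : ℤ), 0]

/-- The triple `(θ, edge, type)` that is meant by a reported triple. -/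
noncomputable def reported {n : ℕ} (P : Polygon ℂ n) (q : ℂ) (w : Fin n × Fin n × WindowType) :
    ℝ × Fin n × WindowType :=
  (angle q (P w.1), w.2.1, w.2.2)

end KVis

namespace KVis

/-! ### Segments seen from the origin -/

/-! Everything is seen from `q`, taken as the origin. A ray in direction `d` meets an edge iff `d`
lies in the closed cone over the edge (`InCone`), at the reciprocal of `slope`, which is linear in
`d`. As the edges of a simple polygon meet only in common vertices, two edges keep their order along
the rays throughout their common cone (`no_swap`).

Windows become statements about ranks. Fix the ray through a critical vertex `i`, with distances in
units of the distance of `i`, and let the rank of an edge be the number of properly crossing edges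
in front of it. Put `K = 2 * (k / 2)`. The vertex is visible iff at most `K` crossing edges are
closer than distance `1`. The two incident edges take two places of the edge list at distance `1`,
so the edge in place `K + 3` is the crossing edge of rank `K`, and the edge in place `K + 2` is its
predecessor: the crossing edge of rank `K - 1`, or the second incident edge (`hasWindow_iff`). The
type is decided by the side of the incident edges. On the side away from them exactly `K` edges lie
in front of the window, and since `K` is even and `q` is inside, the parity of ray crossings puts
these points inside the polygon (`mem_region_of_even`). On the other side the incident edges are
additional crossings (`regionOnLeft_iff`).

The program visits the critical vertices in angular order, starting from one of them, and on each
ray looks for the crossing edge of rank `K`, or the last crossing edge if there are too few. From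
one ray to the next it follows the boundary counterclockwise along the edge it has found. Between
critical vertices the number of edges in front of the followed chain, and the number behind it, do
not change: at a noncritical vertex one edge ends where another begins on the same side of the chain
(`sideCount_eq`). The next critical vertex changes these numbers by a bounded amount
(`abs_sideCount_sub_le`), so only boundedly many moves to a neighbouring crossing edge are needed on
each new ray (`pot_walk_le`), while the first ray needs at most `K + 2`. Each move, and each passage
to the next ray, costs a constant number of passes over the input, that is `O(n)`. There are `O(k +
c)` of them, which gives `O(kn + cn)`.

For the machine model the program is written in a small language of integer expressions and unnested
loops of length `n`. Variables hold only array addresses; all other values are polynomials of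
bounded degree in the input words and these addresses, hence have `O(b)` bits. Compilation is
verified once (`Ex.compile_spec`, `Cmd.compile_spec`), and a measure on the states of the sweep
bounds the number of passes through the outer loop (`inv_sweep`, `while_spec`). -/

theorem cross_add_left (a b c : ℂ) : cross (a + b) c = cross a c + cross b c := by
  simp [cross]; ring

theorem cross_add_right (a b c : ℂ) : cross a (b + c) = cross a b + cross a c := by
  simp [cross]; ring

theorem cross_smul_left (s : ℝ) (a b : ℂ) : cross (s • a) b = s * cross a b := by
  simp [cross]; ring

theorem cross_smul_right (s : ℝ) (a b : ℂ) : cross a (s • b) = s * cross a b := by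
  simp [cross]; ring

theorem cross_comm (a b : ℂ) : cross a b = -cross b a := by
  simp [cross]; ring

theorem cross_self (a : ℂ) : cross a a = 0 := by
  simp [cross]; ring

/-- The Plücker relation of four vectors in the plane. -/
theorem cross_plucker (a b c d : ℂ) :
    cross a b * cross c d - cross a c * cross b d + cross a d * cross b c = 0 := by
  simp [cross]; ring

/-- Cramer's rule for the coordinates of `d` with respect to `a` and `b`. -/
theorem cross_smul_eq (a b d : ℂ) : cross a b • d = cross d b • a + cross a d • b := by
  apply Complex.ext <;> simp [cross] <;> ring

theorem eq_zero_of_cross {a b d : ℂ} (hab : cross a b ≠ 0) (h1 : cross a d = 0)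
    (h2 : cross d b = 0) : d = 0 := by
  have h := cross_smul_eq a b d
  rw [h1, h2] at h
  simpa [hab] using h

section star

variable {n : ℕ}

/-- The next vertex along the polygon. -/
def nx (i : Fin n) : Fin n := finRotate n i

/-- The previous vertex along the polygon. -/
def pv (i : Fin n) : Fin n := (finRotate n).symm i

@[simp] theorem nx_pv (i : Fin n) : nx (pv i) = i := (finRotate n).apply_symm_apply i

@[simp] theorem pv_nx (i : Fin n) : pv (nx i) = i := (finRotate n).symm_apply_apply i

theorem nx_injective : Function.Injective (nx : Fin n → Fin n) := (finRotate n).injective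

/-- Orientation of two vertices. -/
def X (u : Fin n → ℂ) (i j : Fin n) : ℝ := cross (u i) (u j)

/-- Twice the signed area of the triangle spanned by the origin and an edge. -/
def area (u : Fin n → ℂ) (e : Fin n) : ℝ := X u e (nx e)

/-- The reciprocal of the distance at which the line of an edge is met in a direction. -/
noncomputable def slope (u : Fin n → ℂ) (e : Fin n) (d : ℂ) : ℝ :=
  (cross (u e) d + cross d (u (nx e))) / area u e

/-- The direction `d` is in the closed cone over the edge. -/
def InCone (u : Fin n → ℂ) (e : Fin n) (d : ℂ) : Prop :=
  0 ≤ cross (u e) d * area u e ∧ 0 ≤ cross d (u (nx e)) * area u e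

/-- The direction of vertex `i` is in the open cone over the edge. -/
def Proper (u : Fin n → ℂ) (e i : Fin n) : Prop :=
  0 < X u e i * area u e ∧ 0 < X u i (nx e) * area u e

/-- Both incident edges of the vertex lie on the same side of the ray through it. -/
def Crit (u : Fin n → ℂ) (i : Fin n) : Prop := 0 < X u i (nx i) * X u i (pv i)

/-- The vertices of a simple polygon as seen from the origin, which is on no line through two of
them. -/
structure Star (u : Fin n → ℂ) : Prop where
  three_le : 3 ≤ n
  ne : ∀ i j, i ≠ j → X u i j ≠ 0
  simple : ∀ e f, e ≠ f → ∀ x ∈ segment ℝ (u e) (u (nx e)), x ∈ segment ℝ (u f) (u (nx f)) →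
    (f = nx e ∧ x = u f) ∨ (e = nx f ∧ x = u e)

variable {u : Fin n → ℂ}

theorem X_comm (i j : Fin n) : X u i j = -X u j i := cross_comm _ _

theorem X_self (i : Fin n) : X u i i = 0 := cross_self _

theorem X_plucker (u : Fin n → ℂ) (a b c d : Fin n) :
    X u a b * X u c d - X u a c * X u b d + X u a d * X u b c = 0 := cross_plucker _ _ _ _

theorem Star.nx_ne (h : Star u) (i : Fin n) : nx i ≠ i := by
  have h3 := h.three_le
  obtain ⟨m, rfl⟩ : ∃ m, n = m + 2 := ⟨n - 2, by omega⟩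
  intro hi
  have : i ∈ Finset.univ := Finset.mem_univ i
  rw [← support_finRotate] at this
  exact (Equiv.Perm.mem_support.1 this) hi

theorem Star.pv_ne (h : Star u) (i : Fin n) : pv i ≠ i := fun hi => by
  have := h.nx_ne (pv i)
  rw [nx_pv] at this
  exact this hi.symm

theorem Star.nx_ne_pv (h : Star u) (i : Fin n) : nx i ≠ pv i := by
  have h3 := h.three_le
  obtain ⟨m, rfl⟩ : ∃ m, n = m + 3 := ⟨n - 3, by omega⟩
  intro hi
  have h1 : nx (nx i) = i := by rw [hi]; simp
  have h2 : i + 1 + 1 = i := by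
    simpa [nx, finRotate_apply] using h1
  have h4 : (1 + 1 : Fin (m + 3)) = 0 := by
    have : i + (1 + 1) = i + 0 := by rw [← add_assoc, h2, add_zero]
    exact add_left_cancel this
  have := congrArg Fin.val h4
  simp [Fin.val_add] at this
  rw [Nat.mod_eq_of_lt (by omega)] at this
  omega

theorem Star.area_ne (h : Star u) (e : Fin n) : area u e ≠ 0 := h.ne _ _ (h.nx_ne e).symm

theorem Star.eq_of_X (h : Star u) {i j : Fin n} (hij : X u i j = 0) : i = j := by
  by_contra hne
  exact h.ne i j hne hij

theorem slope_add (e : Fin n) (a b : ℝ) (c d : ℂ) :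
    slope u e (a • c + b • d) = a * slope u e c + b * slope u e d := by
  simp only [slope, cross_add_left, cross_add_right, cross_smul_left, cross_smul_right]
  ring

theorem slope_smul (e : Fin n) (a : ℝ) (c : ℂ) : slope u e (a • c) = a * slope u e c := by
  simp only [slope, cross_smul_left, cross_smul_right]
  ring

theorem InCone.add {e : Fin n} {c d : ℂ} {a b : ℝ} (hc : InCone u e c) (hd : InCone u e d)
    (ha : 0 ≤ a) (hb : 0 ≤ b) : InCone u e (a • c + b • d) := by
  have := mul_nonneg ha hc.1
  have := mul_nonneg ha hc.2
  have := mul_nonneg hb hd.1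
  have := mul_nonneg hb hd.2
  simp only [InCone, cross_add_left, cross_add_right, cross_smul_left, cross_smul_right]
  constructor <;> linarith

theorem inCone_smul {e : Fin n} {d : ℂ} {a : ℝ} (ha : 0 < a) :
    InCone u e (a • d) ↔ InCone u e d := by
  simp only [InCone, cross_smul_left, cross_smul_right, mul_assoc, mul_nonneg_iff_of_pos_left ha]

theorem slope_left (h : Star u) (e : Fin n) : slope u e (u e) = 1 := by
  have := h.area_ne e
  rw [slope, cross_self, zero_add]
  exact div_self this

theorem slope_right (h : Star u) (e : Fin n) : slope u e (u (nx e)) = 1 := by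
  have := h.area_ne e
  rw [slope, cross_self, add_zero]
  exact div_self this

theorem inCone_left (e : Fin n) : InCone u e (u e) := by
  simp only [InCone, cross_self, zero_mul, le_refl, true_and]
  exact mul_self_nonneg _

theorem inCone_right (e : Fin n) : InCone u e (u (nx e)) := by
  simp only [InCone, cross_self, zero_mul, le_refl, and_true]
  exact mul_self_nonneg _

/-- Up to the positive factor `area ^ 2` the slope is the sum of the two nonnegative cone products;
if both vanish, `d` is parallel to both endpoints and hence zero. -/
theorem InCone.slope_pos (h : Star u) {e : Fin n} {d : ℂ} (hd : InCone u e d) (h0 : d ≠ 0) :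
    0 < slope u e d := by
  have ha := h.area_ne e
  have h2 : slope u e d = (cross (u e) d * area u e + cross d (u (nx e)) * area u e)
      / (area u e) ^ 2 := by
    rw [slope]; field_simp
  rw [h2]
  apply div_pos _ (by positivity)
  rcases hd.1.lt_or_eq with h3 | h3
  · linarith [hd.2]
  rcases hd.2.lt_or_eq with h4 | h4
  · linarith
  refine absurd (eq_zero_of_cross ha ?_ ?_) h0
  · rcases mul_eq_zero.1 h3.symm with h5 | h5
    · exact h5
    · exact absurd h5 ha
  · rcases mul_eq_zero.1 h4.symm with h5 | h5
    · exact h5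
    · exact absurd h5 ha

/-- A point of a ray from the origin is on an edge iff the ray is in the cone over the edge and
the distance is the reciprocal slope. -/
theorem smul_mem_segment_iff (h : Star u) {e : Fin n} {d : ℂ} {s : ℝ} (hs : 0 ≤ s) :
    s • d ∈ segment ℝ (u e) (u (nx e)) ↔ InCone u e d ∧ s * slope u e d = 1 := by
  have ha := h.area_ne e
  constructor
  · rintro ⟨a, b, ha0, hb0, hab, hx⟩
    have h1 : s * cross (u e) d = b * area u e := by
      rw [← cross_smul_right, ← hx, cross_add_right, cross_smul_right, cross_smul_right,
        cross_self]
      simp [area, X]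
    have h2 : s * cross d (u (nx e)) = a * area u e := by
      rw [← cross_smul_left, ← hx, cross_add_left, cross_smul_left, cross_smul_left,
        cross_self]
      simp [area, X]
    have h3 : s * slope u e d = 1 := by
      have : s * slope u e d = (s * cross (u e) d + s * cross d (u (nx e))) / area u e := by
        rw [slope]; ring
      rw [this, h1, h2, ← add_mul, add_comm b a, hab, one_mul, div_self ha]
    have hs0 : 0 < s := by
      rcases hs.lt_or_eq with h4 | h4
      · exact h4
      · rw [← h4] at h3; simp at h3
    refine ⟨⟨?_, ?_⟩, h3⟩
    · have : 0 ≤ s * (cross (u e) d * area u e) := by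
        rw [← mul_assoc, h1, mul_assoc]
        exact mul_nonneg hb0 (mul_self_nonneg _)
      exact (mul_nonneg_iff_of_pos_left hs0).1 this
    · have : 0 ≤ s * (cross d (u (nx e)) * area u e) := by
        rw [← mul_assoc, h2, mul_assoc]
        exact mul_nonneg ha0 (mul_self_nonneg _)
      exact (mul_nonneg_iff_of_pos_left hs0).1 this
  · rintro ⟨hc, h1⟩
    -- The barycentric coordinates are read off from Cramer's rule; that they sum to `1` is the
    -- slope equation.
    refine ⟨s * (cross d (u (nx e)) / area u e), s * (cross (u e) d / area u e), ?_, ?_, ?_, ?_⟩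
    · have : cross d (u (nx e)) / area u e = (cross d (u (nx e)) * area u e) / area u e ^ 2 := by
        field_simp
      rw [this]
      exact mul_nonneg hs (div_nonneg hc.2 (by positivity))
    · have : cross (u e) d / area u e = (cross (u e) d * area u e) / area u e ^ 2 := by
        field_simp
      rw [this]
      exact mul_nonneg hs (div_nonneg hc.1 (by positivity))
    · rw [← h1, slope]; ring
    · have h2 := cross_smul_eq (u e) (u (nx e)) d
      have h3 : d = (area u e)⁻¹ • (cross d (u (nx e)) • u e + cross (u e) d • u (nx e)) := by
        rw [← h2]
        change d = (area u e)⁻¹ • (area u e) • d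
        rw [smul_smul, inv_mul_cancel₀ ha, one_smul]
      conv_rhs => rw [h3]
      simp only [smul_add, smul_smul]
      congr 2 <;> ring

theorem inv_slope_mem (h : Star u) {e : Fin n} {d : ℂ} (hd : InCone u e d) (h0 : d ≠ 0) :
    (slope u e d)⁻¹ • d ∈ segment ℝ (u e) (u (nx e)) := by
  have hp := hd.slope_pos h h0
  exact (smul_mem_segment_iff h (by positivity)).2 ⟨hd, inv_mul_cancel₀ hp.ne'⟩

theorem Star.vertex_ne_zero (h : Star u) (i : Fin n) : u i ≠ 0 := by
  intro h0
  have := h.ne i (nx i) (h.nx_ne i).symm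
  rw [X, h0] at this
  simp [cross] at this

/-- Two edges met at the same distance share a vertex in that direction. -/
theorem exists_vertex_of_slope_eq (h : Star u) {e f : Fin n} (hef : e ≠ f) {d : ℂ} (h0 : d ≠ 0)
    (he : InCone u e d) (hf : InCone u f d) (hs : slope u e d = slope u f d) :
    ∃ w, ((f = nx e ∧ w = f) ∨ (e = nx f ∧ w = e)) ∧ cross (u w) d = 0 := by
  have h1 := inv_slope_mem h he h0
  have h2 := inv_slope_mem h hf h0
  rw [← hs] at h2
  have hz : ∀ w, (slope u e d)⁻¹ • d = u w → cross (u w) d = 0 := by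
    intro w hw
    rw [← hw, cross_smul_left, cross_self, mul_zero]
  rcases h.simple e f hef _ h1 h2 with ⟨h3, h4⟩ | ⟨h3, h4⟩
  · exact ⟨f, Or.inl ⟨h3, rfl⟩, hz f h4⟩
  · exact ⟨e, Or.inr ⟨h3, rfl⟩, hz e h4⟩

/-- Edges met at the same point share a vertex there, and by general position the only vertex in the
direction of `x` is `x` itself. -/
theorem slope_ne_of_not_incident (h : Star u) {e f x : Fin n} (hef : e ≠ f)
    (he : InCone u e (u x)) (hf : InCone u f (u x))
    (hx : ¬ ((x = e ∨ x = nx e) ∧ (x = f ∨ x = nx f))) :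
    slope u e (u x) ≠ slope u f (u x) := by
  intro hs
  obtain ⟨w, hw, hc⟩ := exists_vertex_of_slope_eq h hef (h.vertex_ne_zero x) he hf hs
  have : w = x := h.eq_of_X hc
  subst this
  rcases hw with ⟨h1, h2⟩ | ⟨h1, h2⟩
  · exact hx ⟨Or.inr (h2.trans h1), Or.inl h2⟩
  · exact hx ⟨Or.inl h2, Or.inr (h2.trans h1)⟩

/-- The order in which two edges are met does not change within the cone over both. -/
theorem no_swap (h : Star u) {e f : Fin n} (hef : e ≠ f) {c d : ℂ} (hcd : cross c d ≠ 0)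
    (hec : InCone u e c) (hed : InCone u e d) (hfc : InCone u f c) (hfd : InCone u f d) :
    ¬ (slope u e c < slope u f c ∧ slope u f d < slope u e d) := by
  rintro ⟨h1, h2⟩
  -- The weights are chosen so that the two slopes, being linear, agree in the intermediate
  -- direction `b • c + a • d`. The edges then have a common vertex in that direction.
  set a := slope u f c - slope u e c with ha
  set b := slope u e d - slope u f d with hb
  have ha0 : 0 < a := by simp only [ha]; linarith
  have hb0 : 0 < b := by simp only [hb]; linarith
  have hne : b • c + a • d ≠ 0 := by
    intro h3
    have h4 : cross c (b • c + a • d) = a * cross c d := by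
      rw [cross_add_right, cross_smul_right, cross_smul_right, cross_self]; ring
    rw [h3] at h4
    have : cross c 0 = 0 := by simp [cross]
    rw [this] at h4
    exact (mul_ne_zero ha0.ne' hcd) h4.symm
  obtain ⟨w, hw, hc⟩ := exists_vertex_of_slope_eq h hef hne (hec.add hed hb0.le ha0.le)
    (hfc.add hfd hb0.le ha0.le) (by rw [slope_add, slope_add]; simp only [ha, hb]; ring)
  -- The direction of the common vertex bounds the cone of `g`. The cone products of `c` and `d` for
  -- this bounding ray are nonnegative with a vanishing positive combination, so both `c` and `d`
  -- are parallel to it, although `cross c d ≠ 0`.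
  have key : ∀ g, (w = g ∨ w = nx g) → InCone u g c → InCone u g d → False := by
    intro g hg hgc hgd
    have hA := h.area_ne g
    rw [cross_add_right, cross_smul_right, cross_smul_right] at hc
    have hcd0 : cross (u w) c = 0 ∧ cross (u w) d = 0 := by
      rcases hg with rfl | rfl
      · have e1 : b * (cross (u w) c * area u w) + a * (cross (u w) d * area u w) = 0 := by
          linear_combination (area u w) * hc
        have e2 := mul_nonneg hb0.le hgc.1
        have e3 := mul_nonneg ha0.le hgd.1
        have e4 : b * (cross (u w) c * area u w) = 0 := by linarith
        have e5 : a * (cross (u w) d * area u w) = 0 := by linarith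
        simpa [hA, ha0.ne', hb0.ne'] using And.intro e4 e5
      · rw [cross_comm _ c, cross_comm _ d] at hc ⊢
        have e1 : b * (cross c (u (nx g)) * area u g) + a * (cross d (u (nx g)) * area u g) = 0 := by
          linear_combination (-area u g) * hc
        have e2 := mul_nonneg hb0.le hgc.2
        have e3 := mul_nonneg ha0.le hgd.2
        have e4 : b * (cross c (u (nx g)) * area u g) = 0 := by linarith
        have e5 : a * (cross d (u (nx g)) * area u g) = 0 := by linarith
        simpa [hA, ha0.ne', hb0.ne'] using And.intro e4 e5
    have hv := h.vertex_ne_zero w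
    refine hv (eq_zero_of_cross (a := c) (b := d) hcd ?_ hcd0.2)
    rw [cross_comm, hcd0.1, neg_zero]
  rcases hw with ⟨h3, h4⟩ | ⟨h3, h4⟩
  · exact key f (Or.inl h4) hfc hfd
  · exact key e (Or.inl h4) hec hed

/-- Turns `no_swap` into an equivalence by excluding ties at the two directions compared. -/
theorem slope_lt_iff (h : Star u) {e f : Fin n} (hef : e ≠ f) {c d : ℂ} (hcd : cross c d ≠ 0)
    (hec : InCone u e c) (hed : InCone u e d) (hfc : InCone u f c) (hfd : InCone u f d)
    (hc : slope u e c ≠ slope u f c) (hd : slope u e d ≠ slope u f d) :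
    slope u e c < slope u f c ↔ slope u e d < slope u f d := by
  constructor
  · intro h1
    by_contra h2
    exact no_swap h hef hcd hec hed hfc hfd ⟨h1, lt_of_le_of_ne (not_lt.1 h2) hd.symm⟩
  · intro h1
    by_contra h2
    exact no_swap h hef.symm hcd hfc hfd hec hed ⟨lt_of_le_of_ne (not_lt.1 h2) hc.symm, h1⟩

end star

section star

variable {n : ℕ} {u : Fin n → ℂ}

/-! ### Arcs of directions -/

open Classical in
/-- The first endpoint of an edge in counterclockwise order. -/
noncomputable def fstV (u : Fin n → ℂ) (e : Fin n) : Fin n := if 0 < area u e then e else nx e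

open Classical in
/-- The last endpoint of an edge in counterclockwise order. -/
noncomputable def lstV (u : Fin n → ℂ) (e : Fin n) : Fin n := if 0 < area u e then nx e else e

theorem X_fst_lst (h : Star u) (e : Fin n) : 0 < X u (fstV u e) (lstV u e) := by
  unfold fstV lstV
  split_ifs with h1
  · exact h1
  · rw [X_comm]
    have := h.area_ne e
    have : area u e < 0 := lt_of_le_of_ne (not_lt.1 h1) this
    simpa [area] using this

theorem slope_fst (h : Star u) (e : Fin n) : slope u e (u (fstV u e)) = 1 := by
  unfold fstV
  split_ifs
  exacts [slope_left h e, slope_right h e]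

theorem slope_lst (h : Star u) (e : Fin n) : slope u e (u (lstV u e)) = 1 := by
  unfold lstV
  split_ifs
  exacts [slope_right h e, slope_left h e]

theorem inCone_fst (e : Fin n) : InCone u e (u (fstV u e)) := by
  unfold fstV
  split_ifs
  exacts [inCone_left e, inCone_right e]

theorem inCone_lst (e : Fin n) : InCone u e (u (lstV u e)) := by
  unfold lstV
  split_ifs
  exacts [inCone_right e, inCone_left e]

theorem proper_iff (h : Star u) {e i : Fin n} :
    Proper u e i ↔ 0 < X u (fstV u e) i ∧ 0 < X u i (lstV u e) := by
  unfold Proper fstV lstV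
  have h0 := h.area_ne e
  split_ifs with h1
  · rw [mul_pos_iff_of_pos_right h1, mul_pos_iff_of_pos_right h1]
  · have h2 : area u e < 0 := lt_of_le_of_ne (not_lt.1 h1) h0
    rw [X_comm (nx e) i, X_comm i e, neg_pos, neg_pos, and_comm]
    constructor
    · rintro ⟨a, b⟩
      exact ⟨by nlinarith, by nlinarith⟩
    · rintro ⟨a, b⟩
      exact ⟨by nlinarith, by nlinarith⟩

theorem Proper.inCone {e i : Fin n} (h : Proper u e i) : InCone u e (u i) := ⟨h.1.le, h.2.le⟩

theorem Proper.ne_left {e i : Fin n} (h : Proper u e i) : i ≠ e := by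
  rintro rfl
  have := h.1
  rw [X_self] at this
  simp at this

theorem Proper.ne_right {e i : Fin n} (h : Proper u e i) : i ≠ nx e := by
  rintro rfl
  have := h.2
  rw [X_self] at this
  simp at this

theorem inCone_vertex_iff (h : Star u) {e i : Fin n} :
    InCone u e (u i) ↔ Proper u e i ∨ i = e ∨ i = nx e := by
  constructor
  · intro hc
    by_cases h1 : i = e
    · exact Or.inr (Or.inl h1)
    by_cases h2 : i = nx e
    · exact Or.inr (Or.inr h2)
    refine Or.inl ⟨lt_of_le_of_ne hc.1 ?_, lt_of_le_of_ne hc.2 ?_⟩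
    · exact (mul_ne_zero (h.ne _ _ (Ne.symm h1)) (h.area_ne e)).symm
    · exact (mul_ne_zero (h.ne _ _ h2) (h.area_ne e)).symm
  · rintro (hp | rfl | rfl)
    exacts [hp.inCone, inCone_left _, inCone_right _]

theorem fst_or_lst (e : Fin n) : (fstV u e = e ∧ lstV u e = nx e) ∨
    (fstV u e = nx e ∧ lstV u e = e) := by
  unfold fstV lstV
  split_ifs <;> simp

theorem Proper.ne_fst {e i : Fin n} (h : Proper u e i) : i ≠ fstV u e := by
  rcases fst_or_lst (u := u) e with ⟨h1, h2⟩ | ⟨h1, h2⟩ <;> rw [h1]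
  exacts [h.ne_left, h.ne_right]

theorem Proper.ne_lst {e i : Fin n} (h : Proper u e i) : i ≠ lstV u e := by
  rcases fst_or_lst (u := u) e with ⟨h1, h2⟩ | ⟨h1, h2⟩ <;> rw [h2]
  exacts [h.ne_right, h.ne_left]

/-- The edge covers the direction of `x`, half-open at its last endpoint. -/
def Cov (u : Fin n → ℂ) (e x : Fin n) : Prop := x = fstV u e ∨ Proper u e x

/-- The vertex `v` is in the sector from `x` (excluded) to `y` (included). -/
def InArc (u : Fin n → ℂ) (x y v : Fin n) : Prop := v = y ∨ (0 < X u x v ∧ 0 < X u v y)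

theorem Cov.inCone {e x : Fin n} (hx : Cov u e x) : InCone u e (u x) := by
  rcases hx with rfl | hp
  exacts [inCone_fst e, hp.inCone]

theorem slope_ne_of_ne_vertices (h : Star u) {e f x : Fin n} (hef : e ≠ f)
    (he : InCone u e (u x)) (hf : InCone u f (u x))
    (hx : ¬ ((x = fstV u e ∨ x = lstV u e) ∧ (x = fstV u f ∨ x = lstV u f))) :
    slope u e (u x) ≠ slope u f (u x) := by
  apply slope_ne_of_not_incident h hef he hf
  rcases fst_or_lst (u := u) e with ⟨h1, h2⟩ | ⟨h1, h2⟩ <;>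
    rcases fst_or_lst (u := u) f with ⟨h3, h4⟩ | ⟨h3, h4⟩ <;>
    rw [h1, h2, h3, h4] at hx <;> tauto

/-- On the side `σ` of edge `e` (`1`: closer, `-1`: farther). -/
def Side (u : Fin n → ℂ) (σ : ℝ) (e f x : Fin n) : Prop :=
  0 < σ * (slope u f (u x) - slope u e (u x))

theorem side_iff (h : Star u) {σ : ℝ} {e f x y : Fin n} (hef : e ≠ f)
    (hxy : X u x y ≠ 0)
    (hec : InCone u e (u x)) (hed : InCone u e (u y)) (hfc : InCone u f (u x))
    (hfd : InCone u f (u y))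
    (hc : slope u e (u x) ≠ slope u f (u x)) (hd : slope u e (u y) ≠ slope u f (u y)) :
    Side u σ e f x ↔ Side u σ e f y := by
  have h1 := slope_lt_iff h hef hxy hec hed hfc hfd hc hd
  have h2 := slope_lt_iff h hef.symm hxy hfc hfd hec hed hc.symm hd.symm
  simp only [Side, mul_pos_iff, sub_pos, sub_neg, h1, h2]

/-- Four directions: position of an arc `[A,B)` relative to the sector `(x,y]`. -/
theorem arc_cases (h : Star u) {x y A B : Fin n} (hxy : 0 < X u x y) (hAB : 0 < X u A B) :
    let cov : Fin n → Prop := fun v => v = A ∨ (0 < X u A v ∧ 0 < X u v B)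
    (InArc u x y A ∧ InArc u x y B ∧ ¬ cov x ∧ ¬ cov y) ∨
    (InArc u x y A ∧ ¬ InArc u x y B ∧ ¬ cov x ∧ cov y) ∨
    (¬ InArc u x y A ∧ InArc u x y B ∧ cov x ∧ ¬ cov y) ∨
    (¬ InArc u x y A ∧ ¬ InArc u x y B ∧ cov x ∧ cov y) ∨
    (¬ InArc u x y A ∧ ¬ InArc u x y B ∧ ¬ cov x ∧ ¬ cov y) := by
  have hneAB : A ≠ B := by rintro rfl; rw [X_self] at hAB; exact lt_irrefl _ hAB
  have hnexy : x ≠ y := by rintro rfl; rw [X_self] at hxy; exact lt_irrefl _ hxy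
  have hp := X_plucker u x y A B
  have hn : ∀ a b, (a = b ∧ X u a b = 0) ∨ (a ≠ b ∧ b ≠ a ∧ 0 < X u a b ∧ 0 ≤ X u a b ∧ ¬ X u a b < 0) ∨
      (a ≠ b ∧ b ≠ a ∧ X u a b < 0 ∧ X u a b ≤ 0 ∧ ¬ 0 < X u a b) := by
    intro a b
    by_cases hab : a = b
    · subst hab; exact Or.inl ⟨rfl, X_self a⟩
    · rcases (h.ne a b hab).lt_or_gt with h1 | h1
      · exact Or.inr (Or.inr ⟨hab, Ne.symm hab, h1, h1.le, h1.not_gt⟩)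
      · exact Or.inr (Or.inl ⟨hab, Ne.symm hab, h1, h1.le, h1.not_gt⟩)
  have hneg : ∀ a b, X u a b = - X u b a := fun a b => X_comm a b
  have hs : ∀ a, X u a a = 0 := X_self
  -- The next four facts are the sign patterns that the Plücker relation excludes when `X u x y` and
  -- `X u A B` are positive. With them the claim is a finite check over the signs of the remaining
  -- four orientations.
  have f1 : ¬ (X u x A ≤ 0 ∧ 0 ≤ X u y B ∧ 0 ≤ X u x B ∧ 0 ≤ X u y A) := by
    rintro ⟨a, b, c, d⟩; nlinarith [mul_nonneg c d, mul_nonneg (neg_nonneg.2 a) b, mul_pos hxy hAB]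
  have f2 : ¬ (X u x A ≤ 0 ∧ 0 ≤ X u y B ∧ X u x B ≤ 0 ∧ X u y A ≤ 0) := by
    rintro ⟨a, b, c, d⟩
    nlinarith [mul_nonneg_of_nonpos_of_nonpos c d, mul_nonneg (neg_nonneg.2 a) b, mul_pos hxy hAB]
  have f3 : ¬ (0 ≤ X u x A ∧ X u y B ≤ 0 ∧ 0 ≤ X u x B ∧ 0 ≤ X u y A) := by
    rintro ⟨a, b, c, d⟩; nlinarith [mul_nonneg c d, mul_nonneg a (neg_nonneg.2 b), mul_pos hxy hAB]
  have f4 : ¬ (0 ≤ X u x A ∧ X u y B ≤ 0 ∧ X u x B ≤ 0 ∧ X u y A ≤ 0) := by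
    rintro ⟨a, b, c, d⟩
    nlinarith [mul_nonneg_of_nonpos_of_nonpos c d, mul_nonneg a (neg_nonneg.2 b), mul_pos hxy hAB]
  have n1 := hn x A
  have n2 := hn x B
  have n3 := hn y A
  have n4 := hn y B
  have g1 := hneg A x
  have g2 := hneg B x
  have g3 := hneg A y
  have g4 := hneg B y
  have g5 := hneg A B
  have g6 := hneg x y
  clear hneg hn hp
  intro cov
  simp only [cov, InArc, g1, g3, g4, neg_pos]
  clear g1 g2 g3 g4 g5 g6
  rcases n1 with ⟨n1, m1⟩ | ⟨n1, m1, p1, q1, r1⟩ | ⟨n1, m1, p1, q1, r1⟩ <;>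
    rcases n3 with ⟨n3, m3⟩ | ⟨n3, m3, p3, q3, r3⟩ | ⟨n3, m3, p3, q3, r3⟩ <;>
    rcases n2 with ⟨n2, m2⟩ | ⟨n2, m2, p2, q2, r2⟩ | ⟨n2, m2, p2, q2, r2⟩ <;>
    rcases n4 with ⟨n4, m4⟩ | ⟨n4, m4, p4, q4, r4⟩ | ⟨n4, m4, p4, q4, r4⟩ <;>
    simp_all

theorem cov_iff (h : Star u) (e x : Fin n) :
    Cov u e x ↔ x = fstV u e ∨ (0 < X u (fstV u e) x ∧ 0 < X u x (lstV u e)) := by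
  rw [Cov, proper_iff h]

/-- A direction inside the sector is a positive combination of the bounding ones, and the cone is
convex. -/
theorem InCone.between {e x y v : Fin n} (hx : InCone u e (u x)) (hy : InCone u e (u y))
    (hxy : 0 < X u x y) (hv : InArc u x y v) : InCone u e (u v) := by
  rcases hv with rfl | ⟨h1, h2⟩
  · exact hy
  · rw [← inCone_smul hxy, X, cross_smul_eq]
    exact hx.add hy h2.le h1.le

theorem InArc.pos {x y v : Fin n} (hxy : 0 < X u x y) (hv : InArc u x y v) : 0 < X u x v := by
  rcases hv with rfl | ⟨h1, h2⟩
  exacts [hxy, h1]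

open Classical in
/-- The indicator of a proposition. -/
noncomputable def ind (p : Prop) : ℤ := if p then 1 else 0

theorem ind_false {p : Prop} (h : ¬ p) : ind p = 0 := if_neg h

theorem ind_congr {p p' : Prop} (h : p ↔ p') : ind p = ind p' := by rw [propext h]

/-- The contribution of a single edge `f` to the change of a side count. While `f` and `e` share
directions, `f` stays on one side of `e`, so it enters the count at its first endpoint and leaves it
at its last. The half-open conventions match: `f` covers its first endpoint and not its last, and
the sector contains `y` and not `x`. The last two hypotheses exclude that `f` starts together with
`e` at `x` or ends together with `e` at `y`; at such a point the slopes tie and neither side is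
defined. -/
theorem arc_identity (h : Star u) {σ : ℝ} {e f x y : Fin n} (hef : e ≠ f) (hx : Cov u e x)
    (hy : Proper u e y ∨ y = lstV u e) (hxy : 0 < X u x y)
    (hx' : Proper u e x ∨ fstV u f ≠ x) (hy' : ¬ (lstV u f = y ∧ lstV u e = y)) :
    ind (Cov u f y ∧ Side u σ e f y) - ind (Cov u f x ∧ Side u σ e f x) =
      ind (InArc u x y (fstV u f) ∧ Side u σ e f (fstV u f)) -
      ind (InArc u x y (lstV u f) ∧ Side u σ e f (lstV u f)) := by
  have hxc := hx.inCone
  have hyc : InCone u e (u y) := by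
    rcases hy with hy | rfl
    exacts [hy.inCone, inCone_lst e]
  have hfst := inCone_fst (u := u) f
  have hlst := inCone_lst (u := u) f
  have hAB := X_fst_lst h f
  have hxA : fstV u f ≠ x ∨ (x ≠ fstV u e ∧ x ≠ lstV u e) := by
    rcases hx' with h1 | h1
    exacts [Or.inr ⟨h1.ne_fst, h1.ne_lst⟩, Or.inl h1]
  have hXs : ∀ v, X u v v = 0 := X_self
  have hAx : InArc u x y (fstV u f) → fstV u f ≠ fstV u e := by
    intro h1 h2
    have h3 := h1.pos hxy
    rcases hx with rfl | hp
    · rw [h2, hXs] at h3; exact lt_irrefl _ h3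
    · have := ((proper_iff h).1 hp).1
      rw [h2, X_comm] at h3; linarith
  have hBx : InArc u x y (lstV u f) → lstV u f ≠ fstV u e := by
    intro h1 h2
    have h3 := h1.pos hxy
    rcases hx with rfl | hp
    · rw [h2, hXs] at h3; exact lt_irrefl _ h3
    · have := ((proper_iff h).1 hp).1
      rw [h2, X_comm] at h3; linarith
  have hle : ∀ v, InArc u x y v → v = lstV u e → v = y := by
    intro v hv hve
    rcases hv with rfl | ⟨h1, h2⟩
    · rfl
    · rcases hy with hy | rfl
      · have := ((proper_iff h).1 hy).2
        rw [hve, X_comm] at h2; linarith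
      · exact hve
  have hcx : Cov u f x → slope u e (u x) ≠ slope u f (u x) := by
    intro hc
    apply slope_ne_of_ne_vertices h hef hxc hc.inCone
    rintro ⟨h1, h2⟩
    have h3 : x ≠ lstV u f := by
      rintro rfl
      rcases hc with h3 | h3
      · rw [← h3, hXs] at hAB; exact lt_irrefl _ hAB
      · exact h3.ne_lst rfl
    have h4 : x = fstV u f := h2.resolve_right h3
    rcases hxA with h5 | h5
    · exact h5 h4.symm
    · exact h1.elim h5.1 h5.2
  have nAB : fstV u f ≠ lstV u f := by
    intro h1; rw [h1, hXs] at hAB; exact lt_irrefl _ hAB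
  have kx : ¬ Cov u f x → ind (Cov u f x ∧ Side u σ e f x) = 0 := fun h => ind_false fun hc => h hc.1
  have ky : ¬ Cov u f y → ind (Cov u f y ∧ Side u σ e f y) = 0 := fun h => ind_false fun hc => h hc.1
  have kA : ¬ InArc u x y (fstV u f) → ind (InArc u x y (fstV u f) ∧ Side u σ e f (fstV u f)) = 0 :=
    fun h => ind_false fun hc => h hc.1
  have kB : ¬ InArc u x y (lstV u f) → ind (InArc u x y (lstV u f) ∧ Side u σ e f (lstV u f)) = 0 :=
    fun h => ind_false fun hc => h hc.1
  rcases arc_cases h (x := x) (y := y) hxy hAB with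
    ⟨h1, h2, h3, h4⟩ | ⟨h1, h2, h3, h4⟩ | ⟨h1, h2, h3, h4⟩ | ⟨h1, h2, h3, h4⟩ | ⟨h1, h2, h3, h4⟩ <;>
    beta_reduce at h3 h4 <;> rw [← cov_iff h] at h3 h4
  · rw [ky h4, kx h3]
    have hA := hxc.between hyc hxy h1
    have hB := hxc.between hyc hxy h2
    have hAl : fstV u f ≠ lstV u e := by
      intro h5
      have h6 := hle _ h1 h5
      rcases h2 with h7 | ⟨_, h7⟩
      · exact nAB (h6.trans h7.symm)
      · rw [← h6, X_comm] at h7; linarith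
    have hBl : lstV u f ≠ lstV u e := by
      intro h5
      have h6 := hle _ h2 h5
      exact hy' ⟨h6, h5 ▸ h6⟩
    have := side_iff h (σ := σ) hef hAB.ne' hA hB hfst hlst
      (slope_ne_of_ne_vertices h hef hA hfst fun hc => hc.1.elim (hAx h1) hAl)
      (slope_ne_of_ne_vertices h hef hB hlst fun hc => hc.1.elim (hBx h2) hBl)
    simp only [h1, h2, true_and, this, sub_self]
  · rw [kx h3, kB h2, sub_zero, sub_zero]
    apply ind_congr
    simp only [h1, h4, true_and]
    have hA := hxc.between hyc hxy h1
    by_cases hAy : fstV u f = y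
    · rw [hAy]
    have hfy : X u (fstV u f) y ≠ 0 := h.ne _ _ hAy
    have hyl : y ≠ lstV u f := by
      rintro rfl
      exact h2 (Or.inl rfl)
    exact (side_iff h hef hfy hA hyc hfst h4.inCone
      (slope_ne_of_ne_vertices h hef hA hfst fun hc => hc.1.elim (hAx h1) fun h5 => hAy (hle _ h1 h5))
      (slope_ne_of_ne_vertices h hef hyc h4.inCone fun hc =>
        hc.2.elim (fun h5 => hAy h5.symm) hyl)).symm
  · rw [ky h4, kA h1]
    have hB := hxc.between hyc hxy h2
    have hBl : lstV u f ≠ lstV u e := by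
      intro h5
      have h6 := hle _ h2 h5
      exact hy' ⟨h6, h5 ▸ h6⟩
    have := side_iff h (σ := σ) hef (h2.pos hxy).ne' hxc hB h3.inCone hlst (hcx h3)
      (slope_ne_of_ne_vertices h hef hB hlst fun hc => hc.1.elim (hBx h2) hBl)
    simp only [h2, h3, true_and, this]
  · rw [kA h1, kB h2]
    have hyA : y ≠ fstV u f := fun h5 => h1 (Or.inl h5.symm)
    have hyB : y ≠ lstV u f := fun h5 => h2 (Or.inl h5.symm)
    have := side_iff h (σ := σ) hef hxy.ne' hxc hyc h3.inCone h4.inCone (hcx h3)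
      (slope_ne_of_ne_vertices h hef hyc h4.inCone fun hc => hc.2.elim hyA hyB)
    simp only [h3, h4, true_and, this, sub_self]
  · rw [ky h4, kx h3, kA h1, kB h2]

end star

section star

variable {n : ℕ} {u : Fin n → ℂ}

/-! ### Counting the edges on a side of an edge -/

theorem ind_nonneg (p : Prop) : 0 ≤ ind p := by unfold ind; split_ifs <;> simp

theorem ind_le_one (p : Prop) : ind p ≤ 1 := by unfold ind; split_ifs <;> simp

open Classical in
/-- The sign of the area of an edge. -/
noncomputable def sgE (u : Fin n → ℂ) (e : Fin n) : ℤ := if 0 < area u e then 1 else -1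

theorem area_pv (v : Fin n) : area u (pv v) = -X u v (pv v) := by
  rw [area, nx_pv, X_comm]

theorem crit_iff (v : Fin n) : Crit u v ↔ area u v * area u (pv v) < 0 := by
  rw [area_pv, Crit, area, mul_neg, neg_lt_zero]

theorem sgE_eq_of_not_crit (h : Star u) {v : Fin n} (hv : ¬ Crit u v) : sgE u v = sgE u (pv v) := by
  rw [crit_iff, not_lt] at hv
  have h1 := h.area_ne v
  have h2 := h.area_ne (pv v)
  have h3 : 0 < area u v * area u (pv v) := lt_of_le_of_ne hv (mul_ne_zero h1 h2).symm
  unfold sgE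
  rcases mul_pos_iff.1 h3 with ⟨h4, h5⟩ | ⟨h4, h5⟩
  · simp [h4, h5]
  · simp [h4.not_gt, h5.not_gt]

/-- Two edges with the same first endpoint both leave it counterclockwise, so they lie on the same
side of the ray through it. The next lemma is the mirror image. -/
theorem crit_of_fst_eq (h : Star u) {e f : Fin n} (hef : e ≠ f) (he : fstV u e = fstV u f) :
    Crit u (fstV u e) := by
  rw [crit_iff]
  have h1 := h.area_ne e
  have h2 := h.area_ne f
  unfold fstV at *
  by_cases h3 : 0 < area u e <;> by_cases h4 : 0 < area u f <;>
    simp only [h3, h4, if_true, if_false] at he ⊢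
  · exact absurd he hef
  · rw [he, pv_nx, ← he]
    exact mul_neg_of_pos_of_neg h3 (lt_of_le_of_ne (not_lt.1 h4) h2)
  · rw [pv_nx, he]
    exact mul_neg_of_pos_of_neg h4 (lt_of_le_of_ne (not_lt.1 h3) h1)
  · exact absurd (nx_injective he) hef

theorem crit_of_lst_eq (h : Star u) {e f : Fin n} (hef : e ≠ f) (he : lstV u e = lstV u f) :
    Crit u (lstV u e) := by
  rw [crit_iff]
  have h1 := h.area_ne e
  have h2 := h.area_ne f
  unfold lstV at *
  by_cases h3 : 0 < area u e <;> by_cases h4 : 0 < area u f <;>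
    simp only [h3, h4, if_true, if_false] at he ⊢
  · exact absurd (nx_injective he) hef
  · rw [pv_nx, he]
    exact mul_neg_of_neg_of_pos (lt_of_le_of_ne (not_lt.1 h4) h2) h3
  · rw [he, pv_nx, ← he]
    exact mul_neg_of_neg_of_pos (lt_of_le_of_ne (not_lt.1 h3) h1) h4
  · exact absurd he hef

/-- The number of edges covering `x` on side `σ` of `e`. -/
noncomputable def sideCount (u : Fin n → ℂ) (σ : ℝ) (e x : Fin n) : ℤ :=
  ∑ f, ind (Cov u f x ∧ Side u σ e f x)

/-- Every edge has slope `1` at its own endpoints, so the side of an endpoint depends on the vertex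
only and not on the edge. Regrouping by vertices, each vertex collects the signs of its two incident
edges; they cancel unless the vertex is critical. -/
theorem sum_endpoints (h : Star u) (σ : ℝ) (e x y : Fin n) :
    ∑ f, (ind (InArc u x y (fstV u f) ∧ Side u σ e f (fstV u f)) -
      ind (InArc u x y (lstV u f) ∧ Side u σ e f (lstV u f))) =
    ∑ v, ind (InArc u x y v ∧ 0 < σ * (1 - slope u e (u v))) * (sgE u v - sgE u (pv v)) := by
  set I : Fin n → ℤ := fun v => ind (InArc u x y v ∧ 0 < σ * (1 - slope u e (u v))) with hI
  have h1 : ∀ f, ind (InArc u x y (fstV u f) ∧ Side u σ e f (fstV u f)) -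
      ind (InArc u x y (lstV u f) ∧ Side u σ e f (lstV u f)) =
      sgE u f * I f - sgE u f * I (nx f) := by
    intro f
    rw [Side, Side, slope_fst h, slope_lst h]
    change I (fstV u f) - I (lstV u f) = _
    unfold fstV lstV sgE
    split_ifs <;> ring
  have h2 : ∑ f, sgE u f * I (nx f) = ∑ v, sgE u (pv v) * I v := by
    rw [← Equiv.sum_comp (finRotate n) (fun v => sgE u (pv v) * I v)]
    refine Finset.sum_congr rfl fun f _ => ?_
    change _ = sgE u (pv (nx f)) * I (nx f)
    rw [pv_nx]
  rw [Finset.sum_congr rfl fun f _ => h1 f, Finset.sum_sub_distrib, h2, ← Finset.sum_sub_distrib]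
  exact Finset.sum_congr rfl fun v _ => by ring

theorem not_side_self (σ : ℝ) (e x : Fin n) : ¬ Side u σ e e x := by simp [Side]

theorem fst_ne_of_cov (h : Star u) {e f x : Fin n} (hef : e ≠ f) (hx : Cov u e x)
    (hx' : Proper u e x ∨ ¬ Crit u x) : Proper u e x ∨ fstV u f ≠ x := by
  rcases hx with rfl | hp
  · rcases hx' with h1 | h1
    · exact Or.inl h1
    · exact Or.inr fun h2 => h1 (crit_of_fst_eq h hef h2.symm)
  · exact Or.inl hp

/-- Summing `arc_identity` over all edges leaves a sum over the critical vertices in the sector, of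
which there are none. -/
theorem sideCount_eq (h : Star u) {σ : ℝ} {e x y : Fin n} (hx : Cov u e x)
    (hx' : Proper u e x ∨ ¬ Crit u x) (hy : Proper u e y ∨ y = lstV u e) (hxy : 0 < X u x y)
    (hv : ∀ v, InArc u x y v → ¬ Crit u v) :
    sideCount u σ e y = sideCount u σ e x := by
  rw [← sub_eq_zero, sideCount, sideCount, ← Finset.sum_sub_distrib]
  have h1 : ∀ f, ind (Cov u f y ∧ Side u σ e f y) - ind (Cov u f x ∧ Side u σ e f x) =
      ind (InArc u x y (fstV u f) ∧ Side u σ e f (fstV u f)) -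
      ind (InArc u x y (lstV u f) ∧ Side u σ e f (lstV u f)) := by
    intro f
    by_cases hef : e = f
    · subst hef
      simp [not_side_self]
    · refine arc_identity h hef hx hy hxy (fst_ne_of_cov h hef hx hx') ?_
      rintro ⟨h2, h3⟩
      have := crit_of_lst_eq h hef (h3.trans h2.symm)
      rw [h3] at this
      exact hv y (Or.inl rfl) this
  rw [Finset.sum_congr rfl fun f _ => h1 f, sum_endpoints h]
  refine Finset.sum_eq_zero fun v _ => ?_
  by_cases h2 : InArc u x y v
  · rw [sgE_eq_of_not_crit h (hv v h2), sub_self, mul_zero]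
  · rw [ind_false fun h3 => h2 h3.1, zero_mul]

/-- Here `y` may be critical. The bound is `2 + 2 + 2`: `arc_identity` may fail for the two edges
incident to `y`, by at most `2` each, and `y` itself contributes at most `2` to the sum over the
vertices. -/
theorem abs_sideCount_sub_le (h : Star u) {σ : ℝ} {e x y : Fin n} (hx : Cov u e x)
    (hx' : Proper u e x ∨ ¬ Crit u x) (hy : Proper u e y ∨ y = lstV u e) (hxy : 0 < X u x y)
    (hv : ∀ v, InArc u x y v → v ≠ y → ¬ Crit u v) :
    |sideCount u σ e y - sideCount u σ e x| ≤ 6 := by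
  rw [sideCount, sideCount, ← Finset.sum_sub_distrib]
  set L : Fin n → ℤ := fun f => ind (Cov u f y ∧ Side u σ e f y) - ind (Cov u f x ∧ Side u σ e f x)
  set Q : Fin n → ℤ := fun f => ind (InArc u x y (fstV u f) ∧ Side u σ e f (fstV u f)) -
      ind (InArc u x y (lstV u f) ∧ Side u σ e f (lstV u f))
  have h1 : ∀ f, f ≠ y → f ≠ pv y → L f - Q f = 0 := by
    intro f hf1 hf2
    rw [sub_eq_zero]
    by_cases hef : e = f
    · subst hef
      simp [L, Q, not_side_self]
    · refine arc_identity h hef hx hy hxy (fst_ne_of_cov h hef hx hx') ?_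
      rintro ⟨h2, -⟩
      rcases fst_or_lst (u := u) f with ⟨-, h4⟩ | ⟨-, h4⟩
      · rw [h4] at h2
        apply hf2; rw [← h2, pv_nx]
      · exact hf1 (h4.symm.trans h2)
  have h2 : ∀ f, |L f - Q f| ≤ 2 := by
    intro f
    have a1 := ind_nonneg (Cov u f y ∧ Side u σ e f y)
    have a2 := ind_nonneg (Cov u f x ∧ Side u σ e f x)
    have a3 := ind_nonneg (InArc u x y (fstV u f) ∧ Side u σ e f (fstV u f))
    have a4 := ind_nonneg (InArc u x y (lstV u f) ∧ Side u σ e f (lstV u f))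
    have b1 := ind_le_one (Cov u f y ∧ Side u σ e f y)
    have b2 := ind_le_one (Cov u f x ∧ Side u σ e f x)
    have b3 := ind_le_one (InArc u x y (fstV u f) ∧ Side u σ e f (fstV u f))
    have b4 := ind_le_one (InArc u x y (lstV u f) ∧ Side u σ e f (lstV u f))
    simp only [L, Q, abs_le]
    constructor <;> linarith
  have h3 : ∑ f, (L f - Q f) = (L y - Q y) + (L (pv y) - Q (pv y)) := by
    have hne := h.pv_ne y
    rw [← Finset.sum_pair (f := fun f => L f - Q f) hne.symm]
    symm
    apply Finset.sum_subset (Finset.subset_univ _)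
    intro f _ hf
    simp only [Finset.mem_insert, Finset.mem_singleton, not_or] at hf
    exact h1 f hf.1 hf.2
  have h4 : ∑ f, Q f = ind (InArc u x y y ∧ 0 < σ * (1 - slope u e (u y))) *
      (sgE u y - sgE u (pv y)) := by
    rw [sum_endpoints h]
    refine Finset.sum_eq_single y (fun v _ hvy => ?_) (by simp)
    by_cases h2 : InArc u x y v
    · rw [sgE_eq_of_not_crit h (hv v h2 hvy), sub_self, mul_zero]
    · rw [ind_false fun h3 => h2 h3.1, zero_mul]
  have h5 : ∑ f, L f = ∑ f, (L f - Q f) + ∑ f, Q f := by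
    rw [← Finset.sum_add_distrib]; exact Finset.sum_congr rfl fun f _ => by ring
  have h6 : |∑ f, Q f| ≤ 2 := by
    rw [h4, abs_mul]
    have c1 : |ind (InArc u x y y ∧ 0 < σ * (1 - slope u e (u y)))| ≤ 1 := by
      rw [abs_of_nonneg (ind_nonneg _)]; exact ind_le_one _
    have c2 : |sgE u y - sgE u (pv y)| ≤ 2 := by
      unfold sgE; split_ifs <;> simp
    calc _ ≤ 1 * 2 := mul_le_mul c1 c2 (abs_nonneg _) (by norm_num)
      _ = 2 := by norm_num
  rw [h5, h3]
  have h7 := abs_le.1 (h2 y)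
  have h8 := abs_le.1 (h2 (pv y))
  have h9 := abs_le.1 h6
  rw [abs_le]
  constructor <;> linarith

/-- At a common endpoint two edges have the same side counts. -/
theorem sideCount_congr {σ : ℝ} {e f x : Fin n} (hs : slope u e (u x) = slope u f (u x)) :
    sideCount u σ e x = sideCount u σ f x := by
  unfold sideCount Side
  rw [hs]

end star

section star

variable {n : ℕ} {u : Fin n → ℂ}

/-! ### The linear order of directions from a base vertex -/

open Classical in
/-- The part of the plane, relative to the base direction `z`: the ray, its left, its right. -/
noncomputable def half (u : Fin n → ℂ) (z a : Fin n) : ℤ :=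
  if 0 < X u z a then 1 else if X u z a < 0 then 2 else 0

/-- Counterclockwise order of the vertex directions, starting at the base vertex `z`. -/
def Lt (u : Fin n → ℂ) (z a b : Fin n) : Prop :=
  half u z a < half u z b ∨ (half u z a = half u z b ∧ 0 < X u a b)

theorem half_cases (h : Star u) (z a : Fin n) : (half u z a = 0 ∧ z = a) ∨
    (half u z a = 1 ∧ 0 < X u z a) ∨ (half u z a = 2 ∧ X u z a < 0) := by
  unfold half
  by_cases h1 : 0 < X u z a
  · simp [h1]
  · by_cases h2 : X u z a < 0
    · simp [h1, h2]
    · exact Or.inl ⟨by simp [h1, h2], h.eq_of_X (le_antisymm (not_lt.1 h1) (not_lt.1 h2))⟩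

theorem Lt.irrefl {z a : Fin n} : ¬ Lt u z a a := by simp [Lt, X_self]

/-- Inside an open half plane bounded by the line of `z` the orientation is transitive by the
Plücker relation of `z`, `a`, `b`, `c`. By general position that line carries no vertex except `z`,
which comes first. -/
theorem Lt.trans (h : Star u) {z a b c : Fin n} (hab : Lt u z a b) (hbc : Lt u z b c) :
    Lt u z a c := by
  have hp := X_plucker u z a b c
  rcases half_cases h z a with ⟨ha, rfl⟩ | ⟨ha, pa⟩ | ⟨ha, pa⟩ <;>
    rcases half_cases h z b with ⟨hb, rfl⟩ | ⟨hb, pb⟩ | ⟨hb, pb⟩ <;>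
    rcases half_cases h z c with ⟨hc, rfl⟩ | ⟨hc, pc⟩ | ⟨hc, pc⟩ <;>
    simp_all [Lt, X_self]
  · have := mul_pos pa hbc
    have := mul_pos pc hab
    by_contra h1
    have := mul_nonneg pb.le (neg_nonneg.2 (not_lt.1 h1))
    linarith
  · have := mul_neg_of_neg_of_pos pa hbc
    have := mul_neg_of_neg_of_pos pc hab
    by_contra h1
    have := mul_nonneg_of_nonpos_of_nonpos pb.le (not_lt.1 h1)
    linarith

theorem Lt.asymm (h : Star u) {z a b : Fin n} (hab : Lt u z a b) : ¬ Lt u z b a :=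
  fun hba => Lt.irrefl (hab.trans h hba)

theorem Lt.ne {z a b : Fin n} (hab : Lt u z a b) : a ≠ b := by
  rintro rfl; exact Lt.irrefl hab

theorem lt_or_lt (h : Star u) {z a b : Fin n} (hab : a ≠ b) : Lt u z a b ∨ Lt u z b a := by
  have hX := h.ne a b hab
  unfold Lt
  rcases lt_trichotomy (half u z a) (half u z b) with h1 | h1 | h1
  · exact Or.inl (Or.inl h1)
  · rcases hX.lt_or_gt with h2 | h2
    · exact Or.inr (Or.inr ⟨h1.symm, by rw [X_comm]; linarith⟩)
    · exact Or.inl (Or.inr ⟨h1, h2⟩)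
  · exact Or.inr (Or.inl h1)

theorem lt_base (h : Star u) {z a : Fin n} (hz : a ≠ z) : Lt u z z a := by
  left
  rcases half_cases h z a with ⟨ha, rfl⟩ | ⟨ha, pa⟩ | ⟨ha, pa⟩
  · exact absurd rfl hz
  all_goals rcases half_cases h z z with ⟨hb, -⟩ | ⟨hb, pb⟩ | ⟨hb, pb⟩
  all_goals first | (rw [X_self] at pb; exact absurd pb (lt_irrefl _)) | (rw [ha, hb]; norm_num)

/-- An angle below `π` in the linear order is an ordered triple. -/
theorem pos_of_lt_lt (h : Star u) {z x y w : Fin n} (hxy : Lt u z x y) (hyw : Lt u z y w)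
    (hxw : 0 < X u x w) : 0 < X u x y ∧ 0 < X u y w := by
  have hp := X_plucker u z x y w
  rcases half_cases h z x with ⟨ha, rfl⟩ | ⟨ha, pa⟩ | ⟨ha, pa⟩ <;>
    rcases half_cases h z y with ⟨hb, rfl⟩ | ⟨hb, pb⟩ | ⟨hb, pb⟩ <;>
    rcases half_cases h z w with ⟨hc, rfl⟩ | ⟨hc, pc⟩ | ⟨hc, pc⟩ <;>
    simp_all [Lt, X_self]
  · linarith
  · linarith
  · by_contra h1
    have := mul_nonneg pa.le (neg_nonneg.2 (not_lt.1 h1))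
    have := mul_pos pb hxw
    have := mul_neg_of_neg_of_pos pc hxy
    linarith
  · by_contra h1
    have := mul_nonneg_of_nonpos_of_nonpos pc.le (not_lt.1 h1)
    have := mul_pos pa hyw
    have := mul_neg_of_neg_of_pos pb hxw
    linarith

/-- An angle below `π` that contains the base direction. -/
theorem pos_of_lt_lt_wrap (h : Star u) {z x y w : Fin n} (hwx : Lt u z w x) (hxy : Lt u z x y)
    (hxw : 0 < X u x w) : 0 < X u x y ∧ 0 < X u y w := by
  have hp := X_plucker u z x y w
  have e1 := X_comm (u := u) w x
  rcases half_cases h z x with ⟨ha, rfl⟩ | ⟨ha, pa⟩ | ⟨ha, pa⟩ <;>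
    rcases half_cases h z y with ⟨hb, rfl⟩ | ⟨hb, pb⟩ | ⟨hb, pb⟩ <;>
    rcases half_cases h z w with ⟨hc, rfl⟩ | ⟨hc, pc⟩ | ⟨hc, pc⟩ <;>
    simp_all [Lt, X_self]
  all_goals try linarith
  · rw [X_comm]; linarith
  · by_contra h1
    have := mul_nonneg_of_nonpos_of_nonpos pa.le (not_lt.1 h1)
    have := mul_neg_of_neg_of_pos pb hxw
    have := mul_pos pc hxy
    linarith

/-- Converse of `pos_of_lt_lt`: a sector whose ends are in linear order does not contain the base
direction, so geometric betweenness is betweenness in the order. -/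
theorem lt_lt_of_pos (h : Star u) {z x v w : Fin n} (hxw : Lt u z x w) (hX : 0 < X u x w)
    (h1 : 0 < X u x v) (h2 : 0 < X u v w) : Lt u z x v ∧ Lt u z v w := by
  have hxv : x ≠ v := by rintro rfl; rw [X_self] at h1; exact lt_irrefl _ h1
  have hvw : v ≠ w := by rintro rfl; rw [X_self] at h2; exact lt_irrefl _ h2
  rcases lt_or_lt h (z := z) hxv with h3 | h3
  · refine ⟨h3, ?_⟩
    rcases lt_or_lt h (z := z) hvw with h4 | h4
    · exact h4
    · have := (pos_of_lt_lt h hxw h4 h1).2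
      rw [X_comm] at this; linarith
  · have := (pos_of_lt_lt h h3 hxw h2).1
    rw [X_comm] at this; linarith

/-! ### Walking along the boundary -/

open Classical in
/-- The other edge at the last endpoint of an edge. -/
noncomputable def succE (u : Fin n → ℂ) (e : Fin n) : Fin n := if 0 < area u e then nx e else pv e

open Classical in
/-- Advance to the next edge as long as the last endpoint of the edge is before the vertex `t`. -/
noncomputable def walkStep (u : Fin n → ℂ) (z t : Fin n) (s : Fin n × Fin n) : Fin n × Fin n :=
  if Lt u z s.1 (lstV u s.2) ∧ Lt u z (lstV u s.2) t then (lstV u s.2, succE u s.2) else s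

/-- At a noncritical vertex both incident edges have areas of the same sign, so the boundary passes
on counterclockwise. -/
theorem fst_succE (h : Star u) {e : Fin n} (hc : ¬ Crit u (lstV u e)) :
    fstV u (succE u e) = lstV u e := by
  rw [crit_iff, not_lt] at hc
  have h1 := h.area_ne e
  unfold lstV at hc
  unfold fstV succE lstV
  by_cases h2 : 0 < area u e
  · simp only [h2, if_true, pv_nx] at hc ⊢
    have h3 := h.area_ne (nx e)
    have h4 : 0 < area u (nx e) := lt_of_le_of_ne (nonneg_of_mul_nonneg_left hc h2) h3.symm
    simp [h4]
  · simp only [h2, if_false] at hc ⊢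
    have h3 : area u e < 0 := lt_of_le_of_ne (not_lt.1 h2) h1
    have h4 : ¬ 0 < area u (pv e) := fun h5 => by
      have := mul_neg_of_neg_of_pos h3 h5; linarith
    simp [h4]

/-- The situation of the walk from vertex `i` to vertex `t` at vertex `s.1` and edge `s.2`; `S` is
the number of edges on the two sides. -/
structure WalkInv (u : Fin n → ℂ) (z i t : Fin n) (S : ℝ → ℤ) (s : Fin n × Fin n) : Prop where
  cov : Cov u s.2 s.1
  proper : Proper u s.2 s.1 ∨ ¬ Crit u s.1
  left : s.1 = i ∨ Lt u z i s.1
  right : Lt u z s.1 t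
  count : ∀ σ, sideCount u σ s.2 s.1 = S σ

theorem Cov.X_lst (h : Star u) {e x : Fin n} (hx : Cov u e x) : 0 < X u x (lstV u e) := by
  rcases hx with rfl | hp
  exacts [X_fst_lst h e, ((proper_iff h).1 hp).2]

/-- The counts are constant along the edge up to its noncritical last endpoint. There the old and
the new edge both have slope `1`, so their side counts agree. -/
theorem WalkInv.step (h : Star u) {z i t : Fin n} {S : ℝ → ℤ} {s : Fin n × Fin n}
    (hc : ∀ v, Lt u z i v → Lt u z v t → ¬ Crit u v) (hs : WalkInv u z i t S s) :
    WalkInv u z i t S (walkStep u z t s) := by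
  unfold walkStep
  split_ifs with h1
  · obtain ⟨h1, h2⟩ := h1
    have hi : ∀ v, Lt u z s.1 v → Lt u z i v := by
      intro v hv
      rcases hs.left with h3 | h3
      · rwa [← h3]
      · exact h3.trans h hv
    have hB := hc _ (hi _ h1) h2
    have hf := fst_succE h hB
    have hX := hs.cov.X_lst h
    refine ⟨Or.inl hf.symm, Or.inr hB, Or.inr (hi _ h1), h2, fun σ => ?_⟩
    rw [← hs.count σ, ← sideCount_eq h hs.cov hs.proper (Or.inr rfl) hX]
    · apply sideCount_congr
      change slope u (succE u s.2) (u (lstV u s.2)) = _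
      rw [slope_lst h]
      conv_lhs => rw [← hf]
      exact slope_fst h _
    · intro v hv
      rcases hv with rfl | ⟨h3, h4⟩
      · exact hB
      · obtain ⟨h5, h6⟩ := lt_lt_of_pos h h1 hX h3 h4
        exact hc v (hi _ h5) (h6.trans h h2)
  · exact hs

/-- When no further step is possible, the last endpoint of the edge is `t`, or comes after `t`, or
has passed the base direction and precedes the current vertex. In all three cases the ray through
`t` meets the edge, and only `t` itself may be a critical vertex in the sector just traversed. -/
theorem WalkInv.arrive (h : Star u) {z i t : Fin n} {S : ℝ → ℤ} {s : Fin n × Fin n}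
    (hc : ∀ v, Lt u z i v → Lt u z v t → ¬ Crit u v) (hs : WalkInv u z i t S s)
    (h_end : ¬ (Lt u z s.1 (lstV u s.2) ∧ Lt u z (lstV u s.2) t)) :
    (Proper u s.2 t ∨ t = lstV u s.2) ∧ ∀ σ, |sideCount u σ s.2 t - S σ| ≤ 6 := by
  have hX := hs.cov.X_lst h
  have key : (t = lstV u s.2 ∨ 0 < X u t (lstV u s.2)) ∧ 0 < X u s.1 t := by
    by_cases ht : t = lstV u s.2
    · exact ⟨Or.inl ht, ht ▸ hX⟩
    rcases lt_or_lt h (z := z) ht with h1 | h1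
    · have := pos_of_lt_lt h hs.right h1 hX
      exact ⟨Or.inr this.2, this.1⟩
    -- This is the case of an edge that reaches across the base direction: its last endpoint is
    -- small in the linear order although it lies behind `t`.
    · have hne : s.1 ≠ lstV u s.2 := by
        intro h2; rw [← h2, X_self] at hX; exact lt_irrefl _ hX
      have h2 : Lt u z (lstV u s.2) s.1 := by
        rcases lt_or_lt h (z := z) hne with h3 | h3
        · exact absurd ⟨h3, h1⟩ h_end
        · exact h3
      have := pos_of_lt_lt_wrap h h2 hs.right hX
      exact ⟨Or.inr this.2, this.1⟩
  have hy : Proper u s.2 t ∨ t = lstV u s.2 := by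
    rcases key.1 with h1 | h1
    · exact Or.inr h1
    · refine Or.inl ((proper_iff h).2 ⟨?_, h1⟩)
      have hp := X_plucker u (fstV u s.2) s.1 t (lstV u s.2)
      rcases hs.cov with h2 | h2
      · rw [← h2]; exact key.2
      · have h3 := ((proper_iff h).1 h2).1
        have h4 := X_fst_lst h s.2
        by_contra h5
        have := mul_pos h3 h1
        have := mul_pos h4 key.2
        have := mul_nonneg (neg_nonneg.2 (not_lt.1 h5)) hX.le
        linarith
  refine ⟨hy, fun σ => ?_⟩
  rw [← hs.count σ]
  refine abs_sideCount_sub_le h hs.cov hs.proper hy key.2 fun v hv hvt => ?_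
  obtain ⟨h3, h4⟩ := hv.resolve_left hvt
  obtain ⟨h5, h6⟩ := lt_lt_of_pos h hs.right key.2 h3 h4
  refine hc v ?_ h6
  rcases hs.left with h7 | h7
  · rwa [← h7]
  · exact h7.trans h h5

theorem iterate_reaches {α : Type*} {f : α → α} {p : α → Prop} {μ : α → ℕ}
    (hμ : ∀ a, p a → μ (f a) < μ a) (hf : ∀ a, ¬ p a → f a = a) :
    ∀ (m : ℕ) (a : α), μ a ≤ m → ¬ p (f^[m] a)
  | 0, a, hm => fun hp => by
      have := hμ a hp
      omega
  | m + 1, a, hm => by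
      rw [Function.iterate_succ_apply]
      by_cases hp : p a
      · exact iterate_reaches hμ hf m (f a) (by have := hμ a hp; omega)
      · have : f^[m] (f a) = a := by
          rw [hf a hp, Function.iterate_fixed (hf a hp)]
        rw [this]
        exact hp

theorem walk_arrive (h : Star u) {z i t e : Fin n} (hit : Lt u z i t) (he : Proper u e i)
    (hc : ∀ v, Lt u z i v → Lt u z v t → ¬ Crit u v) :
    let s := (walkStep u z t)^[n] (i, e)
    (Proper u s.2 t ∨ t = lstV u s.2) ∧
      ∀ σ, |sideCount u σ s.2 t - sideCount u σ e i| ≤ 6 := by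
  classical
  intro s
  have h0 : WalkInv u z i t (fun σ => sideCount u σ e i) (i, e) :=
    ⟨Or.inr he, Or.inl he, Or.inl rfl, hit, fun _ => rfl⟩
  have hs : WalkInv u z i t (fun σ => sideCount u σ e i) s :=
    Function.Iterate.rec (WalkInv u z i t (fun σ => sideCount u σ e i)) h0
      (fun _ ha => WalkInv.step h hc ha) n
  refine hs.arrive h hc ?_
  -- Each proper step moves the current vertex forward, so the number of vertices after it drops;
  -- hence `n` iterations suffice and superfluous ones do nothing.
  refine iterate_reaches (f := walkStep u z t)
    (p := fun s => Lt u z s.1 (lstV u s.2) ∧ Lt u z (lstV u s.2) t)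
    (μ := fun s => (Finset.univ.filter fun v => Lt u z s.1 v).card) ?_ ?_ n (i, e) ?_
  · intro a ha
    simp only [walkStep, if_pos ha]
    apply Finset.card_lt_card
    rw [Finset.ssubset_iff_of_subset]
    · exact ⟨lstV u a.2, by simpa using ha.1, by simp [Lt.irrefl]⟩
    · intro v hv
      simp only [Finset.mem_filter, Finset.mem_univ, true_and] at hv ⊢
      exact ha.1.trans h hv
  · intro a ha
    exact if_neg ha
  · exact (Finset.card_le_univ _).trans (by simp)

end star

section star

variable {n : ℕ} {u : Fin n → ℂ}

/-! ### Ranks on a ray through a vertex -/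

/-- The distance, in units of the distance of vertex `i`, at which edge `e` is met. -/
noncomputable def dst (u : Fin n → ℂ) (i e : Fin n) : ℝ := (slope u e (u i))⁻¹

/-- The distance of an edge or of the origin. -/
noncomputable def odst (u : Fin n → ℂ) (i : Fin n) : Option (Fin n) → ℝ
  | none => 0
  | some e => dst u i e

open Classical in
/-- The edges that properly cross the ray through vertex `i`. -/
noncomputable def crossing (u : Fin n → ℂ) (i : Fin n) : Finset (Fin n) :=
  Finset.univ.filter fun f => Proper u f i

open Classical in
/-- The number of crossing edges closer than `τ`. -/
noncomputable def rk (u : Fin n → ℂ) (i : Fin n) (τ : ℝ) : ℕ :=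
  ((crossing u i).filter fun f => dst u i f < τ).card

open Classical in
/-- The number of crossing edges farther than `τ`. -/
noncomputable def above (u : Fin n → ℂ) (i : Fin n) (τ : ℝ) : ℕ :=
  ((crossing u i).filter fun f => τ < dst u i f).card

theorem mem_crossing {i f : Fin n} : f ∈ crossing u i ↔ Proper u f i := by simp [crossing]

theorem dst_pos (h : Star u) {i e : Fin n} (he : InCone u e (u i)) : 0 < dst u i e :=
  inv_pos.2 (he.slope_pos h (h.vertex_ne_zero i))

theorem dst_lt_iff (h : Star u) {i e f : Fin n} (he : InCone u e (u i)) (hf : InCone u f (u i)) :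
    dst u i f < dst u i e ↔ slope u e (u i) < slope u f (u i) :=
  inv_lt_inv₀ (hf.slope_pos h (h.vertex_ne_zero i)) (he.slope_pos h (h.vertex_ne_zero i))

theorem dst_left (h : Star u) (i : Fin n) : dst u i i = 1 := by rw [dst, slope_left h, inv_one]

theorem dst_pv (h : Star u) (i : Fin n) : dst u i (pv i) = 1 := by
  have := slope_right h (pv i)
  rw [nx_pv] at this
  rw [dst, this, inv_one]

theorem Proper.incident {e i : Fin n} (h : Proper u e i) : ¬ (i = e ∨ i = nx e) := by
  rintro (h1 | h1)
  exacts [h.ne_left h1, h.ne_right h1]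

theorem dst_ne (h : Star u) {i e f : Fin n} (hef : e ≠ f) (he : InCone u e (u i))
    (hf : Proper u f i) : dst u i e ≠ dst u i f := by
  intro h1
  exact slope_ne_of_not_incident h hef he hf.inCone (fun h2 => hf.incident h2.2) (inv_injective h1)

theorem dst_injective (h : Star u) {i e f : Fin n} (he : Proper u e i) (hf : Proper u f i)
    (hd : dst u i e = dst u i f) : e = f := by
  by_contra hef
  exact dst_ne h hef he.inCone hf hd

theorem dst_ne_one (h : Star u) {i f : Fin n} (hf : Proper u f i) : dst u i f ≠ 1 := by
  rw [← dst_left h i]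
  exact (dst_ne h (fun h1 => hf.ne_left h1) (inCone_left i) hf).symm

theorem rk_lt_of_lt {i f : Fin n} {τ : ℝ} (hf : Proper u f i) (hτ : dst u i f < τ) :
    rk u i (dst u i f) < rk u i τ := by
  classical
  apply Finset.card_lt_card
  rw [Finset.ssubset_iff_of_subset]
  · exact ⟨f, by simp [mem_crossing, hf, hτ], by simp⟩
  · intro g hg
    simp only [Finset.mem_filter] at hg ⊢
    exact ⟨hg.1, hg.2.trans hτ⟩

theorem rk_mono {i : Fin n} {τ τ' : ℝ} (hτ : τ ≤ τ') : rk u i τ ≤ rk u i τ' := by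
  classical
  apply Finset.card_le_card
  intro g hg
  simp only [Finset.mem_filter] at hg ⊢
  exact ⟨hg.1, hg.2.trans_le hτ⟩

theorem rk_injective (h : Star u) {i e f : Fin n} (he : Proper u e i) (hf : Proper u f i)
    (hr : rk u i (dst u i e) = rk u i (dst u i f)) : e = f := by
  apply dst_injective h he hf
  rcases lt_trichotomy (dst u i e) (dst u i f) with h1 | h1 | h1
  · exact absurd hr (rk_lt_of_lt he h1).ne
  · exact h1
  · exact absurd hr (rk_lt_of_lt hf h1).ne'

theorem rk_lt_iff {i e f : Fin n} (he : Proper u e i) :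
    rk u i (dst u i e) < rk u i (dst u i f) ↔ dst u i e < dst u i f := by
  refine ⟨fun h1 => ?_, rk_lt_of_lt he⟩
  by_contra h2
  exact absurd h1 (not_lt.2 (rk_mono (not_lt.1 h2)))

/-- Neither `f` itself nor edge `i`, which is incident to vertex `i`, is among the crossing edges in
front of `f`. -/
theorem rk_add_two_le (h : Star u) {i f : Fin n} (hf : Proper u f i) :
    rk u i (dst u i f) + 2 ≤ n := by
  classical
  have h1 : ((crossing u i).filter fun g => dst u i g < dst u i f) ⊆
      (Finset.univ.erase f).erase i := by
    intro g hg
    simp only [Finset.mem_filter, mem_crossing] at hg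
    simp only [Finset.mem_erase, Finset.mem_univ, and_true]
    refine ⟨fun h1 => hg.1.ne_left h1.symm, ?_⟩
    rintro rfl
    exact lt_irrefl _ hg.2
  have h2 := Finset.card_le_card h1
  rw [Finset.card_erase_of_mem (by
      simp only [Finset.mem_erase, Finset.mem_univ, and_true]; exact hf.ne_left),
    Finset.card_erase_of_mem (Finset.mem_univ _), Finset.card_univ, Fintype.card_fin] at h2
  have := h.three_le
  unfold rk
  omega

/-- `o` is a minimum, with respect to `lt`, of the elements satisfying `p`. -/
def IsBest {α : Type*} (p : α → Prop) (lt : α → α → Prop) (o : Option α) : Prop :=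
  (o = none → ∀ a, ¬ p a) ∧ ∀ b, o = some b → p b ∧ ∀ a, p a → ¬ lt a b

/-- The next crossing edge behind the distance `τ`. -/
def IsSucc (u : Fin n → ℂ) (i : Fin n) (τ : ℝ) : Option (Fin n) → Prop :=
  IsBest (fun f => Proper u f i ∧ τ < dst u i f) fun f g => dst u i f < dst u i g

/-- The next crossing edge in front of the distance `τ`. -/
def IsPred (u : Fin n → ℂ) (i : Fin n) (τ : ℝ) : Option (Fin n) → Prop :=
  IsBest (fun f => Proper u f i ∧ dst u i f < τ) fun f g => dst u i g < dst u i f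

open Classical in
/-- The number of crossing edges at distance `τ`. -/
noncomputable def level (u : Fin n → ℂ) (i : Fin n) (τ : ℝ) : ℕ :=
  ((crossing u i).filter fun f => dst u i f = τ).card

/-- Moving from a distance to the next crossing edge skips exactly the crossing edges at the old
distance; `level` is `1` at a crossing edge and `0` at the origin or at an incident edge. -/
theorem rk_add_level (i : Fin n) (τ : ℝ) (τ' : ℝ)
    (h1 : ∀ f, Proper u f i → (dst u i f < τ' ↔ dst u i f ≤ τ)) :
    rk u i τ' = rk u i τ + level u i τ := by
  classical
  unfold rk level
  rw [← Finset.card_union_of_disjoint]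
  · congr 1
    ext f
    simp only [Finset.mem_filter, Finset.mem_union, mem_crossing, ← and_or_left]
    refine and_congr_right fun hf => ?_
    rw [h1 f hf, le_iff_lt_or_eq]
  · rw [Finset.disjoint_filter]
    intro f _ h2 h3
    exact h2.ne h3

theorem above_add_level (i : Fin n) (τ : ℝ) (τ' : ℝ)
    (h1 : ∀ f, Proper u f i → (τ' < dst u i f ↔ τ ≤ dst u i f)) :
    above u i τ' = above u i τ + level u i τ := by
  classical
  unfold above level
  rw [← Finset.card_union_of_disjoint]
  · congr 1
    ext f
    simp only [Finset.mem_filter, Finset.mem_union, mem_crossing, ← and_or_left]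
    refine and_congr_right fun hf => ?_
    rw [h1 f hf, le_iff_lt_or_eq, eq_comm]
  · rw [Finset.disjoint_filter]
    intro f _ h2 h3
    exact h2.ne h3.symm

theorem level_of_proper (h : Star u) {i e : Fin n} (he : Proper u e i) :
    level u i (dst u i e) = 1 := by
  classical
  unfold level
  rw [Finset.card_eq_one]
  refine ⟨e, ?_⟩
  ext f
  simp only [Finset.mem_filter, mem_crossing, Finset.mem_singleton]
  exact ⟨fun h1 => dst_injective h h1.1 he h1.2, by rintro rfl; exact ⟨he, rfl⟩⟩

/-- An edge that meets the ray through `i`, or the origin. -/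
def OnRay (u : Fin n → ℂ) (i : Fin n) (o : Option (Fin n)) : Prop :=
  ∀ e, o = some e → InCone u e (u i)

/-- The position is on an edge that properly crosses the ray. -/
def OProper (u : Fin n → ℂ) (i : Fin n) (o : Option (Fin n)) : Prop :=
  ∃ e, o = some e ∧ Proper u e i

theorem level_of_not_proper (h : Star u) {i : Fin n} {o : Option (Fin n)} (ho : OnRay u i o)
    (hp : ¬ OProper u i o) : level u i (odst u i o) = 0 := by
  classical
  unfold level
  rw [Finset.card_eq_zero, Finset.filter_eq_empty_iff]
  intro f hf
  rw [mem_crossing] at hf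
  cases o with
  | none => exact (dst_pos h hf.inCone).ne'
  | some e =>
    have hef : e ≠ f := by rintro rfl; exact hp ⟨e, rfl, hf⟩
    exact (dst_ne h hef (ho e rfl) hf).symm

theorem IsSucc.rk_eq (h : Star u) {i f : Fin n} {τ : ℝ} (hf : IsSucc u i τ (some f)) :
    Proper u f i ∧ rk u i (dst u i f) = rk u i τ + level u i τ ∧
      above u i (dst u i f) + 1 = above u i τ := by
  obtain ⟨⟨h1, h2⟩, h3⟩ := hf.2 f rfl
  refine ⟨h1, rk_add_level i τ _ fun g hg => ⟨fun h4 => ?_, fun h4 => h4.trans_lt h2⟩, ?_⟩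
  · by_contra h5
    exact h3 g ⟨hg, not_le.1 h5⟩ h4
  · rw [above_add_level i (dst u i f) τ, level_of_proper h h1]
    refine fun g hg => ⟨fun h4 => ?_, fun h4 => h2.trans_le h4⟩
    by_contra h5
    exact h3 g ⟨hg, h4⟩ (not_le.1 h5)

theorem IsPred.rk_eq (h : Star u) {i f : Fin n} {τ : ℝ} (hf : IsPred u i τ (some f)) :
    Proper u f i ∧ rk u i (dst u i f) + 1 = rk u i τ ∧
      above u i (dst u i f) = above u i τ + level u i τ := by
  obtain ⟨⟨h1, h2⟩, h3⟩ := hf.2 f rfl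
  refine ⟨h1, ?_, above_add_level i τ _ fun g hg =>
    ⟨fun h4 => ?_, fun h4 => h2.trans_le h4⟩⟩
  · rw [rk_add_level i (dst u i f) τ, level_of_proper h h1]
    refine fun g hg => ⟨fun h4 => ?_, fun h4 => h4.trans_lt h2⟩
    by_contra h5
    exact h3 g ⟨hg, h4⟩ (not_le.1 h5)
  · by_contra h5
    exact h3 g ⟨hg, not_le.1 h5⟩ h4

theorem IsSucc.above_eq_zero {i : Fin n} {τ : ℝ} (hf : IsSucc u i τ none) : above u i τ = 0 := by
  classical
  unfold above
  rw [Finset.card_eq_zero, Finset.filter_eq_empty_iff]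
  intro f hf' hlt
  exact hf.1 rfl f ⟨mem_crossing.1 hf', hlt⟩

theorem IsPred.rk_eq_zero {i : Fin n} {τ : ℝ} (hf : IsPred u i τ none) : rk u i τ = 0 := by
  classical
  unfold rk
  rw [Finset.card_eq_zero, Finset.filter_eq_empty_iff]
  intro f hf' hlt
  exact hf.1 rfl f ⟨mem_crossing.1 hf', hlt⟩

open Classical in
/-- A bound for the number of moves from the position `o` to the crossing edge of rank `K`. -/
noncomputable def pot (u : Fin n → ℂ) (K : ℕ) (i : Fin n) (o : Option (Fin n)) : ℕ :=
  (if OProper u i o then 0 else 2) + (rk u i (odst u i o) - K) +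
    min (K - rk u i (odst u i o)) (above u i (odst u i o))

theorem oProper_some {i e : Fin n} : OProper u i (some e) ↔ Proper u e i := by simp [OProper]

/-- From a crossing edge of rank below `K`, the rank rises and the number of edges behind falls, so
the minimum in `pot` drops by one. From any other position the rank stays, and the summand `2`
disappears. -/
theorem IsSucc.pot_lt (h : Star u) {K : ℕ} {i f : Fin n} {o : Option (Fin n)}
    (ho : OnRay u i o) (hf : IsSucc u i (odst u i o) (some f))
    (hK : OProper u i o → rk u i (odst u i o) < K) : pot u K i (some f) < pot u K i o := by
  obtain ⟨h1, h2, h3⟩ := hf.rk_eq h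
  unfold pot
  rw [if_pos (oProper_some.2 h1), show odst u i (some f) = dst u i f from rfl]
  by_cases hp : OProper u i o
  · have := hK hp
    obtain ⟨e, rfl, he⟩ := hp
    simp only [odst] at h2 h3 this ⊢
    rw [level_of_proper h he] at h2
    rw [if_pos (oProper_some.2 he)]
    omega
  · rw [level_of_not_proper h ho hp] at h2
    rw [if_neg hp]
    omega

/-- The mirror image. From a position that is not a crossing edge this move is only made when
nothing lies behind; the minimum in `pot` is then zero before and after. -/
theorem IsPred.pot_lt (h : Star u) {K : ℕ} {i f : Fin n} {o : Option (Fin n)}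
    (ho : OnRay u i o) (hf : IsPred u i (odst u i o) (some f))
    (hK : OProper u i o → K < rk u i (odst u i o))
    (hK' : ¬ OProper u i o → above u i (odst u i o) = 0) : pot u K i (some f) < pot u K i o := by
  obtain ⟨h1, h2, h3⟩ := hf.rk_eq h
  unfold pot
  rw [if_pos (oProper_some.2 h1), show odst u i (some f) = dst u i f from rfl]
  by_cases hp : OProper u i o
  · have := hK hp
    obtain ⟨e, rfl, he⟩ := hp
    simp only [odst] at h2 h3 this ⊢
    rw [level_of_proper h he] at h3
    rw [if_pos (oProper_some.2 he)]
    omega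
  · rw [level_of_not_proper h ho hp] at h3
    have := hK' hp
    rw [if_neg hp]
    omega

theorem cov_or_incident {f i : Fin n} (hc : Cov u f i) : Proper u f i ∨ f = i ∨ f = pv i := by
  rcases hc with h1 | h1
  · rcases fst_or_lst (u := u) f with ⟨h2, -⟩ | ⟨h2, -⟩
    · exact Or.inr (Or.inl (h2.symm.trans h1.symm))
    · right; right; rw [h1, h2, pv_nx]
  · exact Or.inl h1

theorem sum_ind_eq_card (p : Fin n → Prop) [DecidablePred p] :
    ∑ f, ind (p f) = ((Finset.univ.filter p).card : ℤ) := by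
  rw [Finset.card_filter]
  push_cast
  refine Finset.sum_congr rfl fun f _ => ?_
  unfold ind
  split_ifs <;> rfl

/-- `sideCount` counts edges that cover the direction of `i`, whereas ranks count proper crossings;
only the two edges incident to `i` can make a difference. -/
theorem sideCount_bounds {i : Fin n} {σ : ℝ} {e : Fin n} (r : Fin n → Prop) [DecidablePred r]
    (hr : ∀ f, Proper u f i → (Side u σ e f i ↔ r f)) :
    (((crossing u i).filter r).card : ℤ) ≤ sideCount u σ e i ∧
      sideCount u σ e i ≤ ((crossing u i).filter r).card + 2 := by
  classical
  have h1 : sideCount u σ e i =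
      ((Finset.univ.filter fun f => Cov u f i ∧ Side u σ e f i).card : ℤ) := sum_ind_eq_card _
  rw [h1]
  constructor
  · norm_cast
    apply Finset.card_le_card
    intro f hf
    simp only [Finset.mem_filter, mem_crossing, Finset.mem_univ, true_and] at hf ⊢
    exact ⟨Or.inr hf.1, (hr f hf.1).2 hf.2⟩
  · have h2 : (Finset.univ.filter fun f => Cov u f i ∧ Side u σ e f i) ⊆
        ((crossing u i).filter r) ∪ {i, pv i} := by
      intro f hf
      simp only [Finset.mem_filter, mem_crossing, Finset.mem_univ, true_and, Finset.mem_union,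
        Finset.mem_insert, Finset.mem_singleton] at hf ⊢
      rcases cov_or_incident hf.1 with h3 | h3
      · exact Or.inl ⟨h3, (hr f h3).1 hf.2⟩
      · exact Or.inr h3
    have h3 := (Finset.card_le_card h2).trans (Finset.card_union_le _ _)
    have h4 : ({i, pv i} : Finset (Fin n)).card ≤ 2 := Finset.card_le_two
    norm_cast
    omega

theorem rk_sideCount (h : Star u) {i e : Fin n} (he : InCone u e (u i)) :
    (rk u i (dst u i e) : ℤ) ≤ sideCount u 1 e i ∧ sideCount u 1 e i ≤ rk u i (dst u i e) + 2 := by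
  classical
  refine sideCount_bounds _ fun f hf => ?_
  rw [dst_lt_iff h he hf.inCone, Side, one_mul, sub_pos]

theorem above_sideCount (h : Star u) {i e : Fin n} (he : InCone u e (u i)) :
    (above u i (dst u i e) : ℤ) ≤ sideCount u (-1) e i ∧
      sideCount u (-1) e i ≤ above u i (dst u i e) + 2 := by
  classical
  refine sideCount_bounds _ fun f hf => ?_
  rw [dst_lt_iff h hf.inCone he, Side, neg_one_mul, neg_sub, sub_pos]

/-- The position is at rank `K`, or at the last crossing edge if there are too few. -/
def Settled (u : Fin n → ℂ) (K : ℕ) (i e : Fin n) : Prop :=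
  Proper u e i ∧ (rk u i (dst u i e) = K ∨
    (rk u i (dst u i e) < K ∧ above u i (dst u i e) = 0))

/-- Passing between ranks and side counts loses at most `2` and the walk at most `6`, so the rank
and the number of edges behind grow by at most `8`, and the rank falls by at most `8`. Both
alternatives of `Settled` then keep the potential below `20`, with room to spare. -/
theorem pot_walk_le (h : Star u) {K : ℕ} {z i t e : Fin n} (hs : Settled u K i e)
    (hit : Lt u z i t) (hc : ∀ v, Lt u z i v → Lt u z v t → ¬ Crit u v) :
    OnRay u t (some ((walkStep u z t)^[n] (i, e)).2) ∧
    pot u K t (some ((walkStep u z t)^[n] (i, e)).2) ≤ 20 := by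
  classical
  obtain ⟨h1, h2⟩ := walk_arrive h hit hs.1 hc
  set e' := ((walkStep u z t)^[n] (i, e)).2
  have hcone : InCone u e' (u t) := by
    rcases h1 with h3 | h3
    · exact h3.inCone
    · rw [h3]; exact inCone_lst _
  refine ⟨fun f hf => by rwa [← Option.some.inj hf], ?_⟩
  have a1 := rk_sideCount h hcone
  have a2 := above_sideCount h hcone
  have a3 := rk_sideCount h hs.1.inCone
  have a4 := above_sideCount h hs.1.inCone
  have b1 := abs_le.1 (h2 1)
  have b2 := abs_le.1 (h2 (-1))
  have c := hs.2
  unfold pot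
  simp only [odst]
  split_ifs <;> omega

end star

section geometry

variable {n : ℕ}

/-! ### The polygon in polar coordinates around `q` -/

/-- The vertices relative to `q`. -/
def rel (P : Polygon ℂ n) (q : ℂ) (i : Fin n) : ℂ := P i - q

theorem mem_edgeSet_iff (P : Polygon ℂ n) (q x : ℂ) (e : Fin n) :
    q + x ∈ P.edgeSet ℝ e ↔ x ∈ segment ℝ (rel P q e) (rel P q (nx e)) := by
  rw [Polygon.edgeSet, affineSegment_eq_segment, ← mem_segment_translate ℝ q (x := x)]
  simp only [rel, add_sub_cancel]
  rfl

theorem mem_edgeSet_iff' (P : Polygon ℂ n) (q x : ℂ) (e : Fin n) :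
    x ∈ P.edgeSet ℝ e ↔ x - q ∈ segment ℝ (rel P q e) (rel P q (nx e)) := by
  rw [← mem_edgeSet_iff, add_sub_cancel]

theorem cross_ne_of_not_mem_line {q a b : ℂ} (hab : a ≠ b) (hq : q ∉ line[ℝ, a, b]) :
    cross (a - q) (b - q) ≠ 0 := by
  intro h0
  apply hq
  have hba : b - a ≠ 0 := sub_ne_zero.2 hab.symm
  have h1 : cross (b - a) (q - a) = 0 := by
    simp only [cross, Complex.sub_re, Complex.sub_im] at h0 ⊢
    linarith
  have h2 : ∃ r : ℝ, q - a = r • (b - a) := by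
    by_cases hre : (b - a).re = 0
    · have him : (b - a).im ≠ 0 := by
        intro him
        exact hba (Complex.ext hre him)
      refine ⟨(q - a).im / (b - a).im, Complex.ext ?_ ?_⟩
      · simp only [cross, hre, zero_mul, zero_sub, neg_eq_zero, mul_eq_zero, him, false_or] at h1
        rw [h1, Complex.smul_re, hre]; simp
      · rw [Complex.smul_im, smul_eq_mul, div_mul_cancel₀ _ him]
    · refine ⟨(q - a).re / (b - a).re, Complex.ext ?_ ?_⟩
      · rw [Complex.smul_re, smul_eq_mul, div_mul_cancel₀ _ hre]
      · rw [Complex.smul_im, smul_eq_mul]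
        field_simp
        simp only [cross] at h1
        linarith
  obtain ⟨r, hr⟩ := h2
  have h3 : q = AffineMap.lineMap a b r := by
    rw [AffineMap.lineMap_apply, vsub_eq_sub, ← hr]
    simp
  rw [h3]
  exact AffineMap.lineMap_mem_affineSpan_pair r a b

/-- From here on the hypotheses on the polygon are used mostly through `Star`. -/
theorem star_rel {P : Polygon ℂ n} {q : ℂ} (hs : IsSimple P) (hw : WeakGeneralPosition P q) :
    Star (rel P q) where
  three_le := hs.1
  ne i j hij := cross_ne_of_not_mem_line (fun h => hij (hs.2.1 h)) (hw i j hij)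
  simple e f hef x he hf := by
    rw [← mem_edgeSet_iff] at he hf
    rcases hs.2.2 e f hef (q + x) ⟨he, hf⟩ with ⟨h1, h2⟩ | ⟨h1, h2⟩
    · exact Or.inl ⟨h1, by rw [rel, ← h2]; ring⟩
    · exact Or.inr ⟨h1, by rw [rel, ← h2]; ring⟩

/-- The unit vector of angle `θ`. -/
noncomputable def unit (θ : ℝ) : ℂ := Complex.exp (θ * Complex.I)

theorem unit_ne_zero (θ : ℝ) : unit θ ≠ 0 := Complex.exp_ne_zero _

theorem polarPoint_eq (q : ℂ) (θ t : ℝ) : polarPoint q θ t = q + t • unit θ := by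
  rw [polarPoint, unit, Complex.real_smul]

theorem polarPoint_mem_iff {P : Polygon ℂ n} {q : ℂ} (h : Star (rel P q)) {θ t : ℝ} (ht : 0 ≤ t)
    {e : Fin n} : polarPoint q θ t ∈ P.edgeSet ℝ e ↔
      InCone (rel P q) e (unit θ) ∧ t * slope (rel P q) e (unit θ) = 1 := by
  rw [polarPoint_eq, mem_edgeSet_iff, smul_mem_segment_iff h ht]

theorem meets_iff {P : Polygon ℂ n} {q : ℂ} (h : Star (rel P q)) {θ : ℝ} {e : Fin n} :
    Meets P q θ e ↔ InCone (rel P q) e (unit θ) := by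
  constructor
  · rintro ⟨x, hx, t, ht, rfl⟩
    exact ((polarPoint_mem_iff h ht).1 hx).1
  · intro hc
    have hp := hc.slope_pos h (unit_ne_zero θ)
    have ht : 0 ≤ (slope (rel P q) e (unit θ))⁻¹ := (inv_pos.2 hp).le
    exact ⟨_, (polarPoint_mem_iff h ht).2 ⟨hc, inv_mul_cancel₀ hp.ne'⟩, _, ht, rfl⟩

theorem before_iff {P : Polygon ℂ n} {q : ℂ} (h : Star (rel P q)) {θ : ℝ} {a b : Fin n} :
    Before P q θ a b ↔ InCone (rel P q) a (unit θ) ∧ InCone (rel P q) b (unit θ) ∧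
      slope (rel P q) b (unit θ) < slope (rel P q) a (unit θ) := by
  constructor
  · rintro ⟨s, t, hs, hst, ha, hb⟩
    rw [polarPoint_mem_iff h hs] at ha
    rw [polarPoint_mem_iff h (hs.trans hst.le)] at hb
    refine ⟨ha.1, hb.1, ?_⟩
    have h1 := ha.1.slope_pos h (unit_ne_zero θ)
    have h2 := hb.1.slope_pos h (unit_ne_zero θ)
    by_contra h3
    have h4 := mul_le_mul hst.le (not_lt.1 h3) h1.le (hs.trans hst.le)
    have h5 : s * slope (rel P q) b (unit θ) < t * slope (rel P q) b (unit θ) :=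
      mul_lt_mul_of_pos_right hst h2
    have h6 : s * slope (rel P q) a (unit θ) ≤ s * slope (rel P q) b (unit θ) :=
      mul_le_mul_of_nonneg_left (not_lt.1 h3) hs
    linarith [ha.2, hb.2]
  · rintro ⟨ha, hb, hlt⟩
    have h1 := ha.slope_pos h (unit_ne_zero θ)
    have h2 := hb.slope_pos h (unit_ne_zero θ)
    exact ⟨_, _, (inv_pos.2 h1).le, (inv_lt_inv₀ h1 h2).2 hlt,
      (polarPoint_mem_iff h (inv_pos.2 h1).le).2 ⟨ha, inv_mul_cancel₀ h1.ne'⟩,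
      (polarPoint_mem_iff h (inv_pos.2 h2).le).2 ⟨hb, inv_mul_cancel₀ h2.ne'⟩⟩

theorem unit_angle (q z : ℂ) : ‖z - q‖ • unit (angle q z) = z - q := by
  have h1 : unit (angle q z) = Complex.exp (Complex.arg (z - q) * Complex.I) := by
    rw [unit, angle, toIcoMod]
    have := Complex.exp_mul_I_periodic.sub_zsmul_eq
      (x := ((Complex.arg (z - q) : ℝ) : ℂ)) (toIcoDiv Real.two_pi_pos 0 (Complex.arg (z - q)))
    rw [← this]
    push_cast
    simp
  rw [h1, Complex.real_smul, Complex.norm_mul_exp_arg_mul_I]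

variable {P : Polygon ℂ n} {q : ℂ}

theorem norm_rel_pos (h : Star (rel P q)) (i : Fin n) : 0 < ‖P i - q‖ :=
  norm_pos_iff.2 (h.vertex_ne_zero i)

theorem smul_unit_angle (i : Fin n) : ‖P i - q‖ • unit (angle q (P i)) = rel P q i :=
  unit_angle q (P i)

theorem inCone_unit_iff (h : Star (rel P q)) {i e : Fin n} :
    InCone (rel P q) e (unit (angle q (P i))) ↔ InCone (rel P q) e (rel P q i) := by
  rw [← smul_unit_angle, inCone_smul (norm_rel_pos h i)]

theorem meets_angle_iff (h : Star (rel P q)) {i e : Fin n} :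
    Meets P q (angle q (P i)) e ↔ InCone (rel P q) e (rel P q i) := by
  rw [meets_iff h, inCone_unit_iff h]

theorem before_angle_iff (h : Star (rel P q)) {i a b : Fin n} :
    Before P q (angle q (P i)) a b ↔ InCone (rel P q) a (rel P q i) ∧
      InCone (rel P q) b (rel P q i) ∧
      slope (rel P q) b (rel P q i) < slope (rel P q) a (rel P q i) := by
  rw [before_iff h, inCone_unit_iff h, inCone_unit_iff h]
  conv_rhs => rw [← smul_unit_angle (P := P) (q := q) i, slope_smul, slope_smul,
    mul_lt_mul_iff_right₀ (norm_rel_pos h i)]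
  rw [smul_unit_angle]

theorem isEnd_iff {i : Fin n} :
    IsEnd P q i ↔ X (rel P q) i (pv i) < 0 ∧ X (rel P q) i (nx i) < 0 := Iff.rfl

theorem isStart_iff {i : Fin n} :
    IsStart P q i ↔ 0 < X (rel P q) i (pv i) ∧ 0 < X (rel P q) i (nx i) := Iff.rfl

theorem isCritical_iff {i : Fin n} : IsCritical P q i ↔ Crit (rel P q) i := by
  rw [IsCritical, isEnd_iff, isStart_iff, Crit, mul_pos_iff]
  tauto

theorem mem_edge_iff_incident (h : Star (rel P q)) {i e : Fin n} :
    P i ∈ P.edgeSet ℝ e ↔ i = e ∨ i = nx e := by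
  rw [mem_edgeSet_iff' P q]
  change rel P q i ∈ _ ↔ _
  rw [← one_smul ℝ (rel P q i), smul_mem_segment_iff h zero_le_one, one_mul]
  constructor
  · rintro ⟨h1, h2⟩
    rcases (inCone_vertex_iff h).1 h1 with h3 | h3
    · exact absurd (by rw [dst, h2, inv_one]) (dst_ne_one h h3)
    · exact h3
  · rintro (rfl | rfl)
    exacts [⟨inCone_left _, slope_left h _⟩, ⟨inCone_right _, slope_right h _⟩]

/-- The crossings of the segment from `q` to `q + d` with the boundary. -/
theorem encard_crossings (h : Star (rel P q)) {d : ℂ} (hd0 : d ≠ 0)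
    (hd : ∀ j, cross (rel P q j) d = 0 → rel P q j = d) :
    {x | x ∈ openSegment ℝ q (q + d) ∧ x ∈ P.boundary ℝ ∧
      ∀ i, IsCritical P q i → x ≠ P i}.encard =
    {f | InCone (rel P q) f d ∧ 1 < slope (rel P q) f d}.encard := by
  have himg : {x | x ∈ openSegment ℝ q (q + d) ∧ x ∈ P.boundary ℝ ∧
      ∀ i, IsCritical P q i → x ≠ P i} = (fun f => q + (slope (rel P q) f d)⁻¹ • d) ''
      {f | InCone (rel P q) f d ∧ 1 < slope (rel P q) f d} := by
    ext x
    simp only [Set.mem_ofPred_eq, Set.mem_image, openSegment_eq_image', add_sub_cancel_left]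
    constructor
    · rintro ⟨⟨s, ⟨hs0, hs1⟩, rfl⟩, hb, -⟩
      obtain ⟨f, hf⟩ := Set.mem_iUnion.1 hb
      rw [mem_edgeSet_iff, smul_mem_segment_iff h hs0.le] at hf
      refine ⟨f, ⟨hf.1, ?_⟩, ?_⟩
      · have := hf.1.slope_pos h hd0
        by_contra h1
        have := mul_le_mul_of_nonneg_left (not_lt.1 h1) hs0.le
        linarith [hf.2]
      · rw [← eq_inv_of_mul_eq_one_left hf.2]
    · rintro ⟨f, ⟨hf, h1⟩, rfl⟩
      have hp := hf.slope_pos h hd0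
      have h2 : (slope (rel P q) f d)⁻¹ < 1 := inv_lt_one_of_one_lt₀ h1
      refine ⟨⟨_, ⟨inv_pos.2 hp, h2⟩, rfl⟩, Set.mem_iUnion.2 ⟨f, ?_⟩, ?_⟩
      · rw [mem_edgeSet_iff, smul_mem_segment_iff h (inv_pos.2 hp).le]
        exact ⟨hf, inv_mul_cancel₀ hp.ne'⟩
      · intro i _ hi
        have h3 : rel P q i = (slope (rel P q) f d)⁻¹ • d := by rw [rel, ← hi, add_sub_cancel_left]
        have h4 := hd i (by rw [h3, cross_smul_left, cross_self, mul_zero])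
        rw [h4] at h3
        have h5 : ((slope (rel P q) f d)⁻¹ - 1) • d = 0 := by
          rw [sub_smul, one_smul, ← h3, sub_self]
        rcases smul_eq_zero.1 h5 with h6 | h6
        · linarith
        · exact hd0 h6
  rw [himg, Set.InjOn.encard_image]
  -- Two edges through the same crossing point share a vertex on the ray. By `hd` this vertex is the
  -- endpoint of the segment, where the slope is `1` and not greater.
  rintro f ⟨hf, hf1⟩ g ⟨hg, hg1⟩ hfg
  by_contra hne
  have h1 : (slope (rel P q) f d)⁻¹ = (slope (rel P q) g d)⁻¹ := by
    have h2 := add_left_cancel hfg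
    exact smul_left_injective ℝ hd0 h2
  obtain ⟨w, hw, hc⟩ := exists_vertex_of_slope_eq h hne hd0 hf hg (inv_injective h1)
  have hwd := hd w hc
  rcases hw with ⟨h3, h4⟩ | ⟨h3, h4⟩
  · rw [← hwd, h4, slope_left h] at hg1
    exact lt_irrefl _ hg1
  · rw [← hwd, h4, slope_left h] at hf1
    exact lt_irrefl _ hf1

/-- The only vertex on the line through `q` and `P i` is `P i`, so every crossing of the open
segment belongs to exactly one properly crossing edge; the incident edges have slope `1` and do not
count. -/
theorem vertex_mem_visRegion_iff (h : Star (rel P q)) {i : Fin n} {k : ℕ} :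
    P i ∈ visRegion P q k ↔ rk (rel P q) i 1 ≤ k := by
  classical
  have hmem : P i ∈ region P :=
    Or.inl (Set.mem_iUnion.2 ⟨i, (mem_edge_iff_incident h).2 (Or.inl rfl)⟩)
  have h1 := encard_crossings h (d := rel P q i) (h.vertex_ne_zero i) fun j hj => by
    rw [h.eq_of_X (i := j) (j := i) hj]
  have h2 : q + rel P q i = P i := by rw [rel, add_sub_cancel]
  rw [h2] at h1
  have h3 : {f | InCone (rel P q) f (rel P q i) ∧ 1 < slope (rel P q) f (rel P q i)} =
      ((crossing (rel P q) i).filter fun f => dst (rel P q) i f < 1 : Finset (Fin n)) := by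
    ext f
    simp only [Set.mem_ofPred_eq, Finset.coe_filter, mem_crossing]
    constructor
    · rintro ⟨hc, h4⟩
      rcases (inCone_vertex_iff h).1 hc with h5 | h5 | h5
      · refine ⟨h5, ?_⟩
        exact inv_lt_one_of_one_lt₀ h4
      · rw [h5, slope_left h] at h4; exact absurd h4 (lt_irrefl _)
      · rw [h5, slope_right h] at h4; exact absurd h4 (lt_irrefl _)
    · rintro ⟨h5, h4⟩
      refine ⟨h5.inCone, ?_⟩
      have := h5.inCone.slope_pos h (h.vertex_ne_zero i)
      rwa [dst, inv_lt_one₀ this] at h4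
  rw [visRegion, Set.mem_ofPred_eq, h1, h3, Set.encard_coe_eq_coe_finsetCard, Nat.cast_le]
  exact ⟨fun h4 => h4.2, fun h4 => ⟨hmem, h4⟩⟩

end geometry

section geometry

variable {n : ℕ}

/-! ### The edge list of a ray through a critical vertex -/

/-- The orientation of the triangle formed by a vertex and its neighbours. -/
def turn (u : Fin n → ℂ) (i : Fin n) : ℝ := X u i (nx i) + X u (nx i) (pv i) + X u (pv i) i

open Classical in
/-- The incident edge of a critical vertex that is met second. -/
noncomputable def secondE (u : Fin n → ℂ) (i : Fin n) : Fin n :=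
  if 0 < turn u i * X u i (nx i) then i else pv i

open Classical in
/-- The incident edge of a critical vertex that is met first. -/
noncomputable def firstE (u : Fin n → ℂ) (i : Fin n) : Fin n :=
  if 0 < turn u i * X u i (nx i) then pv i else i

theorem one_sub_slope (u : Fin n → ℂ) (i : Fin n) (h : Star u) :
    (1 - slope u (pv i) (u (nx i))) * X u i (pv i) = - turn u i := by
  have h0 := h.area_ne (pv i)
  have h1 := area_pv (u := u) i
  have h2 : slope u (pv i) (u (nx i)) = (X u (pv i) (nx i) + X u (nx i) i) / area u (pv i) := by
    rw [slope, nx_pv]; rfl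
  have h3 : X u i (pv i) ≠ 0 := h.ne _ _ (h.pv_ne i).symm
  rw [h2, h1, turn, X_comm (pv i) (nx i), X_comm (nx i) i, X_comm (pv i) i]
  field_simp
  ring

/-- If the vertex and its neighbours were collinear, then, both neighbours lying on the same side,
the one closer in angle would lie on the edge to the other. This contradicts simplicity. -/
theorem turn_ne (u : Fin n → ℂ) (i : Fin n) (h : Star u) (hc : Crit u i) : turn u i ≠ 0 := by
  intro h0
  have h1 := one_sub_slope u i h
  have hpv : X u i (pv i) ≠ 0 := h.ne _ _ (h.pv_ne i).symm
  have hnp : X u (nx i) (pv i) ≠ 0 := h.ne _ _ (h.nx_ne_pv i)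
  rw [h0, neg_zero, mul_eq_zero, or_iff_left hpv, sub_eq_zero] at h1
  have hne : pv i ≠ i := h.pv_ne i
  have c1 : X u i (nx i) * X u i (pv i) > 0 := hc
  by_cases h2 : 0 < X u (nx i) (pv i) * X u i (pv i)
  · have hcone : InCone u (pv i) (u (nx i)) := by
      constructor
      · change 0 ≤ X u (pv i) (nx i) * area u (pv i)
        rw [area_pv, X_comm (pv i)]; linarith
      · rw [nx_pv]
        change 0 ≤ X u (nx i) i * area u (pv i)
        rw [area_pv, X_comm (nx i)]; linarith
    refine slope_ne_of_not_incident h hne hcone (inCone_right i) ?_ ?_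
    · rintro ⟨h3 | h3, -⟩
      · exact h.nx_ne_pv i h3
      · rw [nx_pv] at h3; exact h.nx_ne i h3
    · rw [← h1, slope_right h]
  · have h3 : X u (nx i) (pv i) * X u i (pv i) < 0 :=
      lt_of_le_of_ne (not_lt.1 h2) (mul_ne_zero hnp hpv)
    have hcone : InCone u i (u (pv i)) := by
      constructor
      · change 0 ≤ X u i (pv i) * area u i
        rw [area]; linarith
      · change 0 ≤ X u (pv i) (nx i) * area u i
        rw [area, X_comm (pv i)]
        rcases mul_pos_iff.1 c1 with ⟨a, b⟩ | ⟨a, b⟩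
        · have : X u (nx i) (pv i) < 0 := by
            by_contra h4; have := mul_nonneg (not_lt.1 h4) b.le; linarith
          nlinarith
        · have : 0 < X u (nx i) (pv i) := by
            by_contra h4; have := mul_nonneg_of_nonpos_of_nonpos (not_lt.1 h4) b.le; linarith
          nlinarith
    refine slope_ne_of_not_incident h hne (inCone_left (pv i)) hcone ?_ ?_
    · rintro ⟨-, h3 | h3⟩
      · exact hne h3
      · exact h.nx_ne_pv i h3.symm
    · rw [slope_left h, slope, X_comm] at *
      change 1 = (X u i (pv i) + X u (pv i) (nx i)) / X u i (nx i)
      have h5 : X u i (nx i) ≠ 0 := h.ne _ _ (h.nx_ne i).symm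
      rw [eq_div_iff h5]
      rw [turn] at h0
      rw [X_comm (pv i) (nx i), X_comm i (pv i)]
      linarith

theorem unit_add (θ ε : ℝ) : unit (θ + ε) =
    Real.cos ε • unit θ + Real.sin ε • (Complex.I * unit θ) := by
  have : unit (θ + ε) = unit θ * (Real.cos ε + Real.sin ε * Complex.I) := by
    rw [unit, unit, Complex.ofReal_cos, Complex.ofReal_sin, ← Complex.exp_mul_I, ← Complex.exp_add]
    push_cast
    ring_nf
  rw [this, Complex.real_smul, Complex.real_smul]
  ring

theorem cross_unit_I (θ : ℝ) : cross (unit θ) (Complex.I * unit θ) = 1 := by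
  have h1 : (unit θ).re = Real.cos θ := Complex.exp_ofReal_mul_I_re θ
  have h2 : (unit θ).im = Real.sin θ := Complex.exp_ofReal_mul_I_im θ
  simp only [cross, Complex.mul_re, Complex.mul_im, Complex.I_re, Complex.I_im, h1, h2]
  have := Real.cos_sq_add_sin_sq θ
  nlinarith

/-- The difference of the two slopes is a linear form that vanishes at `w`, hence a multiple of
`cross w`. -/
theorem slope_cross (u : Fin n → ℂ) (a b : Fin n) {w c d : ℂ} (hw : slope u a w = slope u b w) :
    (slope u a d - slope u b d) * cross w c = (slope u a c - slope u b c) * cross w d := by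
  have e1 : ∀ e, cross w c * slope u e d = cross d c * slope u e w + cross w d * slope u e c := by
    intro e
    rw [← slope_smul, cross_smul_eq w c d, slope_add]
  linear_combination e1 a - e1 b + cross d c * hw

theorem eventually_sin_pos {σ : ℝ} (hσ : σ ≠ 0) :
    ∀ᶠ ε : ℝ in 𝓝[>] 0, 0 < σ * Real.sin (σ * ε) := by
  have h1 : ∀ᶠ ε : ℝ in 𝓝[>] 0, ε < Real.pi / |σ| :=
    nhdsWithin_le_nhds (Iio_mem_nhds (div_pos Real.pi_pos (abs_pos.2 hσ)))
  filter_upwards [h1, self_mem_nhdsWithin] with ε h2 h3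
  rw [Set.mem_Ioi] at h3
  rw [lt_div_iff₀ (abs_pos.2 hσ)] at h2
  rcases hσ.lt_or_gt with h4 | h4
  · rw [abs_of_neg h4] at h2
    have := Real.sin_pos_of_pos_of_lt_pi (x := -(σ * ε)) (by nlinarith) (by linarith)
    rw [Real.sin_neg] at this
    nlinarith
  · rw [abs_of_pos h4] at h2
    have := Real.sin_pos_of_pos_of_lt_pi (x := σ * ε) (by positivity) (by linarith)
    positivity

/-- Used for an edge with one endpoint on the ray and the other endpoint `c` on side `σ` of it: rays
turned slightly towards `c` still meet the edge. -/
theorem eventually_inCone {u : Fin n → ℂ} {θ σ : ℝ} {e : Fin n} {c : ℂ}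
    (hpos : 0 < σ * cross (unit θ) c)
    (hi : (∃ r : ℝ, 0 < r ∧ u e = r • unit θ ∧ u (nx e) = c) ∨
      (∃ r : ℝ, 0 < r ∧ u (nx e) = r • unit θ ∧ u e = c)) :
    ∀ᶠ ε : ℝ in 𝓝[>] 0, InCone u e (unit (θ + σ * ε)) := by
  have hcont : Tendsto (fun ε : ℝ => σ * cross (unit (θ + σ * ε)) c) (𝓝[>] 0)
      (𝓝 (σ * cross (unit θ) c)) := by
    have : Continuous fun ε : ℝ => σ * cross (unit (θ + σ * ε)) c := by
      unfold cross unit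
      fun_prop
    have h2 := this.tendsto 0
    simp only [mul_zero, add_zero] at h2
    exact h2.mono_left nhdsWithin_le_nhds
  have hσ : σ ≠ 0 := by rintro rfl; simp at hpos
  have hsin := eventually_sin_pos hσ
  have hsq : 0 < σ ^ 2 := by positivity
  filter_upwards [hcont.eventually (lt_mem_nhds hpos), hsin] with ε h1 h2
  have h3 : cross (unit θ) (unit (θ + σ * ε)) = Real.sin (σ * ε) := by
    rw [unit_add, cross_add_right, cross_smul_right, cross_smul_right, cross_self, cross_unit_I]
    ring
  have key : 0 ≤ Real.sin (σ * ε) * cross (unit θ) c := by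
    have := mul_pos h2 hpos
    have h5 : σ * Real.sin (σ * ε) * (σ * cross (unit θ) c) =
      σ ^ 2 * (Real.sin (σ * ε) * cross (unit θ) c) := by ring
    rw [h5] at this
    exact ((mul_pos_iff_of_pos_left hsq).1 this).le
  have key2 : 0 ≤ cross (unit (θ + σ * ε)) c * cross (unit θ) c := by
    have := mul_pos h1 hpos
    have h5 : σ * cross (unit (θ + σ * ε)) c * (σ * cross (unit θ) c) =
      σ ^ 2 * (cross (unit (θ + σ * ε)) c * cross (unit θ) c) := by ring
    rw [h5] at this
    exact ((mul_pos_iff_of_pos_left hsq).1 this).le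
  rcases hi with ⟨r, hr, ha, hb⟩ | ⟨r, hr, ha, hb⟩
  · have harea : area u e = r * cross (unit θ) c := by rw [area, X, ha, hb, cross_smul_left]
    rw [InCone, harea, ha, hb, cross_smul_left, h3]
    constructor
    · have := mul_nonneg (mul_nonneg hr.le hr.le) key
      linarith
    · have := mul_nonneg hr.le key2
      linarith
  · have harea : area u e = -(r * cross (unit θ) c) := by
      rw [area, X, ha, hb, cross_smul_right, cross_comm]; ring
    rw [InCone, harea, ha, hb, cross_smul_right, cross_comm _ (unit θ), h3, cross_comm c]
    constructor
    · have := mul_nonneg hr.le key2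
      linarith
    · have := mul_nonneg (mul_nonneg hr.le hr.le) key
      linarith

end geometry

/-! ### The edge list and the windows in terms of crossing edges -/

section geometry

variable {n : ℕ} {P : Polygon ℂ n} {q : ℂ}

theorem firstE_ne_secondE (h : Star (rel P q)) (i : Fin n) :
    firstE (rel P q) i ≠ secondE (rel P q) i := by
  unfold firstE secondE
  have := h.pv_ne i
  split_ifs
  exacts [this, this.symm]

theorem rel_eq_smul (i : Fin n) : rel P q i = ‖P i - q‖ • unit (angle q (P i)) :=
  (smul_unit_angle i).symm

/-- Both incident edges have the same slope on the ray through the vertex, so after turning by `σ *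
ε` the difference of the slopes is `sin (σ * ε)` times a constant `κ`. By `one_sub_slope` the sign
of `κ` is determined by `turn`, so the order does not depend on the small `ε`. -/
theorem eventually_before (h : Star (rel P q)) {i : Fin n} {σ : ℝ}
    (h1 : 0 < σ * X (rel P q) i (pv i)) (h2 : 0 < σ * X (rel P q) i (nx i)) :
    ∀ᶠ ε : ℝ in 𝓝[>] 0, (Before P q (angle q (P i) + σ * ε) i (pv i) ↔
        turn (rel P q) i * X (rel P q) i (nx i) < 0) ∧
      (Before P q (angle q (P i) + σ * ε) (pv i) i ↔
        0 < turn (rel P q) i * X (rel P q) i (nx i)) := by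
  set u := rel P q with hu
  set w := unit (angle q (P i)) with hw
  have hσ : σ ≠ 0 := by rintro rfl; simp at h1
  have hr := norm_rel_pos h i
  have hui : u i = ‖P i - q‖ • w := rel_eq_smul i
  have hX : ∀ j, X u i j = ‖P i - q‖ * cross w (u j) := by
    intro j; rw [X, hui, cross_smul_left]
  have hpos : ∀ j, 0 < σ * X u i j → 0 < σ * cross w (u j) := by
    intro j hj
    rw [hX] at hj
    have : σ * (‖P i - q‖ * cross w (u j)) = ‖P i - q‖ * (σ * cross w (u j)) := by ring
    rw [this] at hj
    exact (mul_pos_iff_of_pos_left hr).1 hj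
  have c1 := eventually_inCone (u := u) (e := i) (hpos _ h2) (Or.inl ⟨_, hr, hui, rfl⟩)
  have c2 := eventually_inCone (u := u) (e := pv i) (hpos _ h1)
    (Or.inr ⟨_, hr, by rw [nx_pv]; exact hui, rfl⟩)
  have hw1 : slope u i w = slope u (pv i) w := by
    have e1 := slope_left h i
    have e2 := slope_right h (pv i)
    rw [nx_pv] at e2
    change slope u i (u i) = 1 at e1
    change slope u (pv i) (u i) = 1 at e2
    rw [hui, slope_smul] at e1 e2
    exact mul_left_cancel₀ hr.ne' (e1.trans e2.symm)
  set κ := slope u i (Complex.I * w) - slope u (pv i) (Complex.I * w) with hκ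
  have hk1 := slope_cross u i (pv i) (c := u (nx i)) (d := Complex.I * w) hw1
  rw [slope_right h, cross_unit_I, ← hκ] at hk1
  have hk2 := one_sub_slope u i h
  have hk3 : κ * (X u i (nx i) * X u i (pv i)) = -(‖P i - q‖ * turn u i) := by
    rw [hX (nx i)]
    linear_combination (‖P i - q‖ * X u i (pv i)) * hk1 + ‖P i - q‖ * hk2
  have hcp : 0 < X u i (nx i) * X u i (pv i) := by
    have := mul_pos h1 h2
    have h3 : σ * X u i (pv i) * (σ * X u i (nx i)) = σ ^ 2 * (X u i (nx i) * X u i (pv i)) := by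
      ring
    rw [h3] at this
    exact (mul_pos_iff_of_pos_left (by positivity)).1 this
  filter_upwards [c1, c2, eventually_sin_pos hσ] with ε d1 d2 d3
  have hs : slope u i (unit (angle q (P i) + σ * ε)) - slope u (pv i) (unit (angle q (P i) + σ * ε))
      = Real.sin (σ * ε) * κ := by
    rw [unit_add, slope_add, slope_add, hw1]; ring
  -- the sign of the difference of the slopes
  have hsign : Real.sin (σ * ε) * κ * ((σ * Real.sin (σ * ε)) * (σ * X u i (nx i)) *
      (X u i (nx i) * X u i (pv i))) = -(σ ^ 2 * Real.sin (σ * ε) ^ 2 * ‖P i - q‖) *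
        (turn u i * X u i (nx i)) := by
    linear_combination (Real.sin (σ * ε) * (σ * Real.sin (σ * ε)) * (σ * X u i (nx i))) * hk3
  have hA : 0 < (σ * Real.sin (σ * ε)) * (σ * X u i (nx i)) * (X u i (nx i) * X u i (pv i)) := by
    positivity
  have hsin0 : Real.sin (σ * ε) ≠ 0 := by
    intro h0; rw [h0] at d3; simp at d3
  have hB : 0 < σ ^ 2 * Real.sin (σ * ε) ^ 2 * ‖P i - q‖ := by positivity
  rw [before_iff h, before_iff h]
  simp only [← hu, d1, d2, true_and]
  have e1 : slope u (pv i) (unit (angle q (P i) + σ * ε)) < slope u i (unit (angle q (P i) + σ * ε)) ↔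
      0 < Real.sin (σ * ε) * κ := by rw [← hs, sub_pos]
  have e2 : slope u i (unit (angle q (P i) + σ * ε)) < slope u (pv i) (unit (angle q (P i) + σ * ε)) ↔
      Real.sin (σ * ε) * κ < 0 := by rw [← hs, sub_neg]
  rw [e1, e2]
  constructor
  · rw [← mul_pos_iff_of_pos_right hA, hsign, neg_mul, neg_pos]
    constructor
    · intro h3; by_contra h4; have := mul_nonneg hB.le (not_lt.1 h4); linarith
    · intro h3; exact mul_neg_of_pos_of_neg hB h3
  · constructor
    · intro h3
      have h4 := mul_neg_of_neg_of_pos h3 hA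
      rw [hsign] at h4
      by_contra h5
      have := mul_nonneg hB.le (neg_nonneg.2 (not_lt.1 h5))
      linarith
    · intro h3
      by_contra h5
      have h6 := mul_nonneg (not_lt.1 h5) hA.le
      rw [hsign] at h6
      have := mul_pos hB h3
      linarith

theorem not_before_self (h : Star (rel P q)) {θ : ℝ} {a : Fin n} : ¬ Before P q θ a a := by
  rw [before_iff h]; simp

/-- End and start vertices are the cases `σ = -1` and `σ = 1` of `eventually_before`; `firstE` and
`secondE` are defined by the sign found there. -/
theorem precedes_incident_iff (h : Star (rel P q)) {i a b : Fin n} (hc : Crit (rel P q) i)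
    (ha : a = i ∨ a = pv i) (hb : b = i ∨ b = pv i) :
    ((IsEnd P q i ∧ ∀ᶠ ε : ℝ in 𝓝[>] 0, Before P q (angle q (P i) - ε) a b) ∨
      (IsStart P q i ∧ ∀ᶠ ε : ℝ in 𝓝[>] 0, Before P q (angle q (P i) + ε) a b)) ↔
    a = firstE (rel P q) i ∧ b = secondE (rel P q) i := by
  have hne := h.pv_ne i
  have ht := turn_ne _ _ h hc
  have hX : X (rel P q) i (nx i) ≠ 0 := h.ne _ _ (h.nx_ne i).symm
  have key : ∀ σ : ℝ, 0 < σ * X (rel P q) i (pv i) → 0 < σ * X (rel P q) i (nx i) →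
      ((∀ᶠ ε : ℝ in 𝓝[>] 0, Before P q (angle q (P i) + σ * ε) a b) ↔
        a = firstE (rel P q) i ∧ b = secondE (rel P q) i) := by
    intro σ h1 h2
    have hev := eventually_before h h1 h2
    have hconst : ∀ {p : ℝ → Prop} {r : Prop}, (∀ᶠ ε : ℝ in 𝓝[>] 0, (p ε ↔ r)) →
        ((∀ᶠ ε : ℝ in 𝓝[>] 0, p ε) ↔ r) := by
      intro p r hp
      rw [eventually_congr hp, eventually_const]
    unfold firstE secondE
    rcases ha with rfl | rfl <;> rcases hb with rfl | rfl
    · rw [hconst (r := False) (Eventually.of_forall fun ε => by simp [not_before_self h])]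
      split_ifs <;> simp [hne.symm]
    · rw [hconst (hev.mono fun ε hε => hε.1)]
      split_ifs with h3
      · simp [hne.symm, h3.le]
      · simp only [true_and, iff_true]
        exact lt_of_le_of_ne (not_lt.1 h3) (mul_ne_zero ht hX)
    · rw [hconst (hev.mono fun ε hε => hε.2)]
      split_ifs with h3
      · simp [h3]
      · simp [h3, hne]
    · rw [hconst (r := False) (Eventually.of_forall fun ε => by simp [not_before_self h])]
      split_ifs <;> simp [hne]
  rw [isEnd_iff, isStart_iff]
  rcases mul_pos_iff.1 hc with ⟨h1, h2⟩ | ⟨h1, h2⟩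
  · have := key 1 (by linarith) (by linarith)
    simp only [one_mul] at this
    rw [this]
    simp [h1, h2, h1.not_gt, h2.not_gt]
  · have := key (-1) (by linarith) (by linarith)
    simp only [neg_one_mul, ← sub_eq_add_neg] at this
    rw [this]
    simp [h1, h2, h1.not_gt, h2.not_gt]

theorem incident_iff {i e : Fin n} : (i = e ∨ i = nx e) ↔ (e = i ∨ e = pv i) := by
  constructor
  · rintro (rfl | rfl)
    · exact Or.inl rfl
    · exact Or.inr (pv_nx e).symm
  · rintro (rfl | rfl)
    · exact Or.inl rfl
    · exact Or.inr (nx_pv i).symm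

theorem precedes_iff (h : Star (rel P q)) {i a b : Fin n} (hc : Crit (rel P q) i) :
    Precedes P q i a b ↔
      (InCone (rel P q) a (rel P q i) ∧ InCone (rel P q) b (rel P q i) ∧
        dst (rel P q) i a < dst (rel P q) i b) ∨
      (a = firstE (rel P q) i ∧ b = secondE (rel P q) i) := by
  rw [Precedes, before_angle_iff h, mem_edge_iff_incident h, mem_edge_iff_incident h,
    incident_iff, incident_iff]
  have hinc : a = firstE (rel P q) i ∧ b = secondE (rel P q) i →
      (a = i ∨ a = pv i) ∧ (b = i ∨ b = pv i) := by
    unfold firstE secondE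
    split_ifs <;> rintro ⟨rfl, rfl⟩ <;> simp
  refine or_congr ?_ ?_
  · refine and_congr_right fun h1 => and_congr_right fun h2 => ?_
    rw [dst_lt_iff h h2 h1]
  · rw [← and_assoc]
    constructor
    · rintro ⟨h1, h2⟩
      exact (precedes_incident_iff h hc h1.1 h1.2).1 h2
    · intro h1
      have h2 := hinc h1
      exact ⟨h2, (precedes_incident_iff h hc h2.1 h2.2).2 h1⟩

theorem inCone_iff_crossing (h : Star (rel P q)) {i e : Fin n} :
    InCone (rel P q) e (rel P q i) ↔
      Proper (rel P q) e i ∨ e = firstE (rel P q) i ∨ e = secondE (rel P q) i := by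
  rw [inCone_vertex_iff h, incident_iff]
  unfold firstE secondE
  split_ifs <;> tauto

theorem dst_firstE (h : Star (rel P q)) (i : Fin n) :
    dst (rel P q) i (firstE (rel P q) i) = 1 := by
  unfold firstE
  split_ifs
  exacts [dst_pv h i, dst_left h i]

theorem dst_secondE (h : Star (rel P q)) (i : Fin n) :
    dst (rel P q) i (secondE (rel P q) i) = 1 := by
  unfold secondE
  split_ifs
  exacts [dst_left h i, dst_pv h i]

theorem firstE_not_proper (h : Star (rel P q)) (i : Fin n) :
    ¬ Proper (rel P q) (firstE (rel P q) i) i :=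
  fun hp => dst_ne_one h hp (dst_firstE h i)

theorem secondE_not_proper (h : Star (rel P q)) (i : Fin n) :
    ¬ Proper (rel P q) (secondE (rel P q) i) i :=
  fun hp => dst_ne_one h hp (dst_secondE h i)

/-- The edges in front of a given edge in the edge list. -/
theorem ncard_precedes (h : Star (rel P q)) {i e : Fin n} (hc : Crit (rel P q) i) :
    (Proper (rel P q) e i →
      {a | Meets P q (angle q (P i)) a ∧ Precedes P q i a e}.ncard =
        rk (rel P q) i (dst (rel P q) i e) + if 1 < dst (rel P q) i e then 2 else 0) ∧
    {a | Meets P q (angle q (P i)) a ∧ Precedes P q i a (firstE (rel P q) i)}.ncard =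
      rk (rel P q) i 1 ∧
    {a | Meets P q (angle q (P i)) a ∧ Precedes P q i a (secondE (rel P q) i)}.ncard =
      rk (rel P q) i 1 + 1 := by
  classical
  have hne := firstE_ne_secondE h i
  have hF := firstE_not_proper h i
  have hS := secondE_not_proper h i
  have dF := dst_firstE h i
  have dS := dst_secondE h i
  have cF : InCone (rel P q) (firstE (rel P q) i) ((rel P q) i) := (inCone_iff_crossing h).2 (Or.inr (Or.inl rfl))
  have cS : InCone (rel P q) (secondE (rel P q) i) ((rel P q) i) := (inCone_iff_crossing h).2 (Or.inr (Or.inr rfl))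
  simp only [meets_angle_iff h, precedes_iff h hc] at *
  -- The predecessors of `e` are the closer crossing edges, both incident edges if `e` lies behind
  -- the vertex, and `firstE` if `e` is `secondE`.
  have main : ∀ e, InCone (rel P q) e ((rel P q) i) →
      {a | InCone (rel P q) a ((rel P q) i) ∧ ((InCone (rel P q) a ((rel P q) i) ∧ InCone (rel P q) e ((rel P q) i) ∧ dst (rel P q) i a < dst (rel P q) i e) ∨
        (a = firstE (rel P q) i ∧ e = secondE (rel P q) i))} =
      (((crossing (rel P q) i).filter fun f => dst (rel P q) i f < dst (rel P q) i e) ∪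
        ((if 1 < dst (rel P q) i e then {firstE (rel P q) i, secondE (rel P q) i} else ∅) ∪
        (if e = secondE (rel P q) i then {firstE (rel P q) i} else ∅)) : Finset (Fin n)) := by
    intro e he
    ext a
    simp only [Set.mem_ofPred_eq, Finset.coe_union, Set.mem_union, Finset.mem_coe,
      Finset.mem_filter, mem_crossing]
    constructor
    · rintro ⟨h1, ⟨-, -, h2⟩ | ⟨h2, h3⟩⟩
      · rcases (inCone_iff_crossing h).1 h1 with h4 | h4 | h4
        · exact Or.inl ⟨h4, h2⟩
        · right; left
          rw [h4, dF] at h2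
          simp [h2, h4]
        · right; left
          rw [h4, dS] at h2
          simp [h2, h4]
      · right; right
        simp [h2, h3]
    · rintro (⟨h1, h2⟩ | h1 | h1)
      · exact ⟨h1.inCone, Or.inl ⟨h1.inCone, he, h2⟩⟩
      · split_ifs at h1 with h3
        · simp only [Finset.mem_insert, Finset.mem_singleton] at h1
          rcases h1 with rfl | rfl
          · exact ⟨cF, Or.inl ⟨cF, he, by rw [dF]; exact h3⟩⟩
          · exact ⟨cS, Or.inl ⟨cS, he, by rw [dS]; exact h3⟩⟩
        · simp at h1
      · split_ifs at h1 with h3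
        · rw [Finset.mem_singleton] at h1
          exact ⟨h1 ▸ cF, Or.inr ⟨h1, h3⟩⟩
        · simp at h1
  refine ⟨fun hp => ?_, ?_, ?_⟩
  · rw [main e hp.inCone, Set.ncard_coe_finset, rk, Finset.card_union_of_disjoint]
    · have h1 : e ≠ secondE (rel P q) i := by rintro rfl; exact hS hp
      rw [if_neg h1, Finset.union_empty]
      split_ifs
      · rw [Finset.card_pair hne]
      · simp
    · rw [Finset.disjoint_left]
      intro a ha hb
      have h1 : e ≠ secondE (rel P q) i := by rintro rfl; exact hS hp
      rw [if_neg h1, Finset.union_empty] at hb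
      have h2 := mem_crossing.1 (Finset.mem_filter.1 ha).1
      split_ifs at hb
      · simp only [Finset.mem_insert, Finset.mem_singleton] at hb
        rcases hb with rfl | rfl
        exacts [hF h2, hS h2]
      · simp at hb
  · rw [main _ cF, Set.ncard_coe_finset, rk, dF, if_neg (lt_irrefl _), if_neg hne]
    simp
  · have hm := main _ cS
    simp only [if_true] at hm
    rw [hm, Set.ncard_coe_finset, rk, dS, if_neg (lt_irrefl _), Finset.empty_union,
      Finset.card_union_of_disjoint, Finset.card_singleton]
    rw [Finset.disjoint_singleton_right]
    intro h1
    exact hF (mem_crossing.1 (Finset.mem_filter.1 h1).1)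

/-- The window on the ray through vertex `i`, in terms of the crossing edges. -/
def Win (u : Fin n → ℂ) (K : ℕ) (i a b : Fin n) : Prop :=
  Crit u i ∧ rk u i 1 ≤ K ∧ (Proper u b i ∧ rk u i (dst u i b) = K) ∧
    ((rk u i 1 = K ∧ a = secondE u i) ∨
      (rk u i 1 < K ∧ Proper u a i ∧ rk u i (dst u i a) + 1 = K))

theorem rk_one_le_iff (h : Star (rel P q)) {i e : Fin n} (he : Proper (rel P q) e i) :
    1 < dst (rel P q) i e ↔ rk (rel P q) i 1 ≤ rk (rel P q) i (dst (rel P q) i e) := by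
  constructor
  · intro h1; exact rk_mono h1.le
  · intro h1
    by_contra h2
    have h3 : dst (rel P q) i e < 1 := lt_of_le_of_ne (not_lt.1 h2) (dst_ne_one h he)
    exact absurd (rk_lt_of_lt he h3) (not_lt.2 h1)

/-- With `r = rk i 1`, a crossing edge of rank `s` has place `s + 1` if `s < r` and place `s + 3`
otherwise, while the incident edges have places `r + 1` and `r + 2`. Visibility means `r ≤ K`, so
place `K + 3` belongs to rank `K`, and place `K + 2` to `secondE` or to rank `K - 1`. -/
theorem hasWindow_iff (h : Star (rel P q)) {K : ℕ} {i a b : Fin n} :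
    HasWindow P q K i a b ↔ Win (rel P q) K i a b := by
  rw [HasWindow, Win, isCritical_iff, vertex_mem_visRegion_iff h]
  refine and_congr_right fun hc => and_congr_right fun hv => ?_
  have hnth : ∀ j e, IsNthEdge P q i j e ↔
      (Proper (rel P q) e i ∧ rk (rel P q) i (dst (rel P q) i e) +
        (if 1 < dst (rel P q) i e then 2 else 0) + 1 = j) ∨
      (e = firstE (rel P q) i ∧ rk (rel P q) i 1 + 1 = j) ∨
      (e = secondE (rel P q) i ∧ rk (rel P q) i 1 + 2 = j) := by
    intro j e
    obtain ⟨h1, h2, h3⟩ := ncard_precedes h (e := e) hc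
    rw [IsNthEdge, meets_angle_iff h, inCone_iff_crossing h]
    constructor
    · rintro ⟨h4 | rfl | rfl, h5⟩
      · rw [h1 h4] at h5; exact Or.inl ⟨h4, h5⟩
      · rw [h2] at h5; exact Or.inr (Or.inl ⟨rfl, h5⟩)
      · rw [h3] at h5; exact Or.inr (Or.inr ⟨rfl, h5⟩)
    · rintro (⟨h4, h5⟩ | ⟨rfl, h5⟩ | ⟨rfl, h5⟩)
      · exact ⟨Or.inl h4, by rw [h1 h4]; exact h5⟩
      · exact ⟨Or.inr (Or.inl rfl), by rw [h2]; exact h5⟩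
      · exact ⟨Or.inr (Or.inr rfl), by rw [h3]; exact h5⟩
  have hif : ∀ e, Proper (rel P q) e i → (if 1 < dst (rel P q) i e then 2 else 0) =
      if rk (rel P q) i 1 ≤ rk (rel P q) i (dst (rel P q) i e) then 2 else 0 := by
    intro e he
    simp only [rk_one_le_iff h he]
  rw [hnth, hnth, and_comm]
  refine and_congr ?_ ?_
  · constructor
    · rintro (⟨h1, h2⟩ | ⟨h1, h2⟩ | ⟨h1, h2⟩)
      · rw [hif b h1] at h2
        refine ⟨h1, ?_⟩
        split_ifs at h2 <;> omega
      · omega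
      · omega
    · rintro ⟨h1, h2⟩
      refine Or.inl ⟨h1, ?_⟩
      rw [hif b h1, if_pos (by omega)]
      omega
  · constructor
    · rintro (⟨h1, h2⟩ | ⟨h1, h2⟩ | ⟨h1, h2⟩)
      · rw [hif a h1] at h2
        right
        split_ifs at h2
        · exact ⟨by omega, h1, by omega⟩
        · omega
      · omega
      · exact Or.inl ⟨by omega, h1⟩
    · rintro (⟨h1, h2⟩ | ⟨h1, h2, h3⟩)
      · exact Or.inr (Or.inr ⟨h2, by omega⟩)
      · refine Or.inl ⟨h2, ?_⟩
        rw [hif a h2, if_pos (by omega)]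
        omega

end geometry

section parity

/-! ### Rays from a point have the same parity of crossings -/

/-- The ray from the origin in direction `d` meets the segment from `a` to `b`. -/
def RayMeets (d a b : ℂ) : Prop := ∃ s : ℝ, 0 ≤ s ∧ s • d ∈ segment ℝ a b

/-- In the frame `c`, `d` a point `p` has coordinates proportional to `cross p d` and `cross c p`.
The segment meets the positive first axis iff the second coordinates of its ends have opposite signs
and the line of the segment cuts the axis at a positive place; the determinant gives the sign of
that place. By `ha` and `hb`, an endpoint on the axis lies on its negative half. -/
theorem rayMeets_iff {c d a b : ℂ} (hcd : 0 < cross c d)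
    (ha : cross c a = 0 → cross a d < 0) (hb : cross c b = 0 → cross b d < 0)
    (h0 : (0 : ℂ) ∉ segment ℝ a b) :
    RayMeets c a b ↔
      (cross c a < 0 ∧ 0 < cross c b ∧ 0 < cross a d * cross c b - cross b d * cross c a) ∨
      (cross c b < 0 ∧ 0 < cross c a ∧ cross a d * cross c b - cross b d * cross c a < 0) := by
  constructor
  · rintro ⟨s, hs, p, r, hp, hr, hpr, hx⟩
    have hs0 : 0 < s := by
      rcases hs.lt_or_eq with h1 | h1
      · exact h1
      · exact absurd ⟨p, r, hp, hr, hpr, by rw [hx, ← h1, zero_smul]⟩ h0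
    have e1 : p * cross c a + r * cross c b = 0 := by
      rw [← cross_smul_right, ← cross_smul_right, ← cross_add_right, hx, cross_smul_right,
        cross_self, mul_zero]
    have e2 : p * cross a d + r * cross b d = s * cross c d := by
      rw [← cross_smul_left, ← cross_smul_left, ← cross_add_left, hx, cross_smul_left]
    have hpos : 0 < s * cross c d := mul_pos hs0 hcd
    have e3 : p * (cross a d * cross c b - cross b d * cross c a) = s * cross c d * cross c b := by
      linear_combination cross c b * e2 - cross b d * e1
    rcases lt_trichotomy (cross c a) 0 with h1 | h1 | h1
    · left
      have hp0 : p ≠ 0 := by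
        rintro rfl
        have hr1 : r = 1 := by linarith
        subst hr1
        have := hb (by linarith)
        linarith
      have hp1 : 0 < p := lt_of_le_of_ne hp (Ne.symm hp0)
      have h2 : 0 < cross c b := by
        by_contra h3
        have := mul_nonneg hr (neg_nonneg.2 (not_lt.1 h3))
        have := mul_neg_of_pos_of_neg hp1 h1
        linarith
      refine ⟨h1, h2, ?_⟩
      rw [← mul_pos_iff_of_pos_left hp1, e3]
      positivity
    · have h2 := ha h1
      rw [h1, mul_zero, zero_add, mul_eq_zero] at e1
      rcases e1 with h3 | h3
      · have hp1 : p = 1 := by linarith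
        rw [h3, hp1] at e2
        linarith
      · have h4 := hb h3
        have := mul_nonneg hp (neg_nonneg.2 h2.le)
        have := mul_nonneg hr (neg_nonneg.2 h4.le)
        linarith
    · right
      have hp0 : p ≠ 0 := by
        rintro rfl
        have hr1 : r = 1 := by linarith
        subst hr1
        have := hb (by linarith)
        linarith
      have hp1 : 0 < p := lt_of_le_of_ne hp (Ne.symm hp0)
      have h2 : cross c b < 0 := by
        by_contra h3
        have := mul_nonneg hr (not_lt.1 h3)
        have := mul_pos hp1 h1
        linarith
      refine ⟨h2, h1, ?_⟩
      by_contra h3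
      have h4 := mul_nonneg hp (not_lt.1 h3)
      rw [e3] at h4
      have := mul_neg_of_pos_of_neg hpos h2
      linarith
  · intro h
    have hO : 0 < (cross a d * cross c b - cross b d * cross c a) / (cross c b - cross c a) := by
      rcases h with ⟨h1, h2, h3⟩ | ⟨h1, h2, h3⟩
      · exact div_pos h3 (by linarith)
      · exact div_pos_of_neg_of_neg h3 (by linarith)
    have hne : cross c b - cross c a ≠ 0 := by
      rcases h with ⟨h1, h2, h3⟩ | ⟨h1, h2, h3⟩
      · linarith
      · linarith
    refine ⟨(cross a d * cross c b - cross b d * cross c a) / (cross c b - cross c a) / cross c d,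
      (div_pos hO hcd).le, cross c b / (cross c b - cross c a),
      -cross c a / (cross c b - cross c a), ?_, ?_, ?_, ?_⟩
    · rcases h with ⟨h1, h2, h3⟩ | ⟨h1, h2, h3⟩
      · exact (div_pos h2 (by linarith)).le
      · exact (div_pos_of_neg_of_neg h1 (by linarith)).le
    · rcases h with ⟨h1, h2, h3⟩ | ⟨h1, h2, h3⟩
      · exact (div_pos (by linarith) (by linarith)).le
      · exact (div_pos_of_neg_of_neg (by linarith) (by linarith)).le
    · rw [← add_div, ← sub_eq_add_neg, div_self hne]
    · have ea := cross_smul_eq c d a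
      have eb := cross_smul_eq c d b
      have : cross c d • ((cross c b / (cross c b - cross c a)) • a +
          (-cross c a / (cross c b - cross c a)) • b) = cross c d •
          (((cross a d * cross c b - cross b d * cross c a) / (cross c b - cross c a) /
            cross c d) • c) := by
        rw [smul_add, smul_comm _ _ a, smul_comm _ _ b, ea, eb, smul_smul, mul_div_cancel₀ _ hcd.ne']
        simp only [smul_add, smul_smul]
        have h1 : cross c b / (cross c b - cross c a) * cross c a =
          -(-cross c a / (cross c b - cross c a) * cross c b) := by ring
        rw [h1, neg_smul]
        have h2 : (cross a d * cross c b - cross b d * cross c a) / (cross c b - cross c a) =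
          cross c b / (cross c b - cross c a) * cross a d +
          -cross c a / (cross c b - cross c a) * cross b d := by ring
        rw [h2, add_smul]
        abel
      exact smul_right_injective ℂ hcd.ne' this

theorem not_mem_ray {c d a : ℂ} (hcd : 0 < cross c d) (ha : ∀ s : ℝ, 0 ≤ s → a ≠ s • c)
    (h0 : cross c a = 0) : cross a d < 0 := by
  by_contra h1
  have h2 := cross_smul_eq c d a
  rw [h0, zero_smul, add_zero] at h2
  refine ha (cross a d / cross c d) (div_nonneg (not_lt.1 h1) hcd.le) ?_
  have : cross c d • a = cross c d • (cross a d / cross c d) • c := by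
    rw [h2, smul_smul, mul_div_cancel₀ _ hcd.ne']
  exact smul_right_injective ℂ hcd.ne' this

/-- If the ends lie strictly on opposite sides of the axis and the determinant vanished, the segment
would pass through the origin. -/
theorem orient_ne {x₁ y₁ x₂ y₂ : ℝ} {c d a b : ℂ} (hcd : 0 < cross c d)
    (h0 : (0 : ℂ) ∉ segment ℝ a b) (hx₁ : cross a d = x₁) (hy₁ : cross c a = y₁)
    (hx₂ : cross b d = x₂) (hy₂ : cross c b = y₂) (hs : y₁ * y₂ < 0) : x₁ * y₂ - x₂ * y₁ ≠ 0 := by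
  intro hO
  apply h0
  have hne : y₂ - y₁ ≠ 0 := by
    intro h1
    have : y₁ = y₂ := by linarith
    rw [this] at hs
    nlinarith
  have hfrac : 0 ≤ y₂ / (y₂ - y₁) ∧ 0 ≤ -y₁ / (y₂ - y₁) := by
    rcases mul_neg_iff.1 hs with ⟨h1, h2⟩ | ⟨h1, h2⟩
    · exact ⟨(div_pos_of_neg_of_neg h2 (by linarith)).le,
        (div_pos_of_neg_of_neg (by linarith) (by linarith)).le⟩
    · exact ⟨(div_pos h2 (by linarith)).le, (div_pos (by linarith) (by linarith)).le⟩
  refine ⟨y₂ / (y₂ - y₁), -y₁ / (y₂ - y₁), hfrac.1, hfrac.2, ?_, ?_⟩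
  · rw [← add_div, ← sub_eq_add_neg, div_self hne]
  · refine eq_zero_of_cross hcd.ne' ?_ ?_
    · rw [cross_add_right, cross_smul_right, cross_smul_right, hy₁, hy₂]; ring
    · rw [cross_add_left, cross_smul_left, cross_smul_left, hx₁, hx₂]
      field_simp
      linarith

/-- A segment that avoids the origin meets exactly one of the two rays iff exactly one of its ends
is in the open sector between them. The ray `d` is treated in the frame `d`, `-c`, which has the
same determinant as `c`, `d`; what remains is a check of signs. -/
theorem rayMeets_xor {c d a b : ℂ} (hcd : 0 < cross c d)
    (hac : ∀ s : ℝ, 0 ≤ s → a ≠ s • c) (hbc : ∀ s : ℝ, 0 ≤ s → b ≠ s • c)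
    (had : ∀ s : ℝ, 0 ≤ s → a ≠ s • d) (hbd : ∀ s : ℝ, 0 ≤ s → b ≠ s • d)
    (h0 : (0 : ℂ) ∉ segment ℝ a b) :
    (RayMeets c a b ↔ RayMeets d a b) ↔
      ((0 < cross c a ∧ 0 < cross a d) ↔ (0 < cross c b ∧ 0 < cross b d)) := by
  have hdc : 0 < cross d (-c) := by
    have : cross d (-c) = cross c d := by simp [cross]; ring
    rwa [this]
  have e : ∀ p, cross p (-c) = cross c p := fun p => by simp [cross]; ring
  have e' : ∀ p, cross d p = -cross p d := fun p => cross_comm _ _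
  have a1 := not_mem_ray hcd hac
  have b1 := not_mem_ray hcd hbc
  have a2 := not_mem_ray hdc had
  have b2 := not_mem_ray hdc hbd
  rw [rayMeets_iff hcd a1 b1 h0, rayMeets_iff hdc a2 b2 h0]
  have o1 := orient_ne hcd h0 rfl rfl rfl rfl
  have o2 := orient_ne hdc h0 rfl rfl rfl rfl
  simp only [e, e'] at *
  generalize cross c a = y₁ at *
  generalize cross c b = y₂ at *
  generalize cross a d = x₁ at *
  generalize cross b d = x₂ at *
  clear had hbd hac hbc h0 hdc hcd e e'
  have n : ∀ x : ℝ, x = 0 ∨ 0 < x ∨ x < 0 := fun x => by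
    rcases lt_trichotomy x 0 with h | h | h <;> simp [h]
  have e1 : y₁ * -x₂ - y₂ * -x₁ = x₁ * y₂ - x₂ * y₁ := by ring
  have sgn : ∀ x y : ℝ, (0 < x → 0 < y → 0 < x * y) ∧ (x < 0 → y < 0 → 0 < x * y) ∧
      (0 < x → y < 0 → x * y < 0) ∧ (x < 0 → 0 < y → x * y < 0) ∧ (x = 0 → x * y = 0) ∧
      (y = 0 → x * y = 0) := fun x y =>
    ⟨mul_pos, mul_pos_of_neg_of_neg, mul_neg_of_pos_of_neg, mul_neg_of_neg_of_pos,
      fun h => by rw [h, zero_mul], fun h => by rw [h, mul_zero]⟩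
  have sA := sgn x₁ y₂
  have sB := sgn x₂ y₁
  have sy := (sgn y₁ y₂).2.2
  have sx := (sgn (-x₁) (-x₂)).2.2
  rw [e1] at o2 ⊢
  clear e1 sgn
  generalize x₁ * y₂ = A at *
  generalize x₂ * y₁ = B at *
  generalize y₁ * y₂ = C at *
  generalize -x₁ * -x₂ = D at *
  rcases n x₁ with h1 | h1 | h1 <;> rcases n y₁ with h2 | h2 | h2 <;>
    rcases n x₂ with h3 | h3 | h3 <;> rcases n y₂ with h4 | h4 | h4 <;> grind

end parity

/-! ### Parity of ray crossings and membership in the region -/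

section parity

/-- The degenerate sector of angle `π`: the two rays form a line, and the sector is replaced by an
open half plane. -/
theorem rayMeets_opposite {c a b : ℂ} (hc : c ≠ 0)
    (hac : ∀ s : ℝ, 0 ≤ s → a ≠ s • c) (hbc : ∀ s : ℝ, 0 ≤ s → b ≠ s • c)
    (had : ∀ s : ℝ, 0 ≤ s → a ≠ s • -c) (hbd : ∀ s : ℝ, 0 ≤ s → b ≠ s • -c)
    (h0 : (0 : ℂ) ∉ segment ℝ a b) :
    (RayMeets c a b ↔ RayMeets (-c) a b) ↔ (0 < cross c a ↔ 0 < cross c b) := by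
  have hcd : 0 < cross c (Complex.I * c) := by
    have h1 : cross c (Complex.I * c) = c.re ^ 2 + c.im ^ 2 := by simp [cross]; ring
    have h2 : 0 < Complex.normSq c := Complex.normSq_pos.2 hc
    rw [h1]
    rw [Complex.normSq_apply] at h2
    linarith
  generalize Complex.I * c = d at hcd
  have hdc : 0 < cross (-c) (-d) := by
    have : cross (-c) (-d) = cross c d := by simp [cross]
    rwa [this]
  have e : ∀ p, cross p (-d) = -cross p d := fun p => by simp [cross]; ring
  have e' : ∀ p, cross (-c) p = -cross c p := fun p => by simp [cross]; ring
  have a1 := not_mem_ray hcd hac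
  have b1 := not_mem_ray hcd hbc
  have a2 := not_mem_ray hdc had
  have b2 := not_mem_ray hdc hbd
  rw [rayMeets_iff hcd a1 b1 h0, rayMeets_iff hdc a2 b2 h0]
  have o1 := orient_ne hcd h0 rfl rfl rfl rfl
  simp only [e, e'] at *
  generalize cross c a = y₁ at *
  generalize cross c b = y₂ at *
  generalize cross a d = x₁ at *
  generalize cross b d = x₂ at *
  clear had hbd hac hbc h0 hdc hcd e e'
  have e1 : -x₁ * -y₂ - -x₂ * -y₁ = x₁ * y₂ - x₂ * y₁ := by ring
  rw [e1]
  generalize x₁ * y₂ - x₂ * y₁ = O at *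
  have n1 : y₁ ≠ 0 := fun h => by
    have := a1 h; have := a2 (by rw [h, neg_zero]); linarith
  have n2 : y₂ ≠ 0 := fun h => by
    have := b1 h; have := b2 (by rw [h, neg_zero]); linarith
  rcases n1.lt_or_gt with h1 | h1 <;> rcases n2.lt_or_gt with h2 | h2
  · simp [h1, h2, h1.not_gt, h2.not_gt]
  · have := o1 (mul_neg_of_neg_of_pos h1 h2)
    rcases this.lt_or_gt with h3 | h3 <;>
      simp [h1, h2, h1.not_gt, h2.not_gt, h3, h3.not_gt]
  · have := o1 (mul_neg_of_pos_of_neg h1 h2)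
    rcases this.lt_or_gt with h3 | h3 <;>
      simp [h1, h2, h1.not_gt, h2.not_gt, h3, h3.not_gt]
  · simp [h1, h2, h1.not_gt, h2.not_gt]

variable {n : ℕ}

/-- Modulo `2` the difference of the indicators of `p` and `r` is the coboundary of `χ`, whose sum
around the closed polygon is zero. -/
theorem odd_ncard_iff {p r χ : Fin n → Prop} (h : ∀ e, (p e ↔ r e) ↔ (χ e ↔ χ (nx e))) :
    Odd {e | p e}.ncard ↔ Odd {e | r e}.ncard := by
  classical
  let b : Prop → ZMod 2 := fun p => if p then 1 else 0
  have hcard : ∀ p : Fin n → Prop, (({e | p e}.ncard : ℕ) : ZMod 2) = ∑ e, b (p e) := by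
    intro p
    rw [Set.ncard_eq_toFinset_card', Finset.card_eq_sum_ones, Set.toFinset_ofPred, Finset.sum_filter]
    push_cast
    rfl
  have hb : ∀ e, b (p e) + b (r e) = b (χ e) + b (χ (nx e)) := by
    intro e
    have h1 := h e
    have h2 : (1 + 1 : ZMod 2) = 0 := by decide
    simp only [b]
    by_cases p e <;> by_cases r e <;> by_cases χ e <;> by_cases χ (nx e) <;> simp_all
  have hs : ∑ e, b (χ (nx e)) = ∑ e, b (χ e) := Equiv.sum_comp (finRotate n) fun e => b (χ e)
  have htot : (({e | p e}.ncard + {e | r e}.ncard : ℕ) : ZMod 2) = 0 := by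
    push_cast
    rw [hcard, hcard, ← Finset.sum_add_distrib, Finset.sum_congr rfl fun e _ => hb e,
      Finset.sum_add_distrib, hs, ← two_mul]
    have h2 : (2 : ZMod 2) = 0 := by decide
    rw [h2, zero_mul]
  rw [ZMod.natCast_eq_zero_iff_even, Nat.even_add] at htot
  rw [← Nat.not_even_iff_odd, ← Nat.not_even_iff_odd, htot]

/-- Two rays from a point that avoid all vertices cross the boundary equally often, modulo `2`. -/
theorem odd_rayMeets_iff {a : Fin n → ℂ} {c d : ℂ} (hc0 : c ≠ 0) (hd0 : ‖d‖ = ‖c‖)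
    (hc : ∀ j, ∀ s : ℝ, 0 ≤ s → a j ≠ s • c) (hd : ∀ j, ∀ s : ℝ, 0 ≤ s → a j ≠ s • d)
    (h0 : ∀ e, (0 : ℂ) ∉ segment ℝ (a e) (a (nx e))) :
    Odd {e | RayMeets c (a e) (a (nx e))}.ncard ↔ Odd {e | RayMeets d (a e) (a (nx e))}.ncard := by
  rcases lt_trichotomy (cross c d) 0 with h1 | h1 | h1
  · rw [cross_comm, neg_lt_zero] at h1
    exact (odd_ncard_iff (χ := fun e => 0 < cross d (a e) ∧ 0 < cross (a e) c) fun e =>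
      rayMeets_xor h1 (hd e) (hd _) (hc e) (hc _) (h0 e)).symm
  · have h2 : d = c ∨ d = -c := by
      have hn : d.re ^ 2 + d.im ^ 2 = c.re ^ 2 + c.im ^ 2 := by
        have := congrArg (· ^ 2) hd0
        simp only [Complex.sq_norm, Complex.normSq_apply] at this
        linarith
      -- Parallel vectors of equal length have equal squares as complex numbers.
      have hsq : (d - c) * (d + c) = 0 := by
        have hx : c.re * d.im = c.im * d.re := by unfold cross at h1; linarith
        have hpos : 0 < c.re ^ 2 + c.im ^ 2 := by
          have h2 : 0 < Complex.normSq c := Complex.normSq_pos.2 hc0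
          rw [Complex.normSq_apply] at h2; linarith
        have k1 : d.re * d.im = c.re * c.im := by
          have : (c.re ^ 2 + c.im ^ 2) * (d.re * d.im) = (c.re ^ 2 + c.im ^ 2) * (c.re * c.im) := by
            linear_combination (c.re * d.re - c.im * d.im) * hx + c.re * c.im * hn
          exact mul_left_cancel₀ hpos.ne' this
        have k2 : d.re ^ 2 - d.im ^ 2 = c.re ^ 2 - c.im ^ 2 := by
          have : (c.re ^ 2 + c.im ^ 2) * (d.re ^ 2 - d.im ^ 2) =
              (c.re ^ 2 + c.im ^ 2) * (c.re ^ 2 - c.im ^ 2) := by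
            linear_combination (-2 * (c.re * d.im + c.im * d.re)) * hx +
              (c.re ^ 2 - c.im ^ 2) * hn
          exact mul_left_cancel₀ hpos.ne' this
        apply Complex.ext
        · simp only [Complex.mul_re, Complex.sub_re, Complex.add_re, Complex.sub_im, Complex.add_im,
            Complex.zero_re]
          linarith
        · simp only [Complex.mul_im, Complex.sub_re, Complex.add_re, Complex.sub_im, Complex.add_im,
            Complex.zero_im]
          linarith
      rcases mul_eq_zero.1 hsq with h3 | h3
      · exact Or.inl (sub_eq_zero.1 h3)
      · exact Or.inr (eq_neg_of_add_eq_zero_left h3)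
    rcases h2 with rfl | rfl
    · rfl
    · exact odd_ncard_iff (χ := fun e => 0 < cross c (a e)) fun e =>
        rayMeets_opposite hc0 (hc e) (hc _) (hd e) (hd _) (h0 e)
  · exact odd_ncard_iff (χ := fun e => 0 < cross c (a e) ∧ 0 < cross (a e) d) fun e =>
      rayMeets_xor h1 (hc e) (hc _) (hd e) (hd _) (h0 e)

theorem rayMeets_smul {d a b : ℂ} {r : ℝ} (hr : 0 < r) : RayMeets (r • d) a b ↔ RayMeets d a b := by
  constructor
  · rintro ⟨s, hs, h⟩
    exact ⟨s * r, by positivity, by rwa [mul_smul]⟩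
  · rintro ⟨s, hs, h⟩
    exact ⟨s / r, by positivity, by rwa [smul_smul, div_mul_cancel₀ _ hr.ne']⟩

theorem meets_iff_rayMeets {P : Polygon ℂ n} {z : ℂ} {θ : ℝ} {e : Fin n} :
    Meets P z θ e ↔ RayMeets (unit θ) (rel P z e) (rel P z (nx e)) := by
  constructor
  · rintro ⟨x, hx, t, ht, rfl⟩
    rw [polarPoint_eq, mem_edgeSet_iff] at hx
    exact ⟨t, ht, hx⟩
  · rintro ⟨t, ht, hx⟩
    rw [← mem_edgeSet_iff, ← polarPoint_eq] at hx
    exact ⟨_, hx, t, ht, rfl⟩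

theorem smul_unit_arg (d : ℂ) : ‖d‖ • unit (Complex.arg d) = d := by
  rw [unit, Complex.real_smul, Complex.norm_mul_exp_arg_mul_I]

theorem not_mem_ray_iff {P : Polygon ℂ n} {z : ℂ} {θ : ℝ} {i : Fin n} :
    P i ∉ ray z θ ↔ ∀ s : ℝ, 0 ≤ s → rel P z i ≠ s • unit θ := by
  simp only [ray, Set.mem_ofPred_eq, not_exists, not_and, polarPoint_eq, rel]
  refine forall_congr' fun s => forall_congr' fun _ => ?_
  rw [not_iff_not, sub_eq_iff_eq_add, add_comm]

/-- One ray with an odd number of crossings suffices for a point to be in the region. -/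
theorem mem_region_of_odd {P : Polygon ℂ n} {z d : ℂ} (hd0 : d ≠ 0)
    (hd : ∀ j, ∀ s : ℝ, 0 ≤ s → rel P z j ≠ s • d)
    (hodd : Odd {e | RayMeets d (rel P z e) (rel P z (nx e))}.ncard) : z ∈ region P := by
  by_cases hb : z ∈ P.boundary ℝ
  · exact Or.inl hb
  refine Or.inr fun θ hθ => ?_
  have hr : 0 < ‖d‖ := norm_pos_iff.2 hd0
  have h1 : {e | Meets P z θ e} = {e | RayMeets (‖d‖ • unit θ) (rel P z e) (rel P z (nx e))} := by
    ext e
    simp only [Set.mem_ofPred_eq, meets_iff_rayMeets, rayMeets_smul hr]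
  rw [h1, ← odd_rayMeets_iff hd0 (by
      rw [norm_smul, norm_norm, unit, Complex.norm_exp_ofReal_mul_I, mul_one]) hd]
  · exact hodd
  · intro j s hs
    rw [smul_smul]
    exact not_mem_ray_iff.1 (hθ j) _ (by positivity)
  · intro e he
    apply hb
    rw [← mem_edgeSet_iff, add_zero] at he
    exact Set.mem_iUnion.2 ⟨e, he⟩

variable {P : Polygon ℂ n} {q : ℂ}

theorem not_mem_boundary (h : Star (rel P q)) : q ∉ P.boundary ℝ := by
  intro hb
  obtain ⟨e, he⟩ := Set.mem_iUnion.1 hb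
  rw [← add_zero q, mem_edgeSet_iff, ← zero_smul ℝ (rel P q e),
    smul_mem_segment_iff h le_rfl] at he
  simp at he

/-- Directions from `q` without vertices cross the boundary an odd number of times. -/
theorem odd_inCone (h : Star (rel P q)) (hq : q ∈ region P) {d : ℂ} (hd0 : d ≠ 0)
    (hd : ∀ j, cross (rel P q j) d ≠ 0) : Odd {e | InCone (rel P q) e d}.ncard := by
  have h1 := hq.resolve_left (not_mem_boundary h) (Complex.arg d) fun i => not_mem_ray_iff.2 ?_
  · have hr : 0 < ‖d‖ := norm_pos_iff.2 hd0
    have h2 : {e | Meets P q (Complex.arg d) e} = {e | InCone (rel P q) e d} := by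
      ext e
      rw [Set.mem_ofPred_eq, Set.mem_ofPred_eq, meets_iff h]
      conv_rhs => rw [← smul_unit_arg d, inCone_smul hr]
    rwa [h2] at h1
  · intro s _ hs
    apply hd i
    rw [hs]
    have h3 : cross (unit (Complex.arg d)) (‖d‖ • unit (Complex.arg d)) = 0 := by
      rw [cross_smul_right, cross_self, mul_zero]
    rw [smul_unit_arg] at h3
    rw [cross_smul_left, h3, mul_zero]

/-- The point at parameter `s` seen from `q + d` has parameter `1 + s` seen from `q`, so the edges
met are those at parameter at least `1`. -/
theorem rayMeets_rel_iff (h : Star (rel P q)) {d : ℂ} (hd0 : d ≠ 0) {e : Fin n} :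
    RayMeets d (rel P (q + d) e) (rel P (q + d) (nx e)) ↔
      InCone (rel P q) e d ∧ slope (rel P q) e d ≤ 1 := by
  have key : ∀ s : ℝ, s • d ∈ segment ℝ (rel P (q + d) e) (rel P (q + d) (nx e)) ↔
      (1 + s) • d ∈ segment ℝ (rel P q e) (rel P q (nx e)) := by
    intro s
    rw [← mem_edgeSet_iff, ← mem_edgeSet_iff, add_smul, one_smul, add_assoc]
  constructor
  · rintro ⟨s, hs, hm⟩
    rw [key, smul_mem_segment_iff h (by linarith)] at hm
    refine ⟨hm.1, ?_⟩
    have := hm.1.slope_pos h hd0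
    have := mul_nonneg hs this.le
    linarith [hm.2]
  · rintro ⟨h1, h2⟩
    have h3 := h1.slope_pos h hd0
    have h4 : 1 ≤ (slope (rel P q) e d)⁻¹ := (one_le_inv₀ h3).2 h2
    refine ⟨(slope (rel P q) e d)⁻¹ - 1, by linarith, ?_⟩
    rw [key, smul_mem_segment_iff h (by linarith)]
    exact ⟨h1, by rw [add_sub_cancel, inv_mul_cancel₀ h3.ne']⟩

/-- A point behind an even number of crossings is in the region. -/
theorem mem_region_of_even (h : Star (rel P q)) (hq : q ∈ region P) {d : ℂ} (hd0 : d ≠ 0)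
    (hd : ∀ j, cross (rel P q j) d ≠ 0)
    (heven : Even {f | InCone (rel P q) f d ∧ 1 < slope (rel P q) f d}.ncard) :
    q + d ∈ region P := by
  classical
  refine mem_region_of_odd hd0 ?_ ?_
  · intro j s _ hs
    apply hd j
    have : rel P q j = (1 + s) • d := by
      rw [add_smul, one_smul, ← hs, rel, rel]; ring
    rw [this, cross_smul_left, cross_self, mul_zero]
  -- The edges over `d` split into those in front of `q + d` and those met by the continued ray.
  -- Their total is odd because `q` is inside, so the second number is odd.
  · simp only [rayMeets_rel_iff h hd0]
    have h1 := odd_inCone h hq hd0 hd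
    have h2 : {e | InCone (rel P q) e d} = {f | InCone (rel P q) f d ∧ 1 < slope (rel P q) f d} ∪
        {f | InCone (rel P q) f d ∧ slope (rel P q) f d ≤ 1} := by
      ext e
      simp only [Set.mem_ofPred_eq, Set.mem_union, ← and_or_left]
      simp [lt_or_ge]
    rw [h2, Set.ncard_union_eq, Nat.odd_add] at h1
    · by_contra h3
      rw [Nat.not_odd_iff_even] at h3
      exact absurd (h1.2 h3) (Nat.not_odd_iff_even.2 heven)
    · rw [Set.disjoint_left]
      rintro e ⟨-, h3⟩ ⟨-, h4⟩
      exact absurd h3 (not_lt.2 h4)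

end parity

section types

variable {n : ℕ}

/-! ### The crossings near a ray through a vertex -/

theorem continuous_cross_left (a : ℂ) : Continuous fun d : ℂ => cross a d := by
  unfold cross; fun_prop

theorem continuous_cross_right (a : ℂ) : Continuous fun d : ℂ => cross d a := by
  unfold cross; fun_prop

theorem continuous_slope (u : Fin n → ℂ) (e : Fin n) : Continuous fun d : ℂ => slope u e d :=
  ((continuous_cross_left _).add (continuous_cross_right _)).div_const _

theorem eventually_cross_mul_pos {a x : ℂ} {s : ℝ} (hs : 0 < cross a x * s) :
    ∀ᶠ d in 𝓝 x, 0 < cross a d * s :=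
  ((continuous_cross_left a).mul continuous_const).continuousAt.eventually (lt_mem_nhds hs)

/-- The edges whose cone contains a direction close to the ray through a vertex. -/
theorem eventually_inCone_iff {u : Fin n → ℂ} (h : Star u) {i : Fin n} {τ : ℝ} (hτ : 0 < τ) :
    ∀ᶠ d in 𝓝 (τ • u i), (∀ j, j ≠ i → cross (u j) d ≠ 0) ∧ ∀ f, InCone u f d ↔ Proper u f i ∨
      (f = i ∧ 0 ≤ cross (u i) d * X u i (nx i)) ∨ (f = pv i ∧ 0 ≤ cross (u i) d * X u i (pv i)) := by
  have hX : ∀ j, j ≠ i → ∀ᶠ d in 𝓝 (τ • u i), 0 < cross (u j) d * X u j i := fun j hj => by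
    refine eventually_cross_mul_pos ?_
    rw [cross_smul_right, mul_assoc]
    exact mul_pos hτ (mul_self_pos.2 (h.ne _ _ hj))
  have hX' : ∀ᶠ d in 𝓝 (τ • u i), ∀ j, j ≠ i → 0 < cross (u j) d * X u j i := by
    rw [eventually_all]
    intro j
    by_cases hj : j = i
    · exact Eventually.of_forall fun d h0 => absurd hj h0
    · exact (hX j hj).mono fun d hd _ => hd
  filter_upwards [hX'] with d hd
  refine ⟨fun j hj h0 => ?_, fun f => ?_⟩
  · have := hd j hj
    rw [h0, zero_mul] at this
    exact lt_irrefl _ this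
  have tr : ∀ j, j ≠ i → ∀ s, (0 ≤ cross (u j) d * s ↔ 0 ≤ X u j i * s) := by
    intro j hj s
    have h1 := hd j hj
    rcases mul_pos_iff.1 h1 with ⟨h2, h3⟩ | ⟨h2, h3⟩
    · rw [mul_nonneg_iff_of_pos_left h2, mul_nonneg_iff_of_pos_left h3]
    · rw [← neg_mul_neg, mul_nonneg_iff_of_pos_left (neg_pos.2 h2), ← neg_mul_neg (X u j i),
        mul_nonneg_iff_of_pos_left (neg_pos.2 h3)]
  have tr' : ∀ j, j ≠ i → ∀ s, (0 ≤ cross d (u j) * s ↔ 0 ≤ X u i j * s) := by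
    intro j hj s
    rw [cross_comm d, X_comm i, neg_mul, neg_mul, ← mul_neg, ← mul_neg]
    exact tr j hj _
  unfold InCone
  by_cases h1 : f = i
  · subst h1
    rw [tr' _ (h.nx_ne f)]
    have h2 : ¬ Proper u f f := fun hp => hp.ne_left rfl
    have h3 : f ≠ pv f := (h.pv_ne f).symm
    have h4 : 0 ≤ X u f (nx f) * area u f := mul_self_nonneg _
    simp only [h2, h3, h4, true_and, false_and, false_or, or_false, and_true]
    rfl
  by_cases h2 : f = pv i
  · subst h2
    rw [tr _ h1, nx_pv, area_pv]
    have h3 : ¬ Proper u (pv i) i := fun hp => hp.ne_right (nx_pv i).symm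
    have h4 : 0 ≤ X u (pv i) i * -X u i (pv i) := by
      rw [X_comm (pv i), neg_mul_neg]; exact mul_self_nonneg _
    simp only [h1, h3, h4, true_and, false_and, false_or]
    rw [cross_comm d, neg_mul_neg]
  · have h3 : i ≠ nx f := fun h0 => h2 (by rw [h0, pv_nx])
    rw [tr _ h1, tr' _ h3.symm]
    simp only [h1, h2, false_and, or_false]
    have := inCone_vertex_iff h (e := f) (i := i)
    rw [or_iff_left (by rintro (h0 | h0); exacts [h1 h0.symm, h3 h0])] at this
    exact this

/-- The edges in front of a point close to the ray through a vertex. -/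
theorem eventually_front_iff {u : Fin n → ℂ} (h : Star u) {i : Fin n} {τ : ℝ} (hτ : 1 < τ)
    (hne : ∀ f, Proper u f i → dst u i f ≠ τ) :
    ∀ᶠ d in 𝓝 (τ • u i), (∀ j, j ≠ i → cross (u j) d ≠ 0) ∧ ∀ f, (InCone u f d ∧ 1 < slope u f d) ↔
      (Proper u f i ∧ dst u i f < τ) ∨
      (f = i ∧ 0 ≤ cross (u i) d * X u i (nx i)) ∨ (f = pv i ∧ 0 ≤ cross (u i) d * X u i (pv i)) := by
  have h0 : 0 < τ := one_pos.trans hτ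
  have hs : ∀ᶠ d in 𝓝 (τ • u i), ∀ f, InCone u f (u i) → (1 < slope u f d ↔ dst u i f < τ) := by
    rw [eventually_all]
    intro f
    by_cases hf : InCone u f (u i)
    · have hp := hf.slope_pos h (h.vertex_ne_zero i)
      have hd : dst u i f < τ ↔ 1 < slope u f (τ • u i) := by
        rw [slope_smul, dst, inv_lt_iff_one_lt_mul₀ hp]
      have hn : dst u i f ≠ τ := by
        rcases (inCone_vertex_iff h).1 hf with h1 | h1 | h1
        · exact hne f h1
        · rw [← h1, dst_left h]; exact hτ.ne
        · rw [show f = pv i by rw [h1, pv_nx], dst_pv h]; exact hτ.ne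
      rcases hn.lt_or_gt with h1 | h1
      · refine ((continuous_slope u f).continuousAt.eventually (lt_mem_nhds (hd.1 h1))).mono ?_
        intro d h2 _
        exact ⟨fun _ => h1, fun _ => h2⟩
      · have h2 : slope u f (τ • u i) < 1 := by
          rw [slope_smul]
          rw [dst, lt_inv_comm₀ h0 hp] at h1
          calc τ * slope u f (u i) < τ * τ⁻¹ := mul_lt_mul_of_pos_left h1 h0
            _ = 1 := mul_inv_cancel₀ h0.ne'
        refine ((continuous_slope u f).continuousAt.eventually (gt_mem_nhds h2)).mono ?_
        intro d h3 _
        exact ⟨fun h4 => absurd h4 (not_lt.2 (le_of_lt h3)), fun h4 => absurd h4 (not_lt.2 h1.le)⟩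
    · exact Eventually.of_forall fun d hf' => absurd hf' hf
  filter_upwards [eventually_inCone_iff h h0, hs] with d h1 h2
  refine ⟨h1.1, fun f => ?_⟩
  rw [h1.2 f]
  have a1 : f = i → 1 < slope u f d := by
    rintro rfl
    rw [h2 f (inCone_left f), dst_left h]; exact hτ
  have a2 : f = pv i → 1 < slope u f d := by
    rintro rfl
    rw [h2 _ (by have := inCone_right (u := u) (pv i); rwa [nx_pv] at this), dst_pv h]; exact hτ
  have a3 : Proper u f i → (1 < slope u f d ↔ dst u i f < τ) := fun hp => h2 f hp.inCone
  tauto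

theorem tendsto_turn (x c : ℂ) (σ : ℝ) :
    Tendsto (fun ε : ℝ => x + (σ * ε) • c) (𝓝[>] 0) (𝓝 x) := by
  have h1 : Continuous fun ε : ℝ => x + (σ * ε) • c := by fun_prop
  have h2 := h1.tendsto 0
  rw [mul_zero, zero_smul, add_zero] at h2
  exact h2.mono_left nhdsWithin_le_nhds

theorem cross_I_pos {c : ℂ} (hc : c ≠ 0) : 0 < cross c (Complex.I * c) := by
  have h1 : cross c (Complex.I * c) = c.re * c.re + c.im * c.im := by
    simp [cross, Complex.mul_re, Complex.mul_im]
  rw [h1, ← Complex.normSq_apply]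
  exact Complex.normSq_pos.2 hc

variable {P : Polygon ℂ n} {q : ℂ}

/-- The ray through a critical vertex properly crosses some edge. -/
theorem exists_proper (h : Star (rel P q)) (hq : q ∈ region P) {i : Fin n}
    (hc : Crit (rel P q) i) : ∃ f, Proper (rel P q) f i := by
  have hA : X (rel P q) i (nx i) ≠ 0 := h.ne _ _ (h.nx_ne i).symm
  -- The ray is turned away from the incident edges. An odd number of edges meets the turned ray,
  -- hence at least one does; it is not incident, so it crosses the original ray properly.
  have hev := (tendsto_turn ((1 : ℝ) • rel P q i) (Complex.I * rel P q i)
    (-X (rel P q) i (nx i))).eventually (eventually_inCone_iff h one_pos)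
  obtain ⟨ε, ⟨h1, h2⟩, h3⟩ := (hev.and self_mem_nhdsWithin).exists
  have h4 := cross_I_pos (h.vertex_ne_zero i)
  rw [one_smul] at h1 h2
  set d := rel P q i + (-X (rel P q) i (nx i) * ε) • (Complex.I * rel P q i) with hd
  have h5 : cross (rel P q i) d = -X (rel P q) i (nx i) *
      (ε * cross (rel P q i) (Complex.I * rel P q i)) := by
    rw [hd, cross_add_right, cross_self, cross_smul_right]; ring
  have h6 := mul_pos h3 h4
  have h7 : cross (rel P q i) d * X (rel P q) i (nx i) < 0 := by
    rw [h5]; nlinarith [mul_pos h6 (mul_self_pos.2 hA)]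
  have h8 : cross (rel P q i) d * X (rel P q) i (pv i) < 0 := by
    rw [h5]
    have := mul_pos h6 hc
    nlinarith
  have h9 : cross (rel P q i) d ≠ 0 := by
    intro h0; rw [h0, zero_mul] at h7; exact lt_irrefl _ h7
  have hd0 : d ≠ 0 := by
    rintro h0
    apply h9
    rw [h0]; simp [cross]
  have hodd := odd_inCone h hq hd0 fun j => by
    by_cases hj : j = i
    · rw [hj]; exact h9
    · exact h1 j hj
  obtain ⟨f, hf⟩ : {e | InCone (rel P q) e d}.Nonempty := by
    rw [Set.nonempty_iff_ne_empty]
    intro h0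
    rw [h0, Set.ncard_empty] at hodd
    exact absurd hodd (by decide)
  rcases (h2 f).1 hf with h10 | ⟨-, h10⟩ | ⟨-, h10⟩
  · exact ⟨f, h10⟩
  · exact absurd h7 (not_lt.2 h10)
  · exact absurd h8 (not_lt.2 h10)

/-- No crossing edge lies strictly between the two ends of a window, because their ranks are
consecutive or, if the window starts at the vertex, because `K` crossing edges lie in front of the
vertex already. -/
theorem Win.one_le_dst (h : Star (rel P q)) {K : ℕ} {i a b : Fin n} (hw : Win (rel P q) K i a b) :
    1 ≤ dst (rel P q) i a ∧ dst (rel P q) i a < dst (rel P q) i b ∧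
      ∀ f, Proper (rel P q) f i → dst (rel P q) i f < dst (rel P q) i b →
        dst (rel P q) i f ≤ dst (rel P q) i a := by
  obtain ⟨-, -, ⟨hb, hbK⟩, ⟨h1, rfl⟩ | ⟨h1, h2, h3⟩⟩ := hw
  · rw [dst_secondE h]
    refine ⟨le_rfl, (rk_one_le_iff h hb).2 (by omega), fun f hf hfb => ?_⟩
    by_contra h4
    have := (rk_one_le_iff h hf).1 (not_le.1 h4)
    have := rk_lt_of_lt hf hfb
    omega
  · refine ⟨((rk_one_le_iff h h2).2 (by omega)).le, (rk_lt_iff h2).1 (by omega), fun f hf hfb => ?_⟩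
    by_contra h4
    have := rk_lt_of_lt h2 (not_le.1 h4)
    have := rk_lt_of_lt hf hfb
    omega

theorem Win.inCone_left (h : Star (rel P q)) {K : ℕ} {i a b : Fin n}
    (hw : Win (rel P q) K i a b) : InCone (rel P q) a (rel P q i) := by
  obtain ⟨-, -, -, ⟨-, rfl⟩ | ⟨-, h2, -⟩⟩ := hw
  · exact (inCone_iff_crossing h).2 (Or.inr (Or.inr rfl))
  · exact h2.inCone

theorem mem_openWindow_iff (h : Star (rel P q)) {i a b : Fin n} {x : ℂ}
    (ha : InCone (rel P q) a (rel P q i)) (hb : InCone (rel P q) b (rel P q i)) :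
    x ∈ openWindow P q (angle q (P i)) a b ↔
      ∃ τ, dst (rel P q) i a < τ ∧ τ < dst (rel P q) i b ∧ x = q + τ • rel P q i := by
  have hr := norm_rel_pos h i
  have key : ∀ e, InCone (rel P q) e (rel P q i) → ∀ s, 0 ≤ s →
      (polarPoint q (angle q (P i)) s ∈ P.edgeSet ℝ e ↔ s = dst (rel P q) i e * ‖P i - q‖) := by
    intro e he s hs
    rw [polarPoint_mem_iff h hs, inCone_unit_iff h, and_iff_right he]
    have h1 : slope (rel P q) e (rel P q i) =
        ‖P i - q‖ * slope (rel P q) e (unit (angle q (P i))) := by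
      rw [← slope_smul, smul_unit_angle]
    have h2 := he.slope_pos h (h.vertex_ne_zero i)
    have h3 : 0 < slope (rel P q) e (unit (angle q (P i))) := by
      rw [h1] at h2; exact (mul_pos_iff_of_pos_left hr).1 h2
    rw [dst, h1, mul_inv, mul_right_comm, inv_mul_cancel₀ hr.ne', one_mul]
    exact mul_eq_one_iff_eq_inv₀ h3.ne'
  constructor
  · rintro ⟨s, v, t, hs, hsv, hvt, h1, h2, rfl⟩
    rw [key a ha s hs] at h1
    rw [key b hb t (by linarith)] at h2
    refine ⟨v / ‖P i - q‖, by rw [lt_div_iff₀ hr]; linarith, by rw [div_lt_iff₀ hr]; linarith, ?_⟩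
    rw [polarPoint_eq, ← smul_unit_angle, smul_smul, div_mul_cancel₀ _ hr.ne']
  · rintro ⟨τ, h1, h2, rfl⟩
    have h3 := dst_pos h ha
    have h4 := dst_pos h hb
    refine ⟨dst (rel P q) i a * ‖P i - q‖, τ * ‖P i - q‖, dst (rel P q) i b * ‖P i - q‖,
      by positivity, mul_lt_mul_of_pos_right h1 hr, mul_lt_mul_of_pos_right h2 hr,
      (key a ha _ (by positivity)).2 rfl, (key b hb _ (by positivity)).2 rfl, ?_⟩
    rw [polarPoint_eq, mul_smul, smul_unit_angle]

/-- No crossing edge lies inside the window, so a point of it sees the same edges in front as its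
far end, which has rank `K`. -/
theorem Win.front_ncard (h : Star (rel P q)) {K : ℕ} {i a b : Fin n} (hw : Win (rel P q) K i a b)
    {τ : ℝ} (h1 : dst (rel P q) i a < τ) (h2 : τ < dst (rel P q) i b) :
    {f | Proper (rel P q) f i ∧ dst (rel P q) i f < τ}.encard = K := by
  classical
  have h3 : {f | Proper (rel P q) f i ∧ dst (rel P q) i f < τ} =
      ((crossing (rel P q) i).filter fun f => dst (rel P q) i f < dst (rel P q) i b :
        Finset (Fin n)) := by
    ext f
    simp only [Set.mem_ofPred_eq, Finset.coe_filter, mem_crossing]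
    exact ⟨fun h4 => ⟨h4.1, h4.2.trans h2⟩,
      fun h4 => ⟨h4.1, ((hw.one_le_dst h).2.2 f h4.1 h4.2).trans_lt h1⟩⟩
  rw [h3, Set.encard_coe_eq_coe_finsetCard, ← hw.2.2.1.2, rk]

/-- The region is to the left of the window of an end vertex, and to the right of the window of a
start vertex. -/
theorem regionOnLeft_iff (h : Star (rel P q)) (hq : q ∈ region P) {K : ℕ} (hK : Even K)
    {i a b : Fin n} (hw : Win (rel P q) K i a b) :
    RegionOnLeft P q K (angle q (P i)) a b ↔ X (rel P q) i (nx i) < 0 := by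
  have hd := hw.one_le_dst h
  have hb : InCone (rel P q) b (rel P q i) := hw.2.2.1.1.inCone
  have hr := norm_rel_pos h i
  have hev : ∀ τ, dst (rel P q) i a < τ → τ < dst (rel P q) i b → _ := fun τ h1 h2 =>
    eventually_front_iff h (i := i) (τ := τ) (by linarith) (fun f hf hfτ => by
      have := hd.2.2 f hf (by linarith)
      linarith)
  have hcross : ∀ z, 0 < cross (Complex.exp ((angle q (P i) : ℝ) * Complex.I)) z ↔
      0 < cross (rel P q i) z := fun z => by
    change 0 < cross (unit _) z ↔ _
    rw [← smul_unit_angle, cross_smul_left, mul_pos_iff_of_pos_left hr]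
  have hne : ∀ {d : ℂ}, (∀ j, j ≠ i → cross (rel P q j) d ≠ 0) → 0 < cross (rel P q i) d →
      ∀ j, cross (rel P q j) d ≠ 0 := by
    intro d h1 h2 j
    by_cases hj : j = i
    · rw [hj]; exact h2.ne'
    · exact h1 j hj
  constructor
  · intro hreg
    by_contra hneg
    have hpos : 0 < X (rel P q) i (nx i) :=
      lt_of_le_of_ne (not_lt.1 hneg) (h.ne _ _ (h.nx_ne i).symm).symm
    obtain ⟨τ, h1, h2⟩ := exists_between hd.2.1
    have h3 := hreg (q + τ • rel P q i)
      ((mem_openWindow_iff h (hw.inCone_left h) hb).2 ⟨τ, h1, h2, rfl⟩)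
    have h4 : Tendsto (fun ε : ℝ => q + (τ • rel P q i + ((1 : ℝ) * ε) • (Complex.I * rel P q i)))
        (𝓝[>] 0) (𝓝[{z | 0 < cross (Complex.exp ((angle q (P i) : ℝ) * Complex.I)) (z - q)}]
          (q + τ • rel P q i)) := by
      refine tendsto_nhdsWithin_iff.2 ⟨(tendsto_turn _ _ 1).const_add q, ?_⟩
      filter_upwards [self_mem_nhdsWithin] with ε hε
      rw [hcross, add_sub_cancel_left, cross_add_right, cross_smul_right,
        cross_smul_right, cross_self, one_mul, mul_zero, zero_add]
      exact mul_pos hε (cross_I_pos (h.vertex_ne_zero i))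
    have h5 := (tendsto_turn (τ • rel P q i) (Complex.I * rel P q i) 1).eventually (hev τ h1 h2)
    obtain ⟨ε, ⟨⟨h6, h7⟩, h8⟩, h9⟩ := ((h5.and (h4.eventually h3)).and self_mem_nhdsWithin).exists
    have h10 : 0 < cross (rel P q i)
        (τ • rel P q i + ((1 : ℝ) * ε) • (Complex.I * rel P q i)) := by
      rw [cross_add_right, cross_smul_right,
        cross_smul_right, cross_self, one_mul, mul_zero, zero_add]
      exact mul_pos h9 (cross_I_pos (h.vertex_ne_zero i))
    set d := τ • rel P q i + ((1 : ℝ) * ε) • (Complex.I * rel P q i)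
    have hne' := hne h6 h10
    have hd0 : d ≠ 0 := by
      rintro h0; rw [h0] at h10; simp [cross] at h10
    have h11 := h8.2
    rw [encard_crossings h hd0 (fun j hj => absurd hj (hne' j))] at h11
    -- To the left of a start vertex the incident edge `i` comes in addition to the `K` crossing
    -- edges; this one edge already exceeds the bound.
    have h12 := Set.encard_le_encard (s := insert i {f | Proper (rel P q) f i ∧
      dst (rel P q) i f < τ}) (t := {f | InCone (rel P q) f d ∧ 1 < slope (rel P q) f d}) (by
        rintro f (rfl | hf)
        · exact (h7 f).2 (Or.inr (Or.inl ⟨rfl, (mul_pos h10 hpos).le⟩))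
        · exact (h7 f).2 (Or.inl hf))
    rw [Set.encard_insert_of_notMem (fun h0 => h0.1.ne_left rfl), hw.front_ncard h h1 h2] at h12
    have h13 := h12.trans h11
    exact absurd h13 (by exact_mod_cast (by omega : ¬ K + 1 ≤ K))
  · intro hneg x hx
    have hneg' : X (rel P q) i (pv i) < 0 := by
      rcases mul_pos_iff.1 hw.1 with ⟨h1, -⟩ | ⟨-, h1⟩
      · exact absurd h1 (not_lt.2 hneg.le)
      · exact h1
    obtain ⟨τ, h1, h2, rfl⟩ := (mem_openWindow_iff h (hw.inCone_left h) hb).1 hx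
    have h3 : Tendsto (fun z => z - q) (𝓝[{z | 0 < cross (Complex.exp
        ((angle q (P i) : ℝ) * Complex.I)) (z - q)}] (q + τ • rel P q i)) (𝓝 (τ • rel P q i)) := by
      have h4 : Continuous fun z : ℂ => z - q := by fun_prop
      have h5 := h4.tendsto (q + τ • rel P q i)
      rw [add_sub_cancel_left] at h5
      exact h5.mono_left nhdsWithin_le_nhds
    filter_upwards [h3.eventually (hev τ h1 h2), self_mem_nhdsWithin] with z ⟨h6, h7⟩ h8
    rw [hcross] at h8
    have hd0 : z - q ≠ 0 := by
      rintro h0; rw [h0] at h8; simp [cross] at h8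
    -- To the left of an end vertex neither incident edge is met, so exactly the `K` crossing edges
    -- are in front.
    have h9 : {f | InCone (rel P q) f (z - q) ∧ 1 < slope (rel P q) f (z - q)} =
        {f | Proper (rel P q) f i ∧ dst (rel P q) i f < τ} := by
      ext f
      refine (h7 f).trans ⟨?_, Or.inl⟩
      rintro (h0 | ⟨-, h0⟩ | ⟨-, h0⟩)
      · exact h0
      · exact absurd (mul_neg_of_pos_of_neg h8 hneg) (not_lt.2 h0)
      · exact absurd (mul_neg_of_pos_of_neg h8 hneg') (not_lt.2 h0)
    have h10 := hw.front_ncard h h1 h2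
    have hz : q + (z - q) = z := add_sub_cancel q z
    constructor
    · rw [← hz]
      apply mem_region_of_even h hq hd0 (hne h6 h8)
      rw [h9, Set.ncard, h10]
      simpa using hK
    · rw [← hz, encard_crossings h hd0 (fun j hj => absurd hj (hne h6 h8 j)), h9, h10]

end types

/-! ### A small language of total programs over bounded variables -/

/-- The variables. -/
inductive Var
  | i | e | z | k | flag | j | r | rv | su | pr | nxt | wlk

/-- The number of a variable. -/
def Var.idx : Var → ℕ
  | .i => 0 | .e => 1 | .z => 2 | .k => 3 | .flag => 4 | .j => 5 | .r => 6 | .rv => 7 | .su => 8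
  | .pr => 9 | .nxt => 10 | .wlk => 11

theorem Var.idx_injective : Function.Injective Var.idx := by
  intro a b h
  cases a <;> cases b <;> first | rfl | (exact absurd h (by decide))

theorem Var.idx_lt (x : Var) : x.idx < 12 := by cases x <;> decide

instance : DecidableEq Var := fun _ _ => decidable_of_iff _ Var.idx_injective.eq_iff

/-- The values of the variables. -/
abbrev Store := Var → ℤ

/-- Expressions. -/
inductive Ex
  | var (x : Var)
  | lit (c : ℤ)
  | add (a b : Ex)
  | sub (a b : Ex)
  | mul (a b : Ex)
  | rd (a : Ex)
  | ite (a b c d : Ex)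

/-- The input word at an address, `0` outside of the input. -/
def readAt (A : List ℤ) (v : ℤ) : ℤ := if v < 0 then 0 else A.getD v.toNat 0

/-- The value of an expression. -/
def Ex.eval (A : List ℤ) (σ : Store) : Ex → ℤ
  | .var x => σ x
  | .lit c => c
  | .add a b => a.eval A σ + b.eval A σ
  | .sub a b => a.eval A σ - b.eval A σ
  | .mul a b => a.eval A σ * b.eval A σ
  | .rd a => readAt A (a.eval A σ)
  | .ite a b c d => if a.eval A σ < b.eval A σ then c.eval A σ else d.eval A σ

/-- The size of the value of an expression, as a multiple of the input word size. -/
def Ex.deg : Ex → ℕ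
  | .var _ => 2
  | .lit c => c.natAbs + 1
  | .add a b => max a.deg b.deg + 1
  | .sub a b => max a.deg b.deg + 1
  | .mul a b => a.deg + b.deg
  | .rd _ => 1
  | .ite _ _ c d => max c.deg d.deg

/-- The size of all values that occur in the evaluation. -/
def Ex.width : Ex → ℕ
  | .var _ => 2
  | .lit c => c.natAbs + 1
  | .add a b => max (max a.width b.width) (max a.deg b.deg + 1)
  | .sub a b => max (max a.width b.width) (max a.deg b.deg + 1)
  | .mul a b => max (max a.width b.width) (a.deg + b.deg)
  | .rd a => max a.width 1
  | .ite a b c d => max (max a.width b.width) (max c.width d.width)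

/-- The number of temporary registers used by the evaluation. -/
def Ex.height : Ex → ℕ
  | .var _ => 0
  | .lit _ => 0
  | .add a b => max a.height (b.height + 1)
  | .sub a b => max a.height (b.height + 1)
  | .mul a b => max a.height (b.height + 1)
  | .rd a => a.height
  | .ite a b c d => max (max a.height (b.height + 1)) (max c.height d.height)

/-- A bound for the time of the evaluation. -/
def Ex.time : Ex → ℕ
  | .var _ => 1
  | .lit _ => 1
  | .add a b => a.time + b.time + 1
  | .sub a b => a.time + b.time + 1
  | .mul a b => a.time + b.time + 1
  | .rd a => a.time + 3
  | .ite a b c d => a.time + b.time + c.time + d.time + 1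

/-- A register, named by a number. -/
def rg (Q k : ℕ) : Fin (Q + 1) := Fin.ofNat (Q + 1) k

theorem rg_inj {Q j k : ℕ} (hj : j ≤ Q) (hk : k ≤ Q) : rg Q j = rg Q k ↔ j = k := by
  rw [Fin.ext_iff]
  simp only [rg, Fin.ofNat]
  rw [Nat.mod_eq_of_lt (by omega), Nat.mod_eq_of_lt (by omega)]

theorem reg_set_self {R : ℕ} (s : State R) (r : Fin R) (v : ℤ) : (s.set r v).reg r = v :=
  Function.update_self _ _ _

theorem reg_set_ne {Q j k : ℕ} (s : State (Q + 1)) (v : ℤ) (hj : j ≤ Q) (hk : k ≤ Q) (hjk : j ≠ k) :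
    (s.set (rg Q k) v).reg (rg Q j) = s.reg (rg Q j) :=
  Function.update_of_ne (fun h => hjk ((rg_inj hj hk).1 h)) _ _

/-- The register of a variable. -/
def Var.reg (Q : ℕ) (x : Var) : Fin (Q + 1) := rg Q (4 + x.idx)

/-- The program that evaluates an expression into a temporary register. -/
def Ex.compile (Q : ℕ) : Ex → ℕ → Prog (Q + 1)
  | .var x, d => .arith .add (rg Q d) (x.reg Q) (rg Q 0)
  | .lit c, d => .const (rg Q d) c
  | .add a b, d => .seq (a.compile Q d) (.seq (b.compile Q (d + 1))
      (.arith .add (rg Q d) (rg Q d) (rg Q (d + 1))))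
  | .sub a b, d => .seq (a.compile Q d) (.seq (b.compile Q (d + 1))
      (.arith .sub (rg Q d) (rg Q d) (rg Q (d + 1))))
  | .mul a b, d => .seq (a.compile Q d) (.seq (b.compile Q (d + 1))
      (.arith .mul (rg Q d) (rg Q d) (rg Q (d + 1))))
  | .rd a, d => .seq (a.compile Q d) (.ifLt (rg Q d) (rg Q 0) (.const (rg Q d) 0)
      (.ifLt (rg Q d) (rg Q 2) (.read (rg Q d) (rg Q d)) (.const (rg Q d) 0)))
  | .ite a b c e, d => .seq (a.compile Q d) (.seq (b.compile Q (d + 1))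
      (.ifLt (rg Q d) (rg Q (d + 1)) (c.compile Q d) (e.compile Q d)))

/-- The data that stay fixed while a program runs. -/
structure Env where
  /-- the input -/
  A : List ℤ
  /-- the number of vertices -/
  n : ℕ
  /-- the number of bits of the input words -/
  b : ℕ
  three_le : 3 ≤ n
  length_eq : A.length = 2 * n + 4
  fits : ∀ x ∈ A, Fits b x
  n_fits : (n : ℤ) < 2 ^ b

/-- The values are in the range of array addresses. -/
def Env.Bounded (ε : Env) (σ : Store) : Prop := ∀ x, 0 ≤ σ x ∧ σ x < 2 * ε.n + 4

/-- The state represents the store and the output. -/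
structure Rep (ε : Env) (Q : ℕ) (s : State (Q + 1)) (σ : Store) (o : List ℤ) : Prop where
  zero : s.reg (rg Q 0) = 0
  num : s.reg (rg Q 1) = ε.n
  len : s.reg (rg Q 2) = 2 * ε.n + 4
  var : ∀ x, s.reg (Var.reg Q x) = σ x
  out : s.out = o

theorem Env.two_le (ε : Env) : 2 ≤ ε.b := by
  by_contra h
  have h1 := ε.n_fits
  have h2 := ε.three_le
  have h3 : (2 : ℤ) ^ ε.b ≤ 2 ^ 1 := pow_le_pow_right₀ (by norm_num) (by omega)
  omega

/-- As `n ≤ 2 ^ b - 1` and `2 ^ b ≥ 4`, the length is at most `2 * 2 ^ b + 2`. This is why a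
variable is given size `2` in `Ex.deg`. -/
theorem Env.len_lt (ε : Env) : (2 * ε.n + 4 : ℤ) ≤ 2 ^ (2 * ε.b) := by
  have h1 := ε.n_fits
  have h2 : (2 : ℤ) ^ 2 ≤ 2 ^ ε.b := pow_le_pow_right₀ (by norm_num) ε.two_le
  have h4 : (2 : ℤ) ^ (2 * ε.b) = 2 ^ ε.b * 2 ^ ε.b := by rw [two_mul, pow_add]
  rw [h4]
  nlinarith

theorem Fits.mono {w w' : ℕ} {x : ℤ} (h : Fits w x) (hw : w ≤ w') : Fits w' x :=
  lt_of_lt_of_le h (pow_le_pow_right₀ (by norm_num) hw)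

theorem Env.Bounded.fits {ε : Env} {σ : Store} (h : ε.Bounded σ) (x : Var) :
    Fits (2 * ε.b) (σ x) := by
  have h1 := h x
  have h2 := ε.len_lt
  rw [Fits, abs_of_nonneg h1.1]
  omega

theorem fits_add {w v : ℕ} {x y : ℤ} (hx : Fits w x) (hy : Fits w y) (hv : w + 1 ≤ v) :
    Fits v (x + y) ∧ Fits v (x - y) := by
  have h1 : (2 : ℤ) ^ (w + 1) ≤ 2 ^ v := pow_le_pow_right₀ (by norm_num) hv
  rw [pow_succ] at h1
  unfold Fits at *
  rw [abs_lt] at *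
  rw [abs_lt]
  constructor <;> constructor <;> omega

theorem fits_mul {w v : ℕ} {x y : ℤ} (hx : Fits w x) (hy : Fits v y) : Fits (w + v) (x * y) := by
  unfold Fits at *
  rw [abs_mul, pow_add]
  exact mul_lt_mul'' hx hy (abs_nonneg _) (abs_nonneg _)

theorem fits_lit (c : ℤ) {b : ℕ} (hb : 1 ≤ b) : Fits ((c.natAbs + 1) * b) c := by
  have h1 : c.natAbs < 2 ^ ((c.natAbs + 1) * b) :=
    (Nat.lt_two_pow_self).trans_le (Nat.pow_le_pow_right (by norm_num)
      ((Nat.le_succ _).trans (Nat.le_mul_of_pos_right _ hb)))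
  rw [Fits, Int.abs_eq_natAbs]
  exact_mod_cast h1

theorem Env.fits_readAt (ε : Env) (v : ℤ) : Fits ε.b (readAt ε.A v) := by
  have h0 : Fits ε.b 0 := by simp [Fits]
  unfold readAt
  split_ifs with h
  · exact h0
  · rw [List.getD_eq_getElem?_getD]
    rcases h1 : ε.A[v.toNat]? with _ | y
    · exact h0
    · exact ε.fits y (List.mem_of_getElem? h1)

theorem Ex.eval_fits (ε : Env) {σ : Store} (hσ : ε.Bounded σ) (e : Ex) :
    Fits (e.deg * ε.b) (e.eval ε.A σ) := by
  have hb := ε.two_le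
  induction e with
  | var x => exact hσ.fits x
  | lit c => exact fits_lit c (by omega)
  | add a b ha hb' =>
    refine (fits_add (ha.mono (Nat.mul_le_mul_right _ (le_max_left _ b.deg)))
      (hb'.mono (Nat.mul_le_mul_right _ (le_max_right a.deg _))) ?_).1
    rw [Ex.deg, add_mul]; omega
  | sub a b ha hb' =>
    refine (fits_add (ha.mono (Nat.mul_le_mul_right _ (le_max_left _ b.deg)))
      (hb'.mono (Nat.mul_le_mul_right _ (le_max_right a.deg _))) ?_).2
    rw [Ex.deg, add_mul]; omega
  | mul a b ha hb' => rw [Ex.deg, add_mul]; exact fits_mul ha hb'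
  | rd a _ => rw [Ex.deg, one_mul]; exact ε.fits_readAt _
  | ite a b c d _ _ hc hd =>
    rw [Ex.eval]
    split_ifs
    · exact hc.mono (Nat.mul_le_mul_right _ (le_max_left _ _))
    · exact hd.mono (Nat.mul_le_mul_right _ (le_max_right _ _))

/-- The number of the first temporary register. -/
def tmp : ℕ := 16

theorem Rep.of_eq {ε : Env} {Q : ℕ} {s s' : State (Q + 1)} {σ : Store} {o : List ℤ}
    (h : Rep ε Q s σ o) (hr : ∀ j < tmp, s'.reg (rg Q j) = s.reg (rg Q j)) (ho : s'.out = s.out) :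
    Rep ε Q s' σ o where
  zero := by rw [hr 0 (by decide)]; exact h.zero
  num := by rw [hr 1 (by decide)]; exact h.num
  len := by rw [hr 2 (by decide)]; exact h.len
  var x := by
    have := x.idx_lt
    rw [Var.reg, hr _ (by unfold tmp; omega)]; exact h.var x
  out := by rw [ho]; exact h.out

/-- The program of an expression evaluates it. -/
theorem Ex.compile_spec (ε : Env) {Q : ℕ} {σ : Store} (hσ : ε.Bounded σ) {W : ℕ} (e : Ex) :
    ∀ (d : ℕ) (s : State (Q + 1)) (o : List ℤ), Rep ε Q s σ o → tmp ≤ d → d + e.height ≤ Q →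
      e.width ≤ W → ∃ t s', Exec ε.A (W * ε.b) (e.compile Q d) s t s' ∧ t ≤ e.time ∧
        s'.reg (rg Q d) = e.eval ε.A σ ∧ (∀ j < d, s'.reg (rg Q j) = s.reg (rg Q j)) ∧
        s'.out = s.out := by
  have hb := ε.two_le
  have hlt : ∀ {a : ℕ}, a ≤ W → a * ε.b ≤ W * ε.b := fun h => Nat.mul_le_mul_right _ h
  -- Temporary registers form a stack: the second operand is evaluated one register higher and
  -- leaves the value of the first operand and the variables untouched.
  have two : ∀ (a b : Ex), (∀ (d : ℕ) (s : State (Q + 1)) (o : List ℤ), Rep ε Q s σ o → tmp ≤ d →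
      d + a.height ≤ Q → a.width ≤ W → ∃ t s', Exec ε.A (W * ε.b) (a.compile Q d) s t s' ∧
        t ≤ a.time ∧ s'.reg (rg Q d) = a.eval ε.A σ ∧
        (∀ j < d, s'.reg (rg Q j) = s.reg (rg Q j)) ∧ s'.out = s.out) →
      (∀ (d : ℕ) (s : State (Q + 1)) (o : List ℤ), Rep ε Q s σ o → tmp ≤ d →
      d + b.height ≤ Q → b.width ≤ W → ∃ t s', Exec ε.A (W * ε.b) (b.compile Q d) s t s' ∧
        t ≤ b.time ∧ s'.reg (rg Q d) = b.eval ε.A σ ∧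
        (∀ j < d, s'.reg (rg Q j) = s.reg (rg Q j)) ∧ s'.out = s.out) →
      ∀ (d : ℕ) (s : State (Q + 1)) (o : List ℤ), Rep ε Q s σ o → tmp ≤ d →
        d + max a.height (b.height + 1) ≤ Q → max a.width b.width ≤ W →
        ∃ t t' s₁ s', Exec ε.A (W * ε.b) (a.compile Q d) s t s₁ ∧
          Exec ε.A (W * ε.b) (b.compile Q (d + 1)) s₁ t' s' ∧ t ≤ a.time ∧ t' ≤ b.time ∧
          s'.reg (rg Q d) = a.eval ε.A σ ∧ s'.reg (rg Q (d + 1)) = b.eval ε.A σ ∧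
          (∀ j < d, s'.reg (rg Q j) = s.reg (rg Q j)) ∧ s'.out = s.out ∧ Rep ε Q s' σ o := by
    intro a b ha hb' d s o hs hd hh hw
    obtain ⟨t, s₁, h1, h2, h3, h4, h5⟩ := ha d s o hs hd (by omega) (by omega)
    have hs1 : Rep ε Q s₁ σ o := hs.of_eq (fun j hj => h4 j (by omega)) h5
    obtain ⟨t', s', g1, g2, g3, g4, g5⟩ := hb' (d + 1) s₁ o hs1 (by omega) (by omega) (by omega)
    have h6 : ∀ j < d, s'.reg (rg Q j) = s.reg (rg Q j) := fun j hj => by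
      rw [g4 j (by omega), h4 j hj]
    exact ⟨t, t', s₁, s', h1, g1, h2, g2, by rw [g4 d (by omega), h3], g3, h6, by rw [g5, h5],
      hs.of_eq (fun j hj => h6 j (by omega)) (by rw [g5, h5])⟩
  have fin : ∀ (op : ArithOp) (a b e : Ex) (d : ℕ) (s : State (Q + 1)) (o : List ℤ),
      tmp ≤ d → d + max a.height (b.height + 1) ≤ Q → e.deg ≤ W →
      e.eval ε.A σ = op.eval (a.eval ε.A σ) (b.eval ε.A σ) → e.time = a.time + b.time + 1 →
      (∃ t t' s₁ s', Exec ε.A (W * ε.b) (a.compile Q d) s t s₁ ∧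
          Exec ε.A (W * ε.b) (b.compile Q (d + 1)) s₁ t' s' ∧ t ≤ a.time ∧ t' ≤ b.time ∧
          s'.reg (rg Q d) = a.eval ε.A σ ∧ s'.reg (rg Q (d + 1)) = b.eval ε.A σ ∧
          (∀ j < d, s'.reg (rg Q j) = s.reg (rg Q j)) ∧ s'.out = s.out ∧ Rep ε Q s' σ o) →
      ∃ t s', Exec ε.A (W * ε.b) (.seq (a.compile Q d) (.seq (b.compile Q (d + 1))
        (.arith op (rg Q d) (rg Q d) (rg Q (d + 1))))) s t s' ∧ t ≤ e.time ∧
        s'.reg (rg Q d) = e.eval ε.A σ ∧ (∀ j < d, s'.reg (rg Q j) = s.reg (rg Q j)) ∧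
        s'.out = s.out := by
    rintro op a b e d s o hd hh hw he ht ⟨t, t', s₁, s', h1, h2, h3, h4, h5, h6, h7, h8, -⟩
    refine ⟨_, _, .seq h1 (.seq h2 (.arith ?_)), by omega, ?_, ?_, h8⟩
    · rw [h5, h6, ← he]
      exact (e.eval_fits ε hσ).mono (hlt hw)
    · rw [reg_set_self, h5, h6, he]
    · intro j hj
      rw [reg_set_ne _ _ (by omega) (by omega) (by omega), h7 j hj]
  induction e with
  | var x =>
    intro d s o hs hd hh hw
    have hx := x.idx_lt
    have h1 : s.reg (x.reg Q) + s.reg (rg Q 0) = σ x := by rw [hs.zero, add_zero, hs.var]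
    refine ⟨1, _, .arith ?_, le_rfl, ?_, ?_, rfl⟩
    · change Fits _ (s.reg (x.reg Q) + s.reg (rg Q 0))
      rw [h1]
      exact (hσ.fits x).mono (hlt hw)
    · rw [reg_set_self]; exact h1
    · intro j hj
      rw [reg_set_ne _ _ (by omega) (by omega) (by omega)]
  | lit c =>
    intro d s o hs hd hh hw
    refine ⟨1, _, .const ((fits_lit c (by omega)).mono (hlt hw)), le_rfl, reg_set_self _ _ _, ?_, rfl⟩
    intro j hj
    rw [reg_set_ne _ _ (by omega) (by omega) (by omega)]
  | add a b ha hb' =>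
    intro d s o hs hd hh hw
    simp only [Ex.width, Ex.height] at hh hw
    exact fin .add a b (.add a b) d s o hd hh (by simp only [Ex.deg]; omega) rfl rfl
      (two a b ha hb' d s o hs hd hh (by omega))
  | sub a b ha hb' =>
    intro d s o hs hd hh hw
    simp only [Ex.width, Ex.height] at hh hw
    exact fin .sub a b (.sub a b) d s o hd hh (by simp only [Ex.deg]; omega) rfl rfl
      (two a b ha hb' d s o hs hd hh (by omega))
  | mul a b ha hb' =>
    intro d s o hs hd hh hw
    simp only [Ex.width, Ex.height] at hh hw
    exact fin .mul a b (.mul a b) d s o hd hh (by simp only [Ex.deg]; omega) rfl rfl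
      (two a b ha hb' d s o hs hd hh (by omega))
  | rd a ha =>
    intro d s o hs hd hh hw
    simp only [Ex.width, Ex.height] at hh hw
    obtain ⟨t, s', h1, h2, h3, h4, h5⟩ := ha d s o hs hd (by omega) (by omega)
    have hs' : Rep ε Q s' σ o := hs.of_eq (fun j hj => h4 j (by omega)) h5
    have h0 : Fits (W * ε.b) 0 := by simp [Fits]
    have hset : ∀ v, ∀ j < d, (s'.set (rg Q d) v).reg (rg Q j) = s.reg (rg Q j) := by
      intro v j hj
      rw [reg_set_ne _ _ (by omega) (by omega) (by omega), h4 j hj]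
    simp only [Ex.compile, Ex.eval, Ex.time, readAt]
    by_cases hneg : a.eval ε.A σ < 0
    · refine ⟨_, _, .seq h1 (.ifTrue (by rw [h3, hs'.zero]; exact hneg) (.const h0)), by omega, ?_,
        hset _, h5⟩
      rw [reg_set_self, if_pos hneg]
    · rw [if_neg hneg]
      have hn : ¬ s'.reg (rg Q d) < s'.reg (rg Q 0) := by rw [h3, hs'.zero]; exact hneg
      have hlen := ε.length_eq
      by_cases hin : a.eval ε.A σ < 2 * ε.n + 4
      · have hlt' : (a.eval ε.A σ).toNat < ε.A.length := by omega
        refine ⟨_, _, .seq h1 (.ifFalse hn (.ifTrue (by rw [h3, hs'.len]; exact hin)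
          (.read (m := (a.eval ε.A σ).toNat) (x := ε.A[(a.eval ε.A σ).toNat])
            (by rw [h3]; omega) (List.getElem?_eq_getElem hlt')
            ((ε.fits _ (List.getElem_mem _)).mono ?_)))), by omega, ?_, hset _, h5⟩
        · have := hlt (show 1 ≤ W by omega)
          omega
        · rw [reg_set_self, List.getD_eq_getElem?_getD, List.getElem?_eq_getElem hlt']
          rfl
      · refine ⟨_, _, .seq h1 (.ifFalse hn (.ifFalse (by rw [h3, hs'.len]; exact hin)
          (.const h0))), by omega, ?_, hset _, h5⟩
        rw [reg_set_self, List.getD_eq_getElem?_getD, List.getElem?_eq_none (by omega)]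
        rfl
  | ite a b c e ha hb' hc he =>
    intro d s o hs hd hh hw
    simp only [Ex.width, Ex.height] at hh hw
    obtain ⟨t, t', s₁, s', h1, h2, h3, h4, h5, h6, h7, h8, h9⟩ :=
      two a b ha hb' d s o hs hd (by omega) (by omega)
    simp only [Ex.compile, Ex.eval, Ex.time]
    by_cases hlt : a.eval ε.A σ < b.eval ε.A σ
    · obtain ⟨t'', s'', g1, g2, g3, g4, g5⟩ := hc d s' o h9 hd (by omega) (by omega)
      refine ⟨_, _, .seq h1 (.seq h2 (.ifTrue (by rw [h5, h6]; exact hlt) g1)), by omega,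
        by rw [g3, if_pos hlt], fun j hj => by rw [g4 j hj, h7 j hj], by rw [g5, h8]⟩
    · obtain ⟨t'', s'', g1, g2, g3, g4, g5⟩ := he d s' o h9 hd (by omega) (by omega)
      refine ⟨_, _, .seq h1 (.seq h2 (.ifFalse (by rw [h5, h6]; exact hlt) g1)), by omega,
        by rw [g3, if_neg hlt], fun j hj => by rw [g4 j hj, h7 j hj], by rw [g5, h8]⟩

/-- Commands; those of level `false` have no loops, those of level `true` have no nested loops.
An assignment of a value that is not an array address assigns `0`. -/
inductive Cmd : Bool → Type
  | skip {l : Bool} : Cmd l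
  | asg {l : Bool} (y : Var) (a : Ex) : Cmd l
  | seq {l : Bool} (c d : Cmd l) : Cmd l
  | ifc {l : Bool} (a b : Ex) (c d : Cmd l) : Cmd l
  | emit {l : Bool} (a : Ex) : Cmd l
  | forN (y : Var) (c : Cmd false) : Cmd true

/-- Values that are not array addresses are replaced by `0`. -/
def clip (n : ℕ) (v : ℤ) : ℤ := if v < 0 then 0 else if v < 2 * n + 4 then v else 0

theorem clip_of_mem {n : ℕ} {v : ℤ} (h : 0 ≤ v) (h' : v < 2 * n + 4) : clip n v = v := by
  rw [clip, if_neg (not_lt.2 h), if_pos h']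

theorem clip_mem (n : ℕ) (v : ℤ) : 0 ≤ clip n v ∧ clip n v < 2 * n + 4 := by
  unfold clip; split_ifs <;> omega

/-- Apply `f 0`, …, `f (m - 1)`. -/
def loop {α : Type*} (f : ℕ → α → α) : ℕ → α → α
  | 0, p => p
  | m + 1, p => f m (loop f m p)

/-- The effect of a command on the variables and the output. -/
def Cmd.run (A : List ℤ) (n : ℕ) : {l : Bool} → Cmd l → Store × List ℤ → Store × List ℤ
  | _, .skip, p => p
  | _, .asg y a, p => (Function.update p.1 y (clip n (a.eval A p.1)), p.2)
  | _, .seq c d, p => d.run A n (c.run A n p)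
  | _, .ifc a b c d, p => if a.eval A p.1 < b.eval A p.1 then c.run A n p else d.run A n p
  | _, .emit a, p => (p.1, p.2 ++ [a.eval A p.1])
  | _, .forN y c, p => loop (fun m p => c.run A n (Function.update p.1 y m, p.2)) n p

def Cmd.width : {l : Bool} → Cmd l → ℕ
  | _, .skip => 0
  | _, .asg _ a => a.width
  | _, .seq c d => max c.width d.width
  | _, .ifc a b c d => max (max a.width b.width) (max c.width d.width)
  | _, .emit a => a.width
  | _, .forN _ c => c.width

def Cmd.height : {l : Bool} → Cmd l → ℕ
  | _, .skip => 0
  | _, .asg _ a => a.height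
  | _, .seq c d => max c.height d.height
  | _, .ifc a b c d => max (max a.height (b.height + 1)) (max c.height d.height)
  | _, .emit a => a.height
  | _, .forN _ c => c.height

/-- A bound for the time of a command, per iteration of its loops. -/
def Cmd.time : {l : Bool} → Cmd l → ℕ
  | _, .skip => 1
  | _, .asg _ a => a.time + 3
  | _, .seq c d => c.time + d.time
  | _, .ifc a b c d => a.time + b.time + 1 + (c.time + d.time)
  | _, .emit a => a.time + 1
  | _, .forN _ c => c.time + 4

/-- The program of a command. -/
def Cmd.compile (Q : ℕ) : {l : Bool} → Cmd l → Prog (Q + 1)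
  | _, .skip => .const (rg Q tmp) 0
  | _, .asg y a => .seq (a.compile Q tmp) (.ifLt (rg Q tmp) (rg Q 0) (.const (y.reg Q) 0)
      (.ifLt (rg Q tmp) (rg Q 2) (.arith .add (y.reg Q) (rg Q tmp) (rg Q 0)) (.const (y.reg Q) 0)))
  | _, .seq c d => .seq (c.compile Q) (d.compile Q)
  | _, .ifc a b c d => .seq (a.compile Q tmp) (.seq (b.compile Q (tmp + 1))
      (.ifLt (rg Q tmp) (rg Q (tmp + 1)) (c.compile Q) (d.compile Q)))
  | _, .emit a => .seq (a.compile Q tmp) (.emit (rg Q tmp))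
  | _, .forN y c => .seq (.const (rg Q 3) 0) (.whileLt (rg Q 3) (rg Q 1)
      (.seq (.arith .add (y.reg Q) (rg Q 3) (rg Q 0)) (.seq (c.compile Q)
        (.seq (.const (rg Q tmp) 1) (.arith .add (rg Q 3) (rg Q 3) (rg Q tmp))))))

theorem Rep.set_var {ε : Env} {Q : ℕ} {s : State (Q + 1)} {σ : Store} {o : List ℤ}
    (h : Rep ε Q s σ o) (hQ : tmp ≤ Q) (y : Var) (v : ℤ) :
    Rep ε Q (s.set (y.reg Q) v) (Function.update σ y v) o := by
  have hy := y.idx_lt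
  unfold tmp at hQ
  refine ⟨?_, ?_, ?_, fun x => ?_, h.out⟩
  · rw [Var.reg, reg_set_ne _ _ (by omega) (by omega) (by omega)]; exact h.zero
  · rw [Var.reg, reg_set_ne _ _ (by omega) (by omega) (by omega)]; exact h.num
  · rw [Var.reg, reg_set_ne _ _ (by omega) (by omega) (by omega)]; exact h.len
  · have hx := x.idx_lt
    by_cases hxy : x = y
    · subst hxy
      rw [reg_set_self, Function.update_self]
    · rw [Function.update_of_ne hxy, Var.reg, Var.reg,
        reg_set_ne _ _ (by omega) (by omega) (fun h0 => hxy (Var.idx_injective (by omega)))]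
      exact h.var x

theorem Rep.set_other {ε : Env} {Q : ℕ} {s : State (Q + 1)} {σ : Store} {o : List ℤ}
    (h : Rep ε Q s σ o) {k : ℕ} (hk : k = 3 ∨ tmp ≤ k) (hkQ : k ≤ Q) (hQ : tmp ≤ Q) (v : ℤ) :
    Rep ε Q (s.set (rg Q k) v) σ o := by
  unfold tmp at *
  refine ⟨?_, ?_, ?_, fun x => ?_, h.out⟩
  · rw [reg_set_ne _ _ (by omega) hkQ (by omega)]; exact h.zero
  · rw [reg_set_ne _ _ (by omega) hkQ (by omega)]; exact h.num
  · rw [reg_set_ne _ _ (by omega) hkQ (by omega)]; exact h.len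
  · have hx := x.idx_lt
    rw [Var.reg, reg_set_ne _ _ (by omega) (by omega) (by omega)]; exact h.var x

theorem Env.Bounded.update {ε : Env} {σ : Store} (h : ε.Bounded σ) (y : Var) {v : ℤ}
    (hv : 0 ≤ v) (hv' : v < 2 * ε.n + 4) : ε.Bounded (Function.update σ y v) := by
  intro x
  by_cases hx : x = y
  · subst hx; rw [Function.update_self]; exact ⟨hv, hv'⟩
  · rw [Function.update_of_ne hx]; exact h x

theorem loop_induction {α : Type*} {f : ℕ → α → α} {p : ℕ → α → Prop} {m : ℕ} {a : α} (h0 : p 0 a)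
    (hs : ∀ k < m, ∀ x, p k x → p (k + 1) (f k x)) : p m (loop f m a) := by
  induction m with
  | zero => exact h0
  | succ m ih => exact hs m (Nat.lt_succ_self m) _ (ih fun k hk => hs k (hk.trans (Nat.lt_succ_self m)))

theorem Cmd.run_bounded (ε : Env) {l : Bool} (c : Cmd l) :
    ∀ p : Store × List ℤ, ε.Bounded p.1 → ε.Bounded (c.run ε.A ε.n p).1 := by
  induction c with
  | skip => exact fun p hp => hp
  | asg y a =>
    intro p hp
    have := clip_mem ε.n (a.eval ε.A p.1)
    exact hp.update y this.1 this.2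
  | seq c d hc hd => exact fun p hp => hd _ (hc _ hp)
  | ifc a b c d hc hd =>
    intro p hp
    simp only [Cmd.run]
    split_ifs
    exacts [hc _ hp, hd _ hp]
  | emit a => exact fun p hp => hp
  | forN y c hc =>
    intro p hp
    refine loop_induction (p := fun _ (p : Store × List ℤ) => ε.Bounded p.1) hp fun k hk x hx => hc _ ?_
    exact hx.update y (by omega) (by omega)

theorem Exec.arith_of_eq {R : ℕ} {A : List ℤ} {w : ℕ} {s : State R} {op : ArithOp} {r a b : Fin R}
    {v : ℤ} (hv : op.eval (s.reg a) (s.reg b) = v) (h : Fits w v) :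
    Exec A w (.arith op r a b) s 1 (s.set r v) := by
  subst hv; exact .arith h

/-- The program of a command has the effect of the command. -/
theorem Cmd.compile_spec (ε : Env) {Q W : ℕ} (hW : 2 ≤ W) {l : Bool} (c : Cmd l) :
    ∀ (s : State (Q + 1)) (p : Store × List ℤ), Rep ε Q s p.1 p.2 → ε.Bounded p.1 →
      tmp + c.height ≤ Q → c.width ≤ W →
      ∃ t s', Exec ε.A (W * ε.b) (c.compile Q) s t s' ∧ t ≤ c.time * (if l then ε.n + 1 else 1) ∧
        Rep ε Q s' (c.run ε.A ε.n p).1 (c.run ε.A ε.n p).2 ∧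
        (l = false → s'.reg (rg Q 3) = s.reg (rg Q 3)) := by
  have hb := ε.two_le
  have hlt : ∀ {a : ℕ}, a ≤ W → a * ε.b ≤ W * ε.b := fun h => Nat.mul_le_mul_right _ h
  have h0 : Fits (W * ε.b) 0 := by simp [Fits]
  have h1 : Fits (W * ε.b) 1 := by
    have := (fits_lit 1 (b := ε.b) (by omega)).mono (hlt hW)
    exact this
  have hfac : ∀ l : Bool, 1 ≤ (if l then ε.n + 1 else 1) := by intro l; cases l <;> simp
  have tm : tmp = 16 := rfl
  have hvar3 : ∀ (s : State (Q + 1)) (y : Var) (v : ℤ), tmp ≤ Q →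
      (s.set (y.reg Q) v).reg (rg Q 3) = s.reg (rg Q 3) := by
    intro s y v hQ
    have := y.idx_lt
    exact reg_set_ne _ _ (by omega) (by omega) (by omega)
  induction c with
  | skip =>
    intro s p hs hp hh hw
    exact ⟨1, _, .const h0, by rw [Cmd.time, one_mul]; exact hfac _,
      hs.set_other (Or.inr le_rfl) (by omega) (by omega) 0,
      fun _ => reg_set_ne _ _ (by omega) (by omega) (by omega)⟩
  | @asg l y a =>
    intro s p hs hp hh hw
    simp only [Cmd.height, Cmd.width] at hh hw
    obtain ⟨t, s₁, e1, e2, e3, e4, e5⟩ := a.compile_spec ε hp (W := W) tmp s p.2 hs le_rfl hh hw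
    have hs1 : Rep ε Q s₁ p.1 p.2 := hs.of_eq e4 e5
    have ht : t + (1 + 1 + 1) ≤ Cmd.time (.asg (l := l) y a) * (if l then ε.n + 1 else 1) := by
      have := Nat.mul_le_mul_left (a.time + 3) (hfac l)
      rw [Cmd.time]; omega
    have h3 : s₁.reg (rg Q 3) = s.reg (rg Q 3) := e4 3 (by decide)
    simp only [Cmd.run, clip]
    have c0 := hs1.set_var (by omega) y 0
    by_cases hneg : a.eval ε.A p.1 < 0
    · rw [if_pos hneg]
      exact ⟨_, _, .seq e1 (.ifTrue (by rw [e3, hs1.zero]; exact hneg) (.const h0)), by omega, c0,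
        fun _ => by rw [hvar3 _ _ _ (by omega), h3]⟩
    · rw [if_neg hneg]
      have hn : ¬ s₁.reg (rg Q tmp) < s₁.reg (rg Q 0) := by rw [e3, hs1.zero]; exact hneg
      by_cases hin : a.eval ε.A p.1 < 2 * ε.n + 4
      · rw [if_pos hin]
        have hval : s₁.reg (rg Q tmp) + s₁.reg (rg Q 0) = a.eval ε.A p.1 := by
          rw [e3, hs1.zero, add_zero]
        refine ⟨_, _, .seq e1 (.ifFalse hn (.ifTrue (by rw [e3, hs1.len]; exact hin)
          (.arith_of_eq hval ?_))), by omega, hs1.set_var (by omega) y _,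
          fun _ => by rw [hvar3 _ _ _ (by omega), h3]⟩
        have h4 := ε.len_lt
        refine Fits.mono (w := 2 * ε.b) ?_ (hlt hW)
        rw [Fits, abs_of_nonneg (not_lt.1 hneg)]
        omega
      · rw [if_neg hin]
        exact ⟨_, _, .seq e1 (.ifFalse hn (.ifFalse (by rw [e3, hs1.len]; exact hin) (.const h0))),
          by omega, c0, fun _ => by rw [hvar3 _ _ _ (by omega), h3]⟩
  | seq c d hc hd =>
    intro s p hs hp hh hw
    simp only [Cmd.height, Cmd.width] at hh hw
    obtain ⟨t, s₁, e1, e2, e3, e4⟩ := hc s p hs hp (by omega) (by omega)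
    obtain ⟨t', s₂, f1, f2, f3, f4⟩ := hd s₁ _ e3 (c.run_bounded ε p hp) (by omega) (by omega)
    exact ⟨_, _, .seq e1 f1, by rw [Cmd.time, add_mul]; omega, f3, fun h => by rw [f4 h, e4 h]⟩
  | @ifc l a b c d hc hd =>
    intro s p hs hp hh hw
    simp only [Cmd.height, Cmd.width] at hh hw
    obtain ⟨t, s₁, e1, e2, e3, e4, e5⟩ := a.compile_spec ε hp (W := W) tmp s p.2 hs le_rfl (by omega) (by omega)
    have hs1 : Rep ε Q s₁ p.1 p.2 := hs.of_eq e4 e5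
    obtain ⟨t', s₂, f1, f2, f3, f4, f5⟩ :=
      b.compile_spec ε hp (W := W) (tmp + 1) s₁ p.2 hs1 (by omega) (by omega) (by omega)
    have hs2 : Rep ε Q s₂ p.1 p.2 := hs1.of_eq (fun j hj => f4 j (by omega)) f5
    have h3 : s₂.reg (rg Q 3) = s.reg (rg Q 3) := by rw [f4 3 (by omega), e4 3 (by omega)]
    have h4 : s₂.reg (rg Q tmp) = a.eval ε.A p.1 := by rw [f4 _ (by omega), e3]
    have hm := Nat.mul_le_mul_left (a.time + b.time + 1) (hfac l)
    simp only [Cmd.run, Cmd.time]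
    by_cases hlt : a.eval ε.A p.1 < b.eval ε.A p.1
    · obtain ⟨t'', s', g1, g2, g3, g4⟩ := hc s₂ p hs2 hp (by omega) (by omega)
      refine ⟨_, _, .seq e1 (.seq f1 (.ifTrue (by rw [h4, f3]; exact hlt) g1)), ?_, ?_,
        fun h => by rw [g4 h, h3]⟩
      · rw [add_mul, add_mul c.time]; omega
      · rw [if_pos hlt]; exact g3
    · obtain ⟨t'', s', g1, g2, g3, g4⟩ := hd s₂ p hs2 hp (by omega) (by omega)
      refine ⟨_, _, .seq e1 (.seq f1 (.ifFalse (by rw [h4, f3]; exact hlt) g1)), ?_, ?_,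
        fun h => by rw [g4 h, h3]⟩
      · rw [add_mul, add_mul c.time]; omega
      · rw [if_neg hlt]; exact g3
  | @emit l a =>
    intro s p hs hp hh hw
    simp only [Cmd.height, Cmd.width] at hh hw
    obtain ⟨t, s₁, e1, e2, e3, e4, e5⟩ := a.compile_spec ε hp (W := W) tmp s p.2 hs le_rfl hh hw
    have hs1 : Rep ε Q s₁ p.1 p.2 := hs.of_eq e4 e5
    refine ⟨_, _, .seq e1 .emit, ?_, ?_, fun _ => e4 3 (by decide)⟩
    · have := Nat.mul_le_mul_left (a.time + 1) (hfac l)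
      rw [Cmd.time]; omega
    · exact ⟨hs1.zero, hs1.num, hs1.len, hs1.var, by
        simp only [Cmd.run]; rw [hs1.out, e3]⟩
  | forN y c hc =>
    intro s p hs hp hh hw
    simp only [Cmd.height, Cmd.width] at hh hw
    set f : ℕ → Store × List ℤ → Store × List ℤ :=
      fun m p => c.run ε.A ε.n (Function.update p.1 y m, p.2) with hf
    have hbd : ∀ m, m ≤ ε.n → ε.Bounded (loop f m p).1 := fun m hm =>
      loop_induction (p := fun _ (p : Store × List ℤ) => ε.Bounded p.1) hp fun k hk x hx =>
        c.run_bounded ε _ (hx.update y (by omega) (by omega))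
    -- Induction on the number `d` of remaining iterations. Register `3` is the loop counter; it
    -- survives because the body, of level `false`, contains no loop.
    have main : ∀ d m, m + d = ε.n → ∀ s : State (Q + 1),
        Rep ε Q s (loop f m p).1 (loop f m p).2 → s.reg (rg Q 3) = m →
        ∃ t s', Exec ε.A (W * ε.b) (.whileLt (rg Q 3) (rg Q 1)
          (.seq (.arith .add (y.reg Q) (rg Q 3) (rg Q 0)) (.seq (c.compile Q)
            (.seq (.const (rg Q tmp) 1) (.arith .add (rg Q 3) (rg Q 3) (rg Q tmp)))))) s t s' ∧
          t ≤ (c.time + 4) * d + 1 ∧ Rep ε Q s' (loop f ε.n p).1 (loop f ε.n p).2 := by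
      intro d
      induction d with
      | zero =>
        intro m hm s hs h3
        obtain rfl : m = ε.n := by omega
        exact ⟨1, s, .whileFalse (by rw [h3, hs.num]; exact lt_irrefl _), by omega, hs⟩
      | succ d ih =>
        intro m hm s hs h3
        have hn := ε.len_lt
        have fm : ∀ v : ℤ, 0 ≤ v → v ≤ ε.n → Fits (W * ε.b) v := fun v hv hv' => by
          refine Fits.mono (w := 2 * ε.b) ?_ (hlt hW)
          rw [Fits, abs_of_nonneg hv]; omega
        have hv : s.reg (rg Q 3) + s.reg (rg Q 0) = m := by rw [h3, hs.zero, add_zero]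
        have hs1 := hs.set_var (by omega) y m
        obtain ⟨t, s', e1, e2, e3, e4⟩ := hc (s.set (y.reg Q) m) (Function.update (loop f m p).1 y m,
          (loop f m p).2) hs1 ((hbd m (by omega)).update y (by omega) (by omega)) hh hw
        have h3' : s'.reg (rg Q 3) = m := by rw [e4 rfl, hvar3 _ _ _ (by omega), h3]
        have hs2 := (e3.set_other (k := tmp) (Or.inr le_rfl) (by omega) (by omega) 1)
        have hv2 : (s'.set (rg Q tmp) 1).reg (rg Q 3) + (s'.set (rg Q tmp) 1).reg (rg Q tmp) =
            ((m + 1 : ℕ) : ℤ) := by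
          rw [reg_set_self, reg_set_ne _ _ (by omega) (by omega) (by omega), h3']; push_cast; ring
        have hs3 := hs2.set_other (k := 3) (Or.inl rfl) (by omega) (by omega) ((m + 1 : ℕ) : ℤ)
        obtain ⟨t', s'', g1, g2, g3⟩ := ih (m + 1) (by omega) _ hs3 (reg_set_self _ _ _)
        exact ⟨_, _, .whileTrue (by rw [h3, hs.num]; omega) (.seq (.arith_of_eq hv
          (fm m (by omega) (by omega))) (.seq e1 (.seq (.const h1) (.arith_of_eq hv2
            (fm _ (by omega) (by omega)))))) g1, by rw [if_neg (by decide)] at e2; rw [mul_add]; omega,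
          g3⟩
    obtain ⟨t, s', e1, e2, e3⟩ := main ε.n 0 (by omega) (s.set (rg Q 3) 0)
      (hs.set_other (Or.inl rfl) (by omega) (by omega) 0) (by rw [reg_set_self]; rfl)
    refine ⟨_, _, .seq (.const h0) e1, ?_, e3, fun h => absurd h (by decide)⟩
    rw [Cmd.time, if_pos rfl, mul_add]
    omega

/-! ### Programs with one loop around a command -/

/-- Compute the registers that are not variables, run `c`, and repeat `d` while the flag is set. -/
def mainProg (Q : ℕ) (c d : Cmd true) : Prog (Q + 1) :=
  .seq (.seq (.const (rg Q tmp) 0) (.seq (.read (rg Q 1) (rg Q tmp))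
    (.seq (.arith .add (rg Q 2) (rg Q 1) (rg Q 1)) (.seq (.const (rg Q tmp) 4)
      (.arith .add (rg Q 2) (rg Q 2) (rg Q tmp))))))
    (.seq (c.compile Q) (.whileLt (rg Q 0) (Var.flag.reg Q) (d.compile Q)))

theorem Fits.of_nonneg {w : ℕ} {x : ℤ} (h : 0 ≤ x) (h' : x < 2 ^ w) : Fits w x := by
  rwa [Fits, abs_of_nonneg h]

theorem prologue_spec (ε : Env) {Q W : ℕ} (hW : 2 ≤ W) (hQ : tmp ≤ Q) (hn : ε.A[0]? = some (ε.n : ℤ)) :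
    ∃ s', Exec ε.A (W * ε.b) (.seq (.const (rg Q tmp) 0) (.seq (.read (rg Q 1) (rg Q tmp))
      (.seq (.arith .add (rg Q 2) (rg Q 1) (rg Q 1)) (.seq (.const (rg Q tmp) 4)
      (.arith .add (rg Q 2) (rg Q 2) (rg Q tmp)))))) (State.init (Q + 1)) 5 s' ∧
      Rep ε Q s' (fun _ => 0) [] := by
  have hb := ε.two_le
  have hlen := ε.len_lt
  have hnf := ε.n_fits
  have tm : tmp = 16 := rfl
  have hw : (2 : ℤ) ^ (2 * ε.b) ≤ 2 ^ (W * ε.b) :=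
    pow_le_pow_right₀ (by norm_num) (Nat.mul_le_mul_right _ hW)
  have hfit : ∀ v : ℤ, 0 ≤ v → v < 2 * ε.n + 4 → Fits (W * ε.b) v := fun v h1 h2 =>
    Fits.of_nonneg h1 (by omega)
  have h3 := ε.three_le
  have hlast : Fits (W * ε.b) (2 * ε.n + 4) := by
    refine Fits.of_nonneg (by omega) ?_
    have h4 : (2 : ℤ) ^ 2 ≤ 2 ^ ε.b := pow_le_pow_right₀ (by norm_num) hb
    have h5 : (2 : ℤ) ^ (2 * ε.b) = 2 ^ ε.b * 2 ^ ε.b := by rw [two_mul, pow_add]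
    nlinarith
  set s0 := State.init (Q + 1)
  set s1 := s0.set (rg Q tmp) 0 with hs1
  set s2 := s1.set (rg Q 1) ε.n with hs2
  set s3 := s2.set (rg Q 2) (2 * ε.n) with hs3
  set s4 := s3.set (rg Q tmp) 4 with hs4
  set s5 := s4.set (rg Q 2) (2 * ε.n + 4) with hs5
  have a1 : s1.reg (rg Q tmp) = ((0 : ℕ) : ℤ) := reg_set_self _ _ _
  have a2 : s2.reg (rg Q 1) = ε.n := reg_set_self _ _ _
  have a3 : s4.reg (rg Q 2) = 2 * ε.n := by
    rw [hs4, reg_set_ne _ _ (by omega) (by omega) (by omega)]; exact reg_set_self _ _ _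
  have a4 : s4.reg (rg Q tmp) = 4 := reg_set_self _ _ _
  have other : ∀ j < tmp, j ≠ 1 → j ≠ 2 → s5.reg (rg Q j) = 0 := by
    intro j hj h1 h2
    rw [hs5, reg_set_ne _ _ (by omega) (by omega) (by omega), hs4,
      reg_set_ne _ _ (by omega) (by omega) (by omega), hs3,
      reg_set_ne _ _ (by omega) (by omega) (by omega), hs2,
      reg_set_ne _ _ (by omega) (by omega) (by omega), hs1,
      reg_set_ne _ _ (by omega) (by omega) (by omega)]
    rfl
  refine ⟨s5, .seq (t := 1) (s' := s1) (.const (hfit 0 le_rfl (by omega))) (.seq (t := 1) (s' := s2)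
    (.read a1 hn (hfit _ (by omega) (by omega))) (.seq (t := 1) (s' := s3) (.arith_of_eq ?_
      (hfit _ (by omega) (by omega))) (.seq (t := 1) (s' := s4) (.const (hfit 4 (by omega) (by omega)))
        (.arith_of_eq ?_ hlast)))), ?_⟩
  · change s2.reg (rg Q 1) + s2.reg (rg Q 1) = _
    rw [a2]; ring
  · change s4.reg (rg Q 2) + s4.reg (rg Q tmp) = _
    rw [a3, a4]
  · refine ⟨other 0 (by omega) (by omega) (by omega), ?_, reg_set_self _ _ _, fun x => ?_, rfl⟩
    · rw [hs5, reg_set_ne _ _ (by omega) (by omega) (by omega), hs4,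
        reg_set_ne _ _ (by omega) (by omega) (by omega), hs3,
        reg_set_ne _ _ (by omega) (by omega) (by omega)]
      exact reg_set_self _ _ _
    · have := x.idx_lt
      exact other _ (by omega) (by omega) (by omega)

/-- A loop whose iterations decrease a measure. -/
theorem while_spec (ε : Env) {Q W : ℕ} (hW : 2 ≤ W) (d : Cmd true) (hh : tmp + d.height ≤ Q)
    (hw : d.width ≤ W) {I : ℕ → Store × List ℤ → Prop}
    (hI : ∀ m p, ε.Bounded p.1 → I m p → 0 < p.1 .flag → ∃ m' < m, I m' (d.run ε.A ε.n p)) (m : ℕ) :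
    ∀ (s : State (Q + 1)) (p : Store × List ℤ), Rep ε Q s p.1 p.2 → ε.Bounded p.1 → I m p →
      ∃ t s' p', Exec ε.A (W * ε.b) (.whileLt (rg Q 0) (Var.flag.reg Q) (d.compile Q)) s t s' ∧
        t ≤ (d.time * (ε.n + 1) + 1) * m + 1 ∧ s'.out = p'.2 ∧ ¬ 0 < p'.1 .flag ∧ ∃ m', I m' p' := by
  induction m using Nat.strong_induction_on with
  | _ m ih =>
    intro s p hs hp hm
    by_cases hf : 0 < p.1 .flag
    · obtain ⟨m', hlt, hm'⟩ := hI m p hp hm hf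
      obtain ⟨t, s', e1, e2, e3, -⟩ := d.compile_spec ε hW s p hs hp hh hw
      obtain ⟨t', s'', p', g1, g2, g3⟩ := ih m' hlt s' _ e3 (d.run_bounded ε p hp) hm'
      refine ⟨_, _, p', .whileTrue (by rw [hs.zero, hs.var]; exact hf) e1 g1, ?_, g3⟩
      rw [if_pos rfl] at e2
      have := Nat.mul_le_mul_left (d.time * (ε.n + 1) + 1) (Nat.succ_le_of_lt hlt)
      rw [Nat.succ_eq_add_one, mul_add] at this
      omega
    · exact ⟨1, s, p, .whileFalse (by rw [hs.zero, hs.var]; exact hf), by omega, hs.out, hf, m, hm⟩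

/-- The measure `m` bounds the number of passes through the outer loop, each taking time linear in
`n`. -/
theorem mainProg_spec (ε : Env) {Q W : ℕ} (hW : 2 ≤ W) (c d : Cmd true)
    (hc : tmp + c.height ≤ Q) (hd : tmp + d.height ≤ Q) (hcW : c.width ≤ W) (hdW : d.width ≤ W)
    (hn : ε.A[0]? = some (ε.n : ℤ)) {I : ℕ → Store × List ℤ → Prop} {m : ℕ}
    (h0 : I m (c.run ε.A ε.n (fun _ => 0, [])))
    (hI : ∀ m p, ε.Bounded p.1 → I m p → 0 < p.1 .flag → ∃ m' < m, I m' (d.run ε.A ε.n p)) :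
    ∃ t s' p', Exec ε.A (W * ε.b) (mainProg Q c d) (State.init (Q + 1)) t s' ∧
      t ≤ (c.time + d.time + 6) * ((ε.n + 1) * (m + 1)) ∧ s'.out = p'.2 ∧ ¬ 0 < p'.1 .flag ∧
      ∃ m', I m' p' := by
  obtain ⟨s1, e1, e2⟩ := prologue_spec ε hW (by omega : tmp ≤ Q) hn
  have hb0 : ε.Bounded fun _ => 0 := fun x => ⟨le_rfl, (by omega : (0 : ℤ) < 2 * ε.n + 4)⟩
  obtain ⟨t, s2, f1, f2, f3, -⟩ := c.compile_spec ε hW s1 (fun _ => 0, []) e2 hb0 hc hcW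
  obtain ⟨t', s3, p', g1, g2, g3⟩ := while_spec ε hW d hd hdW hI m s2 _ f3 (c.run_bounded ε _ hb0) h0
  refine ⟨_, s3, p', .seq e1 (.seq f1 g1), ?_, g3⟩
  rw [if_pos rfl] at f2
  have h1 : c.time * (ε.n + 1) ≤ c.time * ((ε.n + 1) * (m + 1)) :=
    Nat.mul_le_mul_left _ (Nat.le_mul_of_pos_right _ (by omega))
  have h2 : (d.time * (ε.n + 1) + 1) * m + 1 ≤ (d.time + 1) * ((ε.n + 1) * (m + 1)) := by nlinarith
  have h3 : 1 ≤ (ε.n + 1) * (m + 1) := Nat.one_le_iff_ne_zero.2 (by positivity)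
  calc 5 + (t + t') ≤ 5 * ((ε.n + 1) * (m + 1)) + (c.time * ((ε.n + 1) * (m + 1)) +
        (d.time + 1) * ((ε.n + 1) * (m + 1))) := by omega
    _ = _ := by ring

/-! ### Tests -/

section tests

variable {A : List ℤ} {n : ℕ} {σ : Store}

open Classical in
/-- The expression is the truth value of `p`. -/
def Tst (A : List ℤ) (σ : Store) (e : Ex) (p : Prop) : Prop :=
  e.eval A σ = if p then 1 else 0

/-- Comparison of two expressions. -/
def Ex.lt (a b : Ex) : Ex := .ite a b (.lit 1) (.lit 0)

theorem tst_lt {a b : Ex} {p : Prop} (h : a.eval A σ < b.eval A σ ↔ p) : Tst A σ (a.lt b) p := by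
  by_cases hp : p
  · simp [Tst, Ex.lt, Ex.eval, h, hp]
  · simp [Tst, Ex.lt, Ex.eval, h, hp]

/-- A product is a conjunction in which the second factor need only be correct if the first test
succeeds. This matters because distances are meaningful only for edges that meet the ray. -/
theorem Tst.mul {a b : Ex} {p q : Prop} (ha : Tst A σ a p) (hb : p → Tst A σ b q) :
    Tst A σ (.mul a b) (p ∧ q) := by
  by_cases hp : p
  · have := hb hp
    simp only [Tst, Ex.eval] at *
    rw [ha, this, if_pos hp, one_mul]
    by_cases hq : q <;> simp [hp, hq]
  · simp only [Tst, Ex.eval] at *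
    rw [ha, if_neg hp, zero_mul, if_neg (fun h => hp h.1)]

/-- Negation. -/
def Ex.not (a : Ex) : Ex := .sub (.lit 1) a

theorem Tst.not {a : Ex} {p : Prop} (ha : Tst A σ a p) : Tst A σ a.not (¬ p) := by
  simp only [Tst, Ex.not, Ex.eval] at *
  by_cases hp : p <;> simp [ha, hp]

/-- Disjunction. -/
def Ex.or (a b : Ex) : Ex := .ite (.lit 0) a (.lit 1) b

theorem Tst.or {a b : Ex} {p q : Prop} (ha : Tst A σ a p) (hb : ¬ p → Tst A σ b q) :
    Tst A σ (a.or b) (p ∨ q) := by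
  by_cases hp : p
  · simp only [Tst, Ex.or, Ex.eval] at *
    rw [ha]; simp [hp]
  · have := hb hp
    simp only [Tst, Ex.or, Ex.eval] at *
    rw [ha, this]
    by_cases hq : q <;> simp [hp, hq]

theorem Tst.congr {a : Ex} {p q : Prop} (ha : Tst A σ a p) (h : p ↔ q) : Tst A σ a q := by
  rwa [← propext h]

theorem tst_false : Tst A σ (.lit 0) False := by simp [Tst, Ex.eval]

/-- Run a command depending on a test. -/
def Cmd.cond {l : Bool} (a : Ex) (c d : Cmd l) : Cmd l := .ifc (.lit 0) a c d

theorem run_cond_pos {l : Bool} {a : Ex} {c d : Cmd l} {p : Prop} {s : Store × List ℤ}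
    (ha : Tst A s.1 a p) (hp : p) : (Cmd.cond a c d).run A n s = c.run A n s := by
  rw [Tst, if_pos hp] at ha
  simp [Cmd.cond, Cmd.run, Ex.eval, ha]

theorem run_cond_neg {l : Bool} {a : Ex} {c d : Cmd l} {p : Prop} {s : Store × List ℤ}
    (ha : Tst A s.1 a p) (hp : ¬ p) : (Cmd.cond a c d).run A n s = d.run A n s := by
  rw [Tst, if_neg hp] at ha
  simp [Cmd.cond, Cmd.run, Ex.eval, ha]

end tests

/-! ### Indices -/

section loops

variable {A : List ℤ} {n : ℕ} {σ : Store}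

/-- The value of the expression is the index `i`. -/
def Den (A : List ℤ) (σ : Store) (a : Ex) (i : Fin n) : Prop := a.eval A σ = (i : ℕ)

/-- The representation of an optional index; `n` means none. -/
def code : Option (Fin n) → ℤ
  | none => n
  | some i => (i : ℕ)

/-- The value of the expression represents an optional index. -/
def ODen (A : List ℤ) (σ : Store) (a : Ex) (o : Option (Fin n)) : Prop := a.eval A σ = code o

theorem code_nonneg (o : Option (Fin n)) : 0 ≤ code o := by cases o <;> simp [code]

theorem code_le (o : Option (Fin n)) : code o ≤ n := by
  cases o with
  | none => exact le_rfl
  | some i => have := i.2; simp only [code]; omega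

theorem clip_code (o : Option (Fin n)) : clip n (code o) = code o :=
  clip_of_mem (code_nonneg o) (by have := code_le o; omega)

/-- Two stores agree outside of the counter and `y`. -/
def SameBut (y : Var) (σ τ : Store) : Prop := ∀ x, x ≠ .j → x ≠ y → τ x = σ x

/-- The number of vertices. -/
def Ex.num : Ex := .rd (.lit 0)

theorem tst_lt_num (hn : (Ex.num).eval A σ = n) {a : Ex} {o : Option (Fin n)} (h : ODen A σ a o) :
    Tst A σ (a.lt .num) (o ≠ none) := by
  refine tst_lt ?_
  rw [hn, h]
  cases o with
  | none => simp [code]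
  | some i => simp [code]

/-- Count the indices that pass a test. -/
def Cmd.count (y : Var) (a : Ex) : Cmd true :=
  .seq (.asg y (.lit 0)) (.forN .j (.cond a (.asg y (.add (.var y) (.lit 1))) .skip))

-- The loop writes only to the counter and to `y`, so the test has to be correct only in stores that
-- agree with the initial one elsewhere. The count never exceeds `n`, so `clip` has no effect on it.
open Classical in
theorem run_count {y : Var} (hy : y ≠ .j) {a : Ex} {p : Fin n → Prop} {s : Store × List ℤ}
    (ha : ∀ τ, SameBut y s.1 τ → ∀ m : Fin n, τ .j = (m : ℕ) → Tst A τ a (p m)) :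
    ∃ τ, (Cmd.count y a).run A n s = (τ, s.2) ∧ SameBut y s.1 τ ∧
      τ y = ((Finset.univ.filter p).card : ℤ) := by
  have key : ∀ m ≤ n, ∃ τ, loop (fun m q => (Cmd.cond a (.asg y (.add (.var y) (.lit 1)))
      (.skip : Cmd false)).run A n (Function.update q.1 .j m, q.2)) m
        ((Cmd.asg (l := true) y (.lit 0)).run A n s) = (τ, s.2) ∧ SameBut y s.1 τ ∧
      τ y = ((Finset.univ.filter fun i : Fin n => p i ∧ (i : ℕ) < m).card : ℤ) := by
    intro m
    induction m with
    | zero =>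
      intro _
      refine ⟨_, rfl, fun x _ h2 => Function.update_of_ne h2 _ _, ?_⟩
      simp only [Function.update_self, Ex.eval, Nat.not_lt_zero, and_false, Finset.filter_false,
        Finset.card_empty]
      exact clip_of_mem le_rfl (by omega)
    | succ m ih =>
      intro hm
      obtain ⟨τ, h1, h2, h3⟩ := ih (by omega)
      have hsame : SameBut y s.1 (Function.update τ .j m) := fun x hx hxy => by
        rw [Function.update_of_ne hx]; exact h2 x hx hxy
      have hj : (Function.update τ .j (m : ℤ)) .j = ((⟨m, hm⟩ : Fin n) : ℕ) :=
        Function.update_self _ _ _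
      have ht := ha _ hsame _ hj
      rw [loop, h1]
      by_cases hp : p ⟨m, hm⟩
      · rw [run_cond_pos ht hp]
        refine ⟨_, rfl, fun x hx hxy => ?_, ?_⟩
        · rw [Function.update_of_ne hxy]; exact hsame x hx hxy
        · have hcard : (Finset.univ.filter fun i : Fin n => p i ∧ (i : ℕ) < m + 1) =
              insert ⟨m, hm⟩ (Finset.univ.filter fun i : Fin n => p i ∧ (i : ℕ) < m) := by
            ext i
            simp only [Finset.mem_filter, Finset.mem_univ, true_and, Finset.mem_insert]
            constructor
            · rintro ⟨h4, h5⟩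
              rcases Nat.lt_succ_iff_lt_or_eq.1 h5 with h6 | h6
              · exact Or.inr ⟨h4, h6⟩
              · exact Or.inl (Fin.ext h6)
            · rintro (rfl | ⟨h4, h5⟩)
              · exact ⟨hp, Nat.lt_succ_self _⟩
              · exact ⟨h4, h5.trans (Nat.lt_succ_self _)⟩
          have hle : (Finset.univ.filter fun i : Fin n => p i ∧ (i : ℕ) < m).card ≤ n := by
            simpa using Finset.card_le_univ (Finset.univ.filter fun i : Fin n => p i ∧ (i : ℕ) < m)
          rw [Function.update_self, hcard, Finset.card_insert_of_notMem (by simp)]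
          simp only [Ex.eval]
          rw [Function.update_of_ne hy, h3, clip_of_mem (by omega) (by omega)]
          push_cast
          rfl
      · rw [run_cond_neg ht hp]
        refine ⟨_, rfl, hsame, ?_⟩
        have hcard : (Finset.univ.filter fun i : Fin n => p i ∧ (i : ℕ) < m + 1) =
            (Finset.univ.filter fun i : Fin n => p i ∧ (i : ℕ) < m) := by
          ext i
          simp only [Finset.mem_filter, Finset.mem_univ, true_and]
          refine and_congr_right fun h4 => ?_
          have : (i : ℕ) ≠ m := fun h5 => hp (by rwa [← show i = ⟨m, hm⟩ from Fin.ext h5])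
          omega
        rw [hcard]
        change Function.update τ .j (m : ℤ) y = _
        rw [Function.update_of_ne hy, h3]
  obtain ⟨τ, h1, h2, h3⟩ := key n le_rfl
  refine ⟨τ, h1, h2, h3.trans ?_⟩
  congr 2
  ext i
  simp

/-- Find a best index that passes a test. -/
def Cmd.best (y : Var) (a b : Ex) : Cmd true :=
  .seq (.asg y .num)
    (.forN .j (.cond (.mul a (((Ex.var y).lt .num).not.or b)) (.asg y (.var .j)) .skip))

theorem run_best {y : Var} (hy : y ≠ .j) {a b : Ex} {p : Fin n → Prop} {lt : Fin n → Fin n → Prop}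
    {s : Store × List ℤ} (hn : ∀ τ, (Ex.num).eval A τ = n) (hirr : ∀ i, ¬ lt i i)
    (htr : ∀ i j k, p i → p j → p k → lt i j → lt j k → lt i k)
    (ha : ∀ τ, SameBut y s.1 τ → ∀ m : Fin n, τ .j = (m : ℕ) → Tst A τ a (p m))
    (hb : ∀ τ, SameBut y s.1 τ → ∀ m c : Fin n, τ .j = (m : ℕ) → τ y = (c : ℕ) → p m → p c →
      Tst A τ b (lt m c)) :
    ∃ τ o, (Cmd.best y a b).run A n s = (τ, s.2) ∧ SameBut y s.1 τ ∧ τ y = code o ∧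
      IsBest p lt o := by
  have key : ∀ m ≤ n, ∃ τ o, loop (fun m q => (Cmd.cond (.mul a (((Ex.var y).lt .num).not.or b))
      (.asg y (.var .j)) (.skip : Cmd false)).run A n (Function.update q.1 .j m, q.2)) m
        ((Cmd.asg (l := true) y .num).run A n s) = (τ, s.2) ∧ SameBut y s.1 τ ∧
      τ y = code o ∧ IsBest (fun i : Fin n => p i ∧ (i : ℕ) < m) lt o := by
    intro m
    induction m with
    | zero =>
      intro _
      refine ⟨_, none, rfl, fun x _ h2 => Function.update_of_ne h2 _ _, ?_, ?_, ?_⟩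
      · simp only [Function.update_self, hn]
        exact clip_code (none : Option (Fin n))
      · simp
      · simp
    | succ m ih =>
      intro hm
      obtain ⟨τ, o, h1, h2, h3, h4⟩ := ih (by omega)
      have hsame : SameBut y s.1 (Function.update τ .j m) := fun x hx hxy => by
        rw [Function.update_of_ne hx]; exact h2 x hx hxy
      have hj : (Function.update τ .j (m : ℤ)) .j = ((⟨m, hm⟩ : Fin n) : ℕ) :=
        Function.update_self _ _ _
      have hyv : Function.update τ .j (m : ℤ) y = code o := by rw [Function.update_of_ne hy, h3]
      -- A candidate is accepted if there is none so far or if it beats the current one. While `y`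
      -- is `n` the comparison `b` has no meaning, and `Ex.or` does not rely on it.
      have ht : Tst A (Function.update τ .j (m : ℤ)) (.mul a (((Ex.var y).lt .num).not.or b))
          (p ⟨m, hm⟩ ∧ (¬ o ≠ none ∨ ∃ c, o = some c ∧ lt ⟨m, hm⟩ c)) := by
        refine (ha _ hsame _ hj).mul fun hpm => (tst_lt_num (σ := Function.update τ .j (m : ℤ)) (a := .var y)
          (hn _) hyv).not.or fun ho => ?_
        obtain ⟨c, rfl⟩ := Option.ne_none_iff_exists'.1 (not_not.1 ho)
        refine (hb _ hsame ⟨m, hm⟩ c hj hyv hpm (h4.2 c rfl).1.1).congr ?_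
        simp
      rw [loop, h1]
      by_cases hp : p ⟨m, hm⟩ ∧ (¬ o ≠ none ∨ ∃ c, o = some c ∧ lt ⟨m, hm⟩ c)
      · rw [run_cond_pos ht hp]
        refine ⟨_, some ⟨m, hm⟩, rfl, fun x hx hxy => ?_, ?_, by simp, ?_⟩
        · rw [Function.update_of_ne hxy]; exact hsame x hx hxy
        · rw [Function.update_self]
          simp only [Ex.eval, Function.update_self]
          exact clip_code (some (⟨m, hm⟩ : Fin n))
        · rintro b ⟨⟩
          refine ⟨⟨hp.1, Nat.lt_succ_self _⟩, ?_⟩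
          rintro i ⟨hi, him⟩ hlt
          rcases Nat.lt_succ_iff_lt_or_eq.1 him with h6 | h6
          · rcases hp.2 with h7 | ⟨c, rfl, h7⟩
            · exact h4.1 (not_not.1 h7) i ⟨hi, h6⟩
            · have h8 := h4.2 c rfl
              exact h8.2 i ⟨hi, h6⟩ (htr _ _ _ hi hp.1 h8.1.1 hlt h7)
          · obtain rfl : i = ⟨m, hm⟩ := Fin.ext h6
            exact hirr _ hlt
      · rw [run_cond_neg ht hp]
        refine ⟨_, o, rfl, hsame, hyv, ?_, ?_⟩
        · rintro rfl i ⟨hi, him⟩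
          rcases Nat.lt_succ_iff_lt_or_eq.1 him with h6 | h6
          · exact h4.1 rfl i ⟨hi, h6⟩
          · obtain rfl : i = ⟨m, hm⟩ := Fin.ext h6
            exact hp ⟨hi, Or.inl (by simp)⟩
        · rintro c rfl
          have h8 := h4.2 c rfl
          refine ⟨⟨h8.1.1, h8.1.2.trans (Nat.lt_succ_self _)⟩, ?_⟩
          rintro i ⟨hi, him⟩ hlt
          rcases Nat.lt_succ_iff_lt_or_eq.1 him with h6 | h6
          · exact h8.2 i ⟨hi, h6⟩ hlt
          · obtain rfl : i = ⟨m, hm⟩ := Fin.ext h6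
            exact hp ⟨hi, Or.inr ⟨c, rfl, hlt⟩⟩
  obtain ⟨τ, o, h1, h2, h3, h4, h5⟩ := key n le_rfl
  refine ⟨τ, o, h1, h2, h3, fun ho i hi => h4 ho i ⟨hi, i.2⟩, fun c hc => ?_⟩
  have h6 := h5 c hc
  exact ⟨h6.1.1, fun i hi => h6.2 i ⟨hi, i.2⟩⟩

end loops

/-! ### Geometric expressions -/

/-- The coordinates of a vertex relative to the viewpoint. -/
def Ex.px (a : Ex) : Ex := .sub (.rd (.add (.lit 4) (.add a a))) (.rd (.lit 2))

/-- The coordinates of a vertex relative to the viewpoint. -/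
def Ex.py (a : Ex) : Ex := .sub (.rd (.add (.lit 5) (.add a a))) (.rd (.lit 3))

/-- The cross product of two vertices. -/
def Ex.cr (a b : Ex) : Ex := .sub (.mul a.px b.py) (.mul a.py b.px)

/-- The next vertex. -/
def Ex.nx (a : Ex) : Ex := .ite (.add a (.lit 1)) .num (.add a (.lit 1)) (.lit 0)

/-- The previous vertex. -/
def Ex.pv (a : Ex) : Ex := .ite a (.lit 1) (.sub .num (.lit 1)) (.sub a (.lit 1))

/-- The signed area spanned by an edge. -/
def Ex.area (a : Ex) : Ex := .cr a a.nx

/-- Positivity. -/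
def Ex.pos (a : Ex) : Ex := .lt (.lit 0) a

/-- Does edge `a` properly cross the ray through vertex `b`? -/
def Ex.proper (a b : Ex) : Ex :=
  .mul (Ex.pos (.mul (.cr a b) a.area)) (Ex.pos (.mul (.cr b a.nx) a.area))

/-- The slope of edge `a` at vertex `b`, times the area. -/
def Ex.gap (a b : Ex) : Ex := .add (.cr a b) (.cr b a.nx)

/-- The numerator of the distance of an edge. -/
def Ex.dnum (b a : Ex) : Ex := .ite a .num (.mul a.area (a.gap b)) (.lit 0)

/-- The denominator of the distance of an edge. -/
def Ex.dden (b a : Ex) : Ex := .ite a .num (.mul (a.gap b) (a.gap b)) (.lit 1)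

/-- Comparison of the distances of two edges on the ray through vertex `b`. -/
def Ex.dlt (b a c : Ex) : Ex := .lt (.mul (.dnum b a) (.dden b c)) (.mul (.dnum b c) (.dden b a))

/-- The half plane of a vertex. -/
def Ex.half (z a : Ex) : Ex :=
  .ite (.lit 0) (.cr z a) (.lit 1) (.ite (.cr z a) (.lit 0) (.lit 2) (.lit 0))

/-- Comparison of the directions of two vertices. -/
def Ex.angLt (z a b : Ex) : Ex :=
  .or (.lt (.half z a) (.half z b)) (.mul (Ex.not (.lt (.half z b) (.half z a))) (Ex.pos (.cr a b)))

/-- Is a vertex critical? -/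
def Ex.crit (a : Ex) : Ex := Ex.pos (.mul (.cr a a.nx) (.cr a a.pv))

/-- The last endpoint of an edge. -/
def Ex.lst (a : Ex) : Ex := .ite (.lit 0) a.area a.nx a

/-- The other edge at the last endpoint of an edge. -/
def Ex.succ (a : Ex) : Ex := .ite (.lit 0) a.area a.nx a.pv

/-- The orientation of the polygon at a vertex. -/
def Ex.turn (a : Ex) : Ex := .add (.add (.cr a a.nx) (.cr a.nx a.pv)) (.cr a.pv a)

/-- The incident edge that is met second. -/
def Ex.second (a : Ex) : Ex := .ite (.lit 0) (.mul a.turn (.cr a a.nx)) a a.pv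

/-- The vertices relative to the viewpoint. -/
noncomputable abbrev pts {n : ℕ} (V : Fin n → ℤ × ℤ) (q : ℤ × ℤ) : Fin n → ℂ :=
  rel (polygon V) (toPlane q)

/-- The input array stores the polygon. -/
structure Reads (A : List ℤ) {n : ℕ} (V : Fin n → ℤ × ℤ) (q : ℤ × ℤ) (k : ℕ) : Prop where
  num : readAt A 0 = n
  rank : readAt A 1 = k
  qx : readAt A 2 = q.1
  qy : readAt A 3 = q.2
  vx : ∀ i : Fin n, readAt A (4 + ((i : ℕ) + (i : ℕ))) = (V i).1
  vy : ∀ i : Fin n, readAt A (5 + ((i : ℕ) + (i : ℕ))) = (V i).2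

theorem val_nx {n : ℕ} (i : Fin n) : (nx i : ℕ) = if (i : ℕ) + 1 < n then (i : ℕ) + 1 else 0 := by
  obtain ⟨m, rfl⟩ : ∃ m, n = m + 1 := ⟨n - 1, by have := i.2; omega⟩
  have hi := i.2
  split_ifs with h
  · exact coe_finRotate_of_ne_last (fun h0 => by rw [h0, Fin.val_last] at h; omega)
  · have : i = Fin.last m := Fin.ext (by rw [Fin.val_last]; omega)
    rw [nx, this, finRotate_last]
    rfl

theorem val_pv {n : ℕ} (i : Fin n) : (pv i : ℕ) = if (i : ℕ) < 1 then n - 1 else (i : ℕ) - 1 := by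
  have h := val_nx (pv i)
  rw [nx_pv] at h
  have h1 := (pv i).2
  split_ifs at h ⊢ <;> omega

section eval

variable {A : List ℤ} {n : ℕ} {V : Fin n → ℤ × ℤ} {q : ℤ × ℤ} {k : ℕ} {σ : Store}
  {a b c z : Ex} {i j w : Fin n} {o o' : Option (Fin n)}

/-- The real number denoted by an expression. -/
def RDen (A : List ℤ) (σ : Store) (a : Ex) (x : ℝ) : Prop := (a.eval A σ : ℝ) = x

theorem RDen.add {x y : ℝ} (ha : RDen A σ a x) (hb : RDen A σ b y) : RDen A σ (.add a b) (x + y) := by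
  simp only [RDen, Ex.eval] at *; push_cast; rw [ha, hb]

theorem RDen.mul {x y : ℝ} (ha : RDen A σ a x) (hb : RDen A σ b y) : RDen A σ (.mul a b) (x * y) := by
  simp only [RDen, Ex.eval] at *; push_cast; rw [ha, hb]

theorem RDen.eval_pos {x : ℝ} (ha : RDen A σ a x) : 0 < a.eval A σ ↔ 0 < x := by
  rw [← ha, Int.cast_pos]

theorem RDen.eval_neg {x : ℝ} (ha : RDen A σ a x) : a.eval A σ < 0 ↔ x < 0 := by
  rw [← ha, Int.cast_lt_zero]

theorem RDen.lt {x y : ℝ} (ha : RDen A σ a x) (hb : RDen A σ b y) : Tst A σ (a.lt b) (x < y) :=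
  tst_lt (by rw [← ha, ← hb, Int.cast_lt])

theorem RDen.pos {x : ℝ} (ha : RDen A σ a x) : Tst A σ a.pos (0 < x) :=
  tst_lt (by simpa [Ex.eval] using ha.eval_pos)

variable (hA : Reads A V q k)
include hA

theorem Reads.eval_num (τ : Store) : (Ex.num).eval A τ = n := hA.num

theorem Reads.cr (ha : Den A σ a i) (hb : Den A σ b j) : RDen A σ (.cr a b) (X (pts V q) i j) := by
  simp only [Den] at ha hb
  simp only [RDen, Ex.cr, Ex.px, Ex.py, Ex.eval, ha, hb, hA.vx, hA.vy, hA.qx, hA.qy]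
  simp [X, pts, rel, cross, polygon, toPlane]

theorem Reads.nx (ha : Den A σ a i) : Den A σ a.nx (nx i) := by
  simp only [Den] at *
  rw [Ex.nx, Ex.eval, hA.eval_num, val_nx]
  simp only [Ex.eval, ha]
  split_ifs <;> first | rfl | omega

theorem Reads.pv (ha : Den A σ a i) : Den A σ a.pv (pv i) := by
  simp only [Den] at *
  have := i.2
  rw [Ex.pv, Ex.eval, val_pv]
  simp only [Ex.eval, ha]
  have h := hA.eval_num σ
  split_ifs <;> first | (rw [h]; omega) | omega

theorem Reads.area (ha : Den A σ a i) : RDen A σ a.area (area (pts V q) i) := hA.cr ha (hA.nx ha)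

theorem Reads.proper (ha : Den A σ a i) (hb : Den A σ b j) :
    Tst A σ (.proper a b) (Proper (pts V q) i j) :=
  (((hA.cr ha hb).mul (hA.area ha)).pos).mul fun _ => ((hA.cr hb (hA.nx ha)).mul (hA.area ha)).pos

theorem Reads.some_lt (ha : Den A σ a i) : a.eval A σ < Ex.num.eval A σ := by
  rw [hA.eval_num, ha]; have := i.2; omega

theorem Reads.none_lt (ha : ODen A σ a (none : Option (Fin n))) :
    ¬ a.eval A σ < Ex.num.eval A σ := by
  rw [hA.eval_num, ha]; exact lt_irrefl _

/-- The distance is `area / g`. Extending the fraction by `g` makes the denominator the square `g *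
g`, so distances can be compared by cross multiplication of integers without regard to signs. The
origin is `0 / 1`. -/
theorem Reads.odst (h : Star (pts V q)) (hb : Den A σ b j) (ha : ODen A σ a o)
    (ho : OnRay (pts V q) j o) :
    ∃ x y : ℝ, RDen A σ (.dnum b a) x ∧ RDen A σ (.dden b a) y ∧ 0 < y ∧
      odst (pts V q) j o = x / y := by
  cases o with
  | none =>
    refine ⟨0, 1, ?_, ?_, one_pos, by simp [KVis.odst]⟩
    · rw [RDen, Ex.dnum, Ex.eval, if_neg (hA.none_lt ha)]; simp [Ex.eval]
    · rw [RDen, Ex.dden, Ex.eval, if_neg (hA.none_lt ha)]; simp [Ex.eval]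
  | some i =>
    have ha' : Den A σ a i := ha
    have hg : RDen A σ (.gap a b) (X (pts V q) i j + X (pts V q) j (KVis.nx i)) :=
      (hA.cr ha' hb).add (hA.cr hb (hA.nx ha'))
    have h1 := (ho i rfl).slope_pos h (h.vertex_ne_zero j)
    have hs : slope (pts V q) i (pts V q j) =
      (X (pts V q) i j + X (pts V q) j (KVis.nx i)) / KVis.area (pts V q) i := rfl
    set g := X (pts V q) i j + X (pts V q) j (KVis.nx i)
    have hg0 : g ≠ 0 := by rintro h0; rw [hs, h0, zero_div] at h1; exact lt_irrefl _ h1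
    refine ⟨KVis.area (pts V q) i * g, g * g, ?_, ?_, mul_self_pos.2 hg0, ?_⟩
    · have := (hA.area ha').mul hg
      rw [RDen, Ex.dnum, Ex.eval, if_pos (hA.some_lt ha')]; exact this
    · have := hg.mul hg
      rw [RDen, Ex.dden, Ex.eval, if_pos (hA.some_lt ha')]; exact this
    · rw [KVis.odst, dst, hs, inv_div, mul_div_mul_right _ _ hg0]

theorem Reads.dlt (h : Star (pts V q)) (hb : Den A σ b j) (ha : ODen A σ a o) (hc : ODen A σ c o')
    (ho : OnRay (pts V q) j o) (ho' : OnRay (pts V q) j o') :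
    Tst A σ (.dlt b a c) (KVis.odst (pts V q) j o < KVis.odst (pts V q) j o') := by
  obtain ⟨x, y, h1, h2, h3, h4⟩ := hA.odst h hb ha ho
  obtain ⟨x', y', h1', h2', h3', h4'⟩ := hA.odst h hb hc ho'
  rw [h4, h4']
  exact ((h1.mul h2').lt (h1'.mul h2)).congr (div_lt_div_iff₀ h3 h3').symm

theorem Reads.half (hz : Den A σ z w) (ha : Den A σ a i) :
    (Ex.half z a).eval A σ = half (pts V q) w i := by
  have h1 := hA.cr hz ha
  have h2 := h1.eval_pos
  have h3 := h1.eval_neg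
  unfold KVis.half
  by_cases p : 0 < X (pts V q) w i
  · rw [if_pos p]
    exact if_pos (h2.2 p)
  · rw [if_neg p]
    refine (if_neg (mt h2.1 p)).trans ?_
    by_cases p' : X (pts V q) w i < 0
    · rw [if_pos p']
      exact if_pos (h3.2 p')
    · rw [if_neg p']
      exact if_neg (mt h3.1 p')

theorem Reads.angLt (hz : Den A σ z w) (ha : Den A σ a i) (hb : Den A σ b j) :
    Tst A σ (.angLt z a b) (Lt (pts V q) w i j) := by
  have h1 := hA.half hz ha
  have h2 := hA.half hz hb
  have t1 : Tst A σ (.lt (.half z a) (.half z b)) _ := tst_lt (p := KVis.half (pts V q) w i <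
    KVis.half (pts V q) w j) (by rw [h1, h2])
  have t2 : Tst A σ (.lt (.half z b) (.half z a)) _ := tst_lt (p := KVis.half (pts V q) w j <
    KVis.half (pts V q) w i) (by rw [h1, h2])
  refine (t1.or fun _ => t2.not.mul fun _ => (hA.cr ha hb).pos).congr ?_
  rw [Lt]
  constructor
  · rintro (h3 | ⟨h3, h4⟩)
    · exact Or.inl h3
    · rcases (not_lt.1 h3).lt_or_eq with h5 | h5
      · exact Or.inl h5
      · exact Or.inr ⟨h5, h4⟩
  · rintro (h3 | ⟨h3, h4⟩)
    · exact Or.inl h3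
    · exact Or.inr ⟨by rw [h3]; exact lt_irrefl _, h4⟩

theorem Reads.crit (ha : Den A σ a i) : Tst A σ a.crit (Crit (pts V q) i) :=
  ((hA.cr ha (hA.nx ha)).mul (hA.cr ha (hA.pv ha))).pos

omit hA in
theorem den_ite {x : ℝ} {p : Prop} [Decidable p] {d e : Ex} (hc : RDen A σ c x) (hp : p ↔ 0 < x)
    (hd : Den A σ d i) (he : Den A σ e j) : Den A σ (.ite (.lit 0) c d e) (if p then i else j) := by
  by_cases h : p
  · rw [if_pos h, Den, Ex.eval, if_pos (by simpa [Ex.eval] using hc.eval_pos.2 (hp.1 h))]; exact hd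
  · rw [if_neg h, Den, Ex.eval,
      if_neg (by simpa [Ex.eval] using (not_congr hc.eval_pos).2 (mt hp.2 h))]; exact he

theorem Reads.lst (ha : Den A σ a i) : Den A σ a.lst (lstV (pts V q) i) := by
  unfold lstV; exact den_ite (hA.area ha) Iff.rfl (hA.nx ha) ha

theorem Reads.succ (ha : Den A σ a i) : Den A σ a.succ (succE (pts V q) i) := by
  unfold succE; exact den_ite (hA.area ha) Iff.rfl (hA.nx ha) (hA.pv ha)

theorem Reads.second (ha : Den A σ a i) : Den A σ a.second (secondE (pts V q) i) := by
  unfold secondE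
  have ht : RDen A σ a.turn (turn (pts V q) i) := ((hA.cr ha (hA.nx ha)).add
    (hA.cr (hA.nx ha) (hA.pv ha))).add (hA.cr (hA.pv ha) ha)
  exact den_ite (ht.mul (hA.cr ha (hA.nx ha))) Iff.rfl ha (hA.pv ha)

end eval

theorem readAt_inputArray {n : ℕ} (V : Fin n → ℤ × ℤ) (q : ℤ × ℤ) (k : ℕ) :
    Reads (inputArray V q k) V q k ∧ (inputArray V q k).length = 2 * n + 4 := by
  have key : ∀ (l : List (ℤ × ℤ)) (m : ℕ) (hm : m < l.length),
      (l.flatMap fun a => [a.1, a.2])[m + m]? = some (l[m]).1 ∧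
      (l.flatMap fun a => [a.1, a.2])[m + m + 1]? = some (l[m]).2 := by
    intro l
    induction l with
    | nil => intro m hm; simp at hm
    | cons x l ih =>
      intro m hm
      rw [List.flatMap_cons]
      cases m with
      | zero => simp
      | succ m =>
        have h1 : m + 1 + (m + 1) = m + m + 1 + 1 := by ring
        rw [h1]
        simpa using ih m (by simpa using hm)
  have hlen : ∀ l : List (ℤ × ℤ), (l.flatMap fun a => [a.1, a.2]).length = 2 * l.length := by
    intro l
    induction l with
    | nil => rfl
    | cons x l ih => rw [List.flatMap_cons, List.length_append, ih]; simp; ring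
  refine ⟨⟨rfl, rfl, rfl, rfl, fun i => ?_, fun i => ?_⟩, ?_⟩
  · have := (key (List.ofFn V) i (by simp)).1
    have h1 : ((4 : ℤ) + ((i : ℕ) + (i : ℕ))).toNat = (i : ℕ) + (i : ℕ) + 1 + 1 + 1 + 1 := by omega
    rw [readAt, if_neg (by omega), h1, List.getD_eq_getElem?_getD]
    simp only [inputArray, List.cons_append, List.nil_append, List.getElem?_cons_succ]
    rw [this]; simp
  · have := (key (List.ofFn V) i (by simp)).2
    have h1 : ((5 : ℤ) + ((i : ℕ) + (i : ℕ))).toNat = (i : ℕ) + (i : ℕ) + 1 + 1 + 1 + 1 + 1 := by omega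
    rw [readAt, if_neg (by omega), h1, List.getD_eq_getElem?_getD]
    simp only [inputArray, List.cons_append, List.nil_append, List.getElem?_cons_succ]
    rw [this]; simp
  · simp only [inputArray, List.length_append, hlen, List.length_ofFn, List.length_cons,
      List.length_nil]
    ring

/-! ### The commands of the program -/

/-- Ranks of the current edge and of the current vertex, the neighbouring crossing edges, and the
next critical vertex. -/
def Cmd.scan : Cmd true :=
  .seq (.count .r (.mul (.proper (.var .j) (.var .i)) (.dlt (.var .i) (.var .j) (.var .e))))
  (.seq (.count .rv (.mul (.proper (.var .j) (.var .i)) (.dlt (.var .i) (.var .j) (.var .i))))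
  (.seq (.best .su (.mul (.proper (.var .j) (.var .i)) (.dlt (.var .i) (.var .e) (.var .j)))
    (.dlt (.var .i) (.var .j) (.var .su)))
  (.seq (.best .pr (.mul (.proper (.var .j) (.var .i)) (.dlt (.var .i) (.var .j) (.var .e)))
    (.dlt (.var .i) (.var .pr) (.var .j)))
  (.best .nxt (.mul (.crit (.var .j)) (.angLt (.var .z) (.var .i) (.var .j)))
    (.angLt (.var .z) (.var .j) (.var .nxt))))))

/-- Follow the boundary from the ray through the current vertex to the ray through the next. -/
def Cmd.walk : Cmd true :=
  .seq (.asg .wlk (.var .i)) (.forN .j (.cond (.mul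
    (.angLt (.var .z) (.var .wlk) (.lst (.var .e))) (.angLt (.var .z) (.lst (.var .e)) (.var .nxt)))
    (.seq (.asg .wlk (.lst (.var .e))) (.asg .e (.succ (.var .e)))) .skip))

/-- Proceed to the next critical vertex, or stop. -/
def Cmd.advance : Cmd true :=
  .cond (.lt (.var .nxt) .num) (.seq .walk (.asg .i (.var .nxt))) (.asg .flag (.lit 0))

/-- Write the endpoint of the window on edge `a`. -/
def Cmd.endpoint (a : Ex) : Cmd true :=
  .seq (.emit (.var .i)) (.seq (.emit a) (.emit (.lt (.cr (.var .i) (.nx (.var .i))) (.lit 0))))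

/-- Report the window, if there is one. -/
def Cmd.report : Cmd true :=
  .cond (.mul (Ex.not (.lt (.var .r) (.var .k))) (Ex.not (.lt (.var .k) (.var .rv))))
    (.seq (.endpoint (.var .e))
      (.endpoint (.ite (.var .rv) (.var .k) (.var .pr) (.second (.var .i))))) .skip

/-- One step of the sweep. -/
def Cmd.sweep : Cmd true :=
  .seq .scan (.cond (.mul (.lt (.var .e) .num) (.proper (.var .e) (.var .i)))
    (.cond (.mul (.lt (.var .r) (.var .k)) (.lt (.var .su) .num)) (.asg .e (.var .su))
      (.cond (.lt (.var .k) (.var .r)) (.asg .e (.var .pr)) (.seq .report .advance)))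
    (.cond (.lt (.var .su) .num) (.asg .e (.var .su)) (.asg .e (.var .pr))))

/-- Start at a critical vertex, if there is one. -/
def Cmd.start : Cmd true :=
  .seq (.best .z (.crit (.var .j)) (.lit 0))
  (.seq (.count .k (.lt (.add (.add (.var .j) (.var .j)) (.lit 1)) (.rd (.lit 1))))
  (.seq (.asg .k (.add (.var .k) (.var .k)))
  (.seq (.asg .i (.var .z)) (.seq (.asg .e .num)
  (.cond (.lt (.var .z) .num) (.asg .flag (.lit 1)) (.asg .flag (.lit 0)))))))

/-! ### Correctness of scanning, walking and reporting -/

section spec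

variable {A : List ℤ} {n : ℕ} {V : Fin n → ℤ × ℤ} {q : ℤ × ℤ} {k : ℕ}

theorem onRay_some {u : Fin n → ℂ} {i e : Fin n} (h : InCone u e (u i)) : OnRay u i (some e) :=
  fun f hf => by rwa [← Option.some.inj hf]

theorem onRay_none {u : Fin n → ℂ} {i : Fin n} : OnRay u i none := fun f hf => by simp at hf

open Classical in
theorem rk_eq_card {u : Fin n → ℂ} {i : Fin n} {τ : ℝ} : rk u i τ =
    (Finset.univ.filter fun f => Proper u f i ∧ dst u i f < τ).card := by
  rw [rk, crossing, Finset.filter_filter]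

/-- The sweep position in a store: the vertex, the edge, the base vertex. -/
structure Pos (σ : Store) (i : Fin n) (o : Option (Fin n)) (z : Fin n) : Prop where
  i : σ .i = (i : ℕ)
  e : σ .e = code o
  z : σ .z = (z : ℕ)

theorem Pos.of_sameBut {σ τ : Store} {i z : Fin n} {o : Option (Fin n)} (h : Pos σ i o z) {y : Var}
    (hs : SameBut y σ τ) (hy : y ≠ .i ∧ y ≠ .e ∧ y ≠ .z) : Pos τ i o z :=
  ⟨(hs _ (by decide) hy.1.symm).trans h.i, (hs _ (by decide) hy.2.1.symm).trans h.e,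
    (hs _ (by decide) hy.2.2.symm).trans h.z⟩

/-- The result of a scan. -/
structure Scanned (u : Fin n → ℂ) (i : Fin n) (o : Option (Fin n)) (z : Fin n) (σ : Store)
    (su pr nxt : Option (Fin n)) : Prop where
  r : σ .r = rk u i (odst u i o)
  rv : σ .rv = rk u i 1
  su_eq : σ .su = code su
  isSucc : IsSucc u i (odst u i o) su
  pr_eq : σ .pr = code pr
  isPred : IsPred u i (odst u i o) pr
  nxt_eq : σ .nxt = code nxt
  isBest : IsBest (fun j => Crit u j ∧ Lt u z i j) (Lt u z) nxt

/-- The five passes write to different variables, none of which describes the position of the sweep,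
so the earlier results persist. -/
theorem scan_spec (hA : Reads A V q k) (h : Star (pts V q)) {s : Store × List ℤ} {i z : Fin n}
    {o : Option (Fin n)} (hp : Pos s.1 i o z) (ho : OnRay (pts V q) i o) :
    ∃ τ su pr nxt, (Cmd.scan).run A n s = (τ, s.2) ∧ Pos τ i o z ∧ τ .k = s.1 .k ∧
      τ .flag = s.1 .flag ∧ Scanned (pts V q) i o z τ su pr nxt := by
  classical
  have hprop : ∀ {τ : Store}, Pos τ i o z → ∀ m : Fin n, τ .j = (m : ℕ) →
      Tst A τ (.proper (.var .j) (.var .i)) (Proper (pts V q) m i) := fun hτ m hm =>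
    hA.proper (show Den A _ (.var .j) m from hm) (show Den A _ (.var .i) i from hτ.i)
  have hdlt : ∀ {τ : Store}, Pos τ i o z → ∀ {a b : Ex} {x y : Option (Fin n)}, ODen A τ a x →
      ODen A τ b y → OnRay (pts V q) i x → OnRay (pts V q) i y →
      Tst A τ (.dlt (.var .i) a b) (odst (pts V q) i x < odst (pts V q) i y) :=
    fun hτ _ _ _ _ ha hb hx hy => hA.dlt h (show Den A _ (.var .i) i from hτ.i) ha hb hx hy
  have hjr : ∀ {τ : Store} {m : Fin n}, τ .j = (m : ℕ) → ODen A τ (.var .j) (some m) := fun h => h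
  have her : ∀ {τ : Store}, Pos τ i o z → ODen A τ (.var .e) o := fun h => h.e
  obtain ⟨τ1, a1, b1, c1⟩ := run_count (A := A) (n := n) (y := .r) (by decide) (s := s)
    (a := .mul (.proper (.var .j) (.var .i)) (.dlt (.var .i) (.var .j) (.var .e)))
    (p := fun m => Proper (pts V q) m i ∧ dst (pts V q) i m < odst (pts V q) i o) (by
      intro τ hτ m hm
      have hτ' := hp.of_sameBut hτ (by decide)
      exact (hprop hτ' m hm).mul fun hpr =>
        hdlt hτ' (hjr hm) (her hτ') (onRay_some hpr.inCone) ho)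
  have p1 := hp.of_sameBut b1 (by decide)
  obtain ⟨τ2, a2, b2, c2⟩ := run_count (A := A) (n := n) (y := .rv) (by decide) (s := (τ1, s.2))
    (a := .mul (.proper (.var .j) (.var .i)) (.dlt (.var .i) (.var .j) (.var .i)))
    (p := fun m => Proper (pts V q) m i ∧ dst (pts V q) i m < 1) (by
      intro τ hτ m hm
      have hτ' := p1.of_sameBut hτ (by decide)
      refine (hprop hτ' m hm).mul fun hpr => ?_
      -- Edge `i` starts at vertex `i` and serves as an edge at distance `1`.
      rw [← dst_left h i]
      exact hdlt hτ' (hjr hm) (show ODen A _ (.var .i) (some i) from hτ'.i)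
        (onRay_some hpr.inCone) (onRay_some (inCone_left i)))
  have p2 := p1.of_sameBut b2 (by decide)
  obtain ⟨τ3, su, a3, b3, c3, d3⟩ := run_best (A := A) (n := n) (y := .su) (by decide)
    (s := (τ2, s.2)) (hA.eval_num)
    (a := .mul (.proper (.var .j) (.var .i)) (.dlt (.var .i) (.var .e) (.var .j)))
    (b := .dlt (.var .i) (.var .j) (.var .su))
    (p := fun m => Proper (pts V q) m i ∧ odst (pts V q) i o < dst (pts V q) i m)
    (lt := fun f g => dst (pts V q) i f < dst (pts V q) i g) (fun _ => lt_irrefl _)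
    (fun _ _ _ _ _ _ h1 h2 => h1.trans h2) (by
      intro τ hτ m hm
      have hτ' := p2.of_sameBut hτ (by decide)
      exact (hprop hτ' m hm).mul fun hpr =>
        hdlt hτ' (her hτ') (hjr hm) ho (onRay_some hpr.inCone)) (by
      intro τ hτ m c hm hc hpm hpc
      have hτ' := p2.of_sameBut hτ (by decide)
      exact hdlt hτ' (hjr hm) (show ODen A _ (.var .su) (some c) from hc)
        (onRay_some hpm.1.inCone) (onRay_some hpc.1.inCone))
  have p3 := p2.of_sameBut b3 (by decide)
  obtain ⟨τ4, pr, a4, b4, c4, d4⟩ := run_best (A := A) (n := n) (y := .pr) (by decide)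
    (s := (τ3, s.2)) (hA.eval_num)
    (a := .mul (.proper (.var .j) (.var .i)) (.dlt (.var .i) (.var .j) (.var .e)))
    (b := .dlt (.var .i) (.var .pr) (.var .j))
    (p := fun m => Proper (pts V q) m i ∧ dst (pts V q) i m < odst (pts V q) i o)
    (lt := fun f g => dst (pts V q) i g < dst (pts V q) i f) (fun _ => lt_irrefl _)
    (fun _ _ _ _ _ _ h1 h2 => h2.trans h1) (by
      intro τ hτ m hm
      have hτ' := p3.of_sameBut hτ (by decide)
      exact (hprop hτ' m hm).mul fun hpr =>
        hdlt hτ' (hjr hm) (her hτ') (onRay_some hpr.inCone) ho) (by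
      intro τ hτ m c hm hc hpm hpc
      have hτ' := p3.of_sameBut hτ (by decide)
      exact hdlt hτ' (show ODen A _ (.var .pr) (some c) from hc) (hjr hm)
        (onRay_some hpc.1.inCone) (onRay_some hpm.1.inCone))
  have p4 := p3.of_sameBut b4 (by decide)
  obtain ⟨τ5, nxt, a5, b5, c5, d5⟩ := run_best (A := A) (n := n) (y := .nxt) (by decide)
    (s := (τ4, s.2)) (hA.eval_num)
    (a := .mul (.crit (.var .j)) (.angLt (.var .z) (.var .i) (.var .j)))
    (b := .angLt (.var .z) (.var .j) (.var .nxt))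
    (p := fun m => Crit (pts V q) m ∧ Lt (pts V q) z i m)
    (lt := Lt (pts V q) z) (fun _ => Lt.irrefl)
    (fun _ _ _ _ _ _ h1 h2 => h1.trans h h2) (by
      intro τ hτ m hm
      have hτ' := p4.of_sameBut hτ (by decide)
      have hj : Den A τ (.var .j) m := hm
      exact (hA.crit hj).mul fun _ => hA.angLt (show Den A _ (.var .z) z from hτ'.z)
        (show Den A _ (.var .i) i from hτ'.i) hj) (by
      intro τ hτ m c hm hc _ _
      have hτ' := p4.of_sameBut hτ (by decide)
      exact hA.angLt (show Den A _ (.var .z) z from hτ'.z) (show Den A _ (.var .j) m from hm)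
        (show Den A _ (.var .nxt) c from hc))
  have p5 := p4.of_sameBut b5 (by decide)
  dsimp only at a2 a3 a4 a5 b2 b3 b4 b5
  refine ⟨τ5, su, pr, nxt, ?_, p5, ?_, ?_, ?_, ?_, ?_, d3, ?_, d4, c5, d5⟩
  · simp only [Cmd.scan, Cmd.run] at a1 a2 a3 a4 a5 ⊢
    rw [a1, a2, a3, a4, a5]
  · rw [b5 _ (by decide) (by decide), b4 _ (by decide) (by decide), b3 _ (by decide) (by decide),
      b2 _ (by decide) (by decide), b1 _ (by decide) (by decide)]
  · rw [b5 _ (by decide) (by decide), b4 _ (by decide) (by decide), b3 _ (by decide) (by decide),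
      b2 _ (by decide) (by decide), b1 _ (by decide) (by decide)]
  · rw [b5 _ (by decide) (by decide), b4 _ (by decide) (by decide), b3 _ (by decide) (by decide),
      b2 _ (by decide) (by decide), c1, rk_eq_card]
    congr!
  · rw [b5 _ (by decide) (by decide), b4 _ (by decide) (by decide), b3 _ (by decide) (by decide),
      c2, rk_eq_card]
    congr!
  · rw [b5 _ (by decide) (by decide), b4 _ (by decide) (by decide), c3]
  · rw [b5 _ (by decide) (by decide), c4]

theorem walk_spec (hA : Reads A V q k) {s : Store × List ℤ} {i e z t : Fin n}
    (hp : Pos s.1 i (some e) z) (ht : s.1 .nxt = (t : ℕ)) :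
    ∃ τ, (Cmd.walk).run A n s = (τ, s.2) ∧ (∀ x, x ≠ .j → x ≠ .wlk → x ≠ .e → τ x = s.1 x) ∧
      τ .e = code (some ((walkStep (pts V q) z t)^[n] (i, e)).2) := by
  have key : ∀ m, ∃ τ, loop (fun m q => (Cmd.cond (.mul
      (.angLt (.var .z) (.var .wlk) (.lst (.var .e))) (.angLt (.var .z) (.lst (.var .e)) (.var .nxt)))
      (.seq (.asg .wlk (.lst (.var .e))) (.asg .e (.succ (.var .e)))) (.skip : Cmd false)).run A n
        (Function.update q.1 .j m, q.2)) m ((Cmd.asg (l := true) .wlk (.var .i)).run A n s) =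
        (τ, s.2) ∧ (∀ x, x ≠ .j → x ≠ .wlk → x ≠ .e → τ x = s.1 x) ∧
      τ .wlk = (((walkStep (pts V q) z t)^[m] (i, e)).1 : ℕ) ∧
      τ .e = (((walkStep (pts V q) z t)^[m] (i, e)).2 : ℕ) := by
    intro m
    induction m with
    | zero =>
      refine ⟨_, rfl, fun x _ h2 _ => Function.update_of_ne h2 _ _, ?_, ?_⟩
      · simp only [Function.update_self, Ex.eval, hp.i]
        exact clip_code (some i)
      · rw [Function.update_of_ne (by decide), hp.e]; rfl
    | succ m ih =>
      obtain ⟨τ, h1, h2, h3, h4⟩ := ih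
      rw [loop, h1, Function.iterate_succ_apply']
      generalize (walkStep (pts V q) z t)^[m] (i, e) = w at h3 h4 ⊢
      set τ' := Function.update τ .j (m : ℤ) with hτ'
      have hu : ∀ x, x ≠ .j → τ' x = τ x := fun x hx => Function.update_of_ne hx _ _
      have hz : Den A τ' (.var .z) z := (hu _ (by decide)).trans
        ((h2 _ (by decide) (by decide) (by decide)).trans hp.z)
      have hn : Den A τ' (.var .nxt) t := (hu _ (by decide)).trans
        ((h2 _ (by decide) (by decide) (by decide)).trans ht)
      have hw : Den A τ' (.var .wlk) w.1 := (hu _ (by decide)).trans h3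
      have he : Den A τ' (.var .e) w.2 := (hu _ (by decide)).trans h4
      have hl := hA.lst he
      have htst := (hA.angLt hz hw hl).mul fun _ => hA.angLt hz hl hn
      by_cases hc : Lt (pts V q) z w.1 (lstV (pts V q) w.2) ∧ Lt (pts V q) z (lstV (pts V q) w.2) t
      · rw [run_cond_pos (s := (τ', s.2)) htst hc, walkStep, if_pos hc]
        refine ⟨_, rfl, fun x h5 h6 h7 => ?_, ?_, ?_⟩
        · simp only [Cmd.run]
          rw [Function.update_of_ne h7, Function.update_of_ne h6, hu x h5]
          exact h2 x h5 h6 h7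
        · simp only [Cmd.run]
          rw [Function.update_of_ne (by decide), Function.update_self, hl]
          exact clip_code (some _)
        · simp only [Cmd.run]
          rw [Function.update_self]
          have he' : Den A (Function.update τ' .wlk (clip n ((Ex.lst (.var .e)).eval A τ')))
              (.var .e) w.2 := by
            change Function.update τ' .wlk _ .e = _
            rw [Function.update_of_ne (by decide)]; exact he
          rw [hA.succ he']
          exact clip_code (some _)
      · rw [run_cond_neg (s := (τ', s.2)) htst hc, walkStep, if_neg hc]
        exact ⟨_, rfl, fun x h5 h6 h7 => (hu x h5).trans (h2 x h5 h6 h7), hw, he⟩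
  obtain ⟨τ, h1, h2, -, h4⟩ := key n
  exact ⟨τ, h1, h2, h4⟩

theorem Win.right_unique {u : Fin n → ℂ} (h : Star u) {K : ℕ} {i a b a' b' : Fin n}
    (hw : Win u K i a b) (hw' : Win u K i a' b') : a = a' ∧ b = b' := by
  obtain ⟨-, -, ⟨h1, h2⟩, h3⟩ := hw
  obtain ⟨-, -, ⟨h1', h2'⟩, h3'⟩ := hw'
  refine ⟨?_, rk_injective h h1 h1' (h2.trans h2'.symm)⟩
  rcases h3 with ⟨h4, h5⟩ | ⟨h4, h5, h6⟩ <;> rcases h3' with ⟨h4', h5'⟩ | ⟨h4', h5', h6'⟩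
  · rw [h5, h5']
  · omega
  · omega
  · exact rk_injective h h5 h5' (by omega)

open Classical in
/-- The triples reported for the window on the ray through vertex `i`. -/
noncomputable def triples (u : Fin n → ℂ) (i a b : Fin n) : List (Fin n × Fin n × WindowType) :=
  [(i, b, if X u i (nx i) < 0 then .ccw else .cw), (i, a, if X u i (nx i) < 0 then .ccw else .cw)]

/-- The list of triples reported for vertex `i`. -/
def Reports (u : Fin n → ℂ) (K : ℕ) (i : Fin n) (l : List (Fin n × Fin n × WindowType)) : Prop :=
  (l = [] ∧ ∀ a b, ¬ Win u K i a b) ∨ ∃ a b, Win u K i a b ∧ l = triples u i a b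

theorem endpoint_spec (hA : Reads A V q k) {s : Store × List ℤ} {i a : Fin n} {x : Ex}
    (hi : s.1 .i = (i : ℕ)) (ha : Den A s.1 x a) :
    (Cmd.endpoint x).run A n s = (s.1, s.2 ++ reportWords (i, a, open Classical in
      if X (pts V q) i (nx i) < 0 then WindowType.ccw else .cw)) := by
  classical
  have hi' : Den A s.1 (.var .i) i := hi
  have h1 := hA.cr hi' (hA.nx hi')
  have h2 : Tst A s.1 (.lt (.cr (.var .i) (.nx (.var .i))) (.lit 0)) (X (pts V q) i (nx i) < 0) :=
    tst_lt (by simpa [Ex.eval] using h1.eval_neg)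
  simp only [Cmd.endpoint, Cmd.run, List.append_assoc]
  rw [h2, hi', ha]
  split_ifs <;> rfl

/-- At a settled edge the test decides whether the edge has rank `K` and the vertex is visible. The
settled edge is then the far end of the window, and the near end is the preceding crossing edge or
`secondE`. -/
theorem report_spec (hA : Reads A V q k) (h : Star (pts V q)) {s : Store × List ℤ}
    {i z e : Fin n} {su pr nxt : Option (Fin n)} {K : ℕ} (hp : Pos s.1 i (some e) z)
    (hs : Scanned (pts V q) i (some e) z s.1 su pr nxt) (hK : s.1 .k = K) (hc : Crit (pts V q) i)
    (hset : Settled (pts V q) K i e) :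
    ∃ l, (Cmd.report).run A n s = (s.1, s.2 ++ l.flatMap reportWords) ∧
      Reports (pts V q) K i l := by
  classical
  have hr := hs.r
  have hrv := hs.rv
  change s.1 .r = rk (pts V q) i (dst (pts V q) i e) at hr
  have t1 : Tst A s.1 (Ex.lt (.var .r) (.var .k)) (rk (pts V q) i (dst (pts V q) i e) < K) :=
    tst_lt (by simp only [Ex.eval]; rw [hr, hK, Nat.cast_lt])
  have t2 : Tst A s.1 (Ex.lt (.var .k) (.var .rv)) (K < rk (pts V q) i 1) :=
    tst_lt (by simp only [Ex.eval]; rw [hrv, hK, Nat.cast_lt])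
  have t3 := t1.not.mul fun _ => t2.not
  by_cases hcond : ¬ rk (pts V q) i (dst (pts V q) i e) < K ∧ ¬ K < rk (pts V q) i 1
  · have hrK : rk (pts V q) i (dst (pts V q) i e) = K := by
      rcases hset.2 with h1 | h1
      · exact h1
      · exact absurd h1.1 hcond.1
    obtain ⟨a, ha, haw⟩ : ∃ a, Den A s.1 (.ite (.var .rv) (.var .k) (.var .pr) (.second (.var .i))) a ∧
        ((rk (pts V q) i 1 = K ∧ a = secondE (pts V q) i) ∨
          (rk (pts V q) i 1 < K ∧ Proper (pts V q) a i ∧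
            rk (pts V q) i (dst (pts V q) i a) + 1 = K)) := by
      by_cases hlt : rk (pts V q) i 1 < K
      · cases hpr : pr with
        | none =>
          have h1 := hs.isPred
          rw [hpr] at h1
          have h2 := h1.rk_eq_zero
          change rk (pts V q) i (dst (pts V q) i e) = 0 at h2
          omega
        | some a =>
          have h1 := hs.isPred
          rw [hpr] at h1
          obtain ⟨h2, h3, -⟩ := h1.rk_eq h
          change _ = rk (pts V q) i (dst (pts V q) i e) at h3
          refine ⟨a, ?_, Or.inr ⟨hlt, h2, by omega⟩⟩
          have h4 := hs.pr_eq
          rw [hpr] at h4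
          refine (if_pos ?_).trans h4
          simp only [Ex.eval]; rw [hrv, hK, Nat.cast_lt]; exact hlt
      · refine ⟨secondE (pts V q) i, ?_, Or.inl ⟨by omega, rfl⟩⟩
        refine (if_neg ?_).trans (hA.second (show Den A s.1 (.var .i) i from hp.i))
        simp only [Ex.eval]; rw [hrv, hK, Nat.cast_lt]; exact hlt
    have hw : Win (pts V q) K i a e := ⟨hc, by omega, ⟨hset.1, hrK⟩, haw⟩
    refine ⟨triples (pts V q) i a e, ?_, Or.inr ⟨a, e, hw, rfl⟩⟩
    have hend := fun o => endpoint_spec (s := (s.1, o)) hA hp.i ha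
    rw [Cmd.report, run_cond_pos t3 hcond, Cmd.run,
      endpoint_spec hA hp.i (show Den A s.1 (.var .e) e from hp.e),
      hend]
    simp [triples]
  · refine ⟨[], ?_, Or.inl ⟨rfl, fun a b hw => hcond ?_⟩⟩
    · rw [Cmd.report, run_cond_neg t3 hcond, Cmd.run]; simp
    · obtain ⟨-, h1, ⟨h2, h3⟩, -⟩ := hw
      refine ⟨?_, not_lt.2 h1⟩
      rcases hset.2 with h4 | ⟨h4, h5⟩
      · omega
      -- A settled edge of smaller rank is the last crossing edge, so no crossing edge has rank `K`.
      · exfalso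
        have h6 : dst (pts V q) i e < dst (pts V q) i b := (rk_lt_iff hset.1).1 (by omega)
        rw [above, Finset.card_eq_zero, Finset.filter_eq_empty_iff] at h5
        exact h5 (mem_crossing.2 h2) h6

end spec

/-! ### One step of the sweep, and its beginning -/

section sweep

variable {A : List ℤ} {n : ℕ} {V : Fin n → ℤ × ℤ} {q : ℤ × ℤ} {k : ℕ}

/-- Jumping to another edge of the same ray. -/
theorem asg_edge_spec {s : Store × List ℤ} {i z : Fin n} {o : Option (Fin n)} {f : Fin n} {y : Var}
    (hp : Pos s.1 i o z) (hy : s.1 y = code (some f)) :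
    ∃ τ, (Cmd.asg (l := true) .e (.var y)).run A n s = (τ, s.2) ∧ τ .k = s.1 .k ∧
      τ .flag = s.1 .flag ∧ Pos τ i (some f) z := by
  refine ⟨_, rfl, Function.update_of_ne (by decide) _ _, Function.update_of_ne (by decide) _ _,
    (Function.update_of_ne (by decide) _ _).trans hp.i, ?_,
    (Function.update_of_ne (by decide) _ _).trans hp.z⟩
  rw [Function.update_self]
  simp only [Ex.eval]
  rw [hy]
  exact clip_code _

theorem advance_spec (hA : Reads A V q k) {s : Store × List ℤ} {i z e : Fin n}
    {nxt : Option (Fin n)} (hp : Pos s.1 i (some e) z) (hn : s.1 .nxt = code nxt) :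
    ∃ τ, (Cmd.advance).run A n s = (τ, s.2) ∧ τ .k = s.1 .k ∧
      ((nxt = none ∧ τ .flag = 0) ∨ ∃ t, nxt = some t ∧ τ .flag = s.1 .flag ∧
        Pos τ t (some ((walkStep (pts V q) z t)^[n] (i, e)).2) z) := by
  have ht : Tst A s.1 (.lt (.var .nxt) .num) (nxt ≠ none) := tst_lt_num (hA.eval_num _) hn
  rcases Option.eq_none_or_eq_some nxt with hnx | ⟨t, hnx⟩
  · rw [Cmd.advance, run_cond_neg ht (by simp [hnx])]
    refine ⟨_, rfl, Function.update_of_ne (by decide) _ _, Or.inl ⟨hnx, ?_⟩⟩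
    rw [Function.update_self]
    exact clip_of_mem (le_refl (0 : ℤ)) (show (0 : ℤ) < 2 * n + 4 by omega)
  · rw [Cmd.advance, run_cond_pos ht (by simp [hnx])]
    have hn' : s.1 .nxt = (t : ℕ) := by rw [hn, hnx]; rfl
    obtain ⟨τ, h1, h2, h3⟩ := walk_spec hA hp hn'
    rw [Cmd.run, h1]
    refine ⟨_, rfl, ?_, Or.inr ⟨t, hnx, ?_, ?_, ?_, ?_⟩⟩
    · exact (Function.update_of_ne (by decide) _ _).trans (h2 _ (by decide) (by decide) (by decide))
    · exact (Function.update_of_ne (by decide) _ _).trans (h2 _ (by decide) (by decide) (by decide))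
    · rw [Function.update_self]
      simp only [Ex.eval]
      rw [h2 _ (by decide) (by decide) (by decide), hn']
      exact clip_code (some t)
    · exact (Function.update_of_ne (by decide) _ _).trans h3
    · exact (Function.update_of_ne (by decide) _ _).trans
        ((h2 _ (by decide) (by decide) (by decide)).trans hp.z)

/-- A pass either moves to a neighbouring crossing edge of the same ray and lowers the potential, or
finds the edge settled, reports, and goes on to the next critical vertex. -/
theorem sweep_spec (hA : Reads A V q k) (h : Star (pts V q)) {s : Store × List ℤ} {i z : Fin n}
    {o : Option (Fin n)} {K : ℕ} (hp : Pos s.1 i o z) (hK : s.1 .k = K) (ho : OnRay (pts V q) i o)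
    (hc : Crit (pts V q) i) (hex : ∃ f, Proper (pts V q) f i) :
    ∃ τ out, (Cmd.sweep).run A n s = (τ, out) ∧ τ .k = s.1 .k ∧
      ((∃ f, Pos τ i (some f) z ∧ τ .flag = s.1 .flag ∧ out = s.2 ∧ Proper (pts V q) f i ∧
          pot (pts V q) K i (some f) < pot (pts V q) K i o) ∨
        ∃ e l nxt, o = some e ∧ Settled (pts V q) K i e ∧ out = s.2 ++ l.flatMap reportWords ∧
          Reports (pts V q) K i l ∧
          IsBest (fun j => Crit (pts V q) j ∧ Lt (pts V q) z i j) (Lt (pts V q) z) nxt ∧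
          ((nxt = none ∧ τ .flag = 0) ∨ ∃ t, nxt = some t ∧ τ .flag = s.1 .flag ∧
            Pos τ t (some ((walkStep (pts V q) z t)^[n] (i, e)).2) z)) := by
  obtain ⟨τ, su, pr, nxt, h1, h2, h3, h4, h5⟩ := scan_spec hA h hp ho
  rw [Cmd.sweep, Cmd.run, h1]
  have tsu : Tst A τ (.lt (.var .su) .num) (su ≠ none) := tst_lt_num (hA.eval_num _) h5.su_eq
  have tk : τ .k = K := h3.trans hK
  have tprop : Tst A τ (.mul (.lt (.var .e) .num) (.proper (.var .e) (.var .i)))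
      (OProper (pts V q) i o) := by
    have t0 : Tst A τ (.lt (.var .e) .num) (o ≠ none) := tst_lt_num (hA.eval_num _) h2.e
    refine (t0.mul (q := OProper (pts V q) i o) fun ho' => ?_).congr ?_
    · obtain ⟨e, rfl⟩ := Option.ne_none_iff_exists'.1 ho'
      exact (hA.proper (show Den A τ (.var .e) e from h2.e)
        (show Den A τ (.var .i) i from h2.i)).congr oProper_some.symm
    · refine and_iff_right_of_imp ?_
      rintro ⟨e, rfl, -⟩
      simp
  by_cases hop : OProper (pts V q) i o
  · rw [run_cond_pos (s := (τ, s.2)) tprop hop]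
    obtain ⟨e, rfl, he⟩ := hop
    have hr : τ .r = rk (pts V q) i (dst (pts V q) i e) := h5.r
    have t1 : Tst A τ (Ex.lt (.var .r) (.var .k)) (rk (pts V q) i (dst (pts V q) i e) < K) :=
      tst_lt (by simp only [Ex.eval]; rw [hr, tk, Nat.cast_lt])
    have t2 : Tst A τ (Ex.lt (.var .k) (.var .r)) (K < rk (pts V q) i (dst (pts V q) i e)) :=
      tst_lt (by simp only [Ex.eval]; rw [hr, tk, Nat.cast_lt])
    have t3 := t1.mul fun _ => tsu
    by_cases hs : rk (pts V q) i (dst (pts V q) i e) < K ∧ su ≠ none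
    · rw [run_cond_pos (s := (τ, s.2)) t3 hs]
      obtain ⟨f, hf⟩ := Option.ne_none_iff_exists'.1 hs.2
      obtain ⟨τ', g1, g2, g3, g4⟩ := asg_edge_spec (A := A) (s := (τ, s.2)) h2
        (h5.su_eq.trans (by rw [hf]))
      have h6 := h5.isSucc
      rw [hf] at h6
      exact ⟨τ', _, g1, g2.trans h3, Or.inl ⟨f, g4, g3.trans h4, rfl, (h6.rk_eq h).1,
        h6.pot_lt h ho fun _ => hs.1⟩⟩
    · rw [run_cond_neg (s := (τ, s.2)) t3 hs]
      by_cases hlt : K < rk (pts V q) i (dst (pts V q) i e)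
      · rw [run_cond_pos (s := (τ, s.2)) t2 hlt]
        have h6 := h5.isPred
        rcases Option.eq_none_or_eq_some pr with hf | ⟨f, hf⟩ <;> rw [hf] at h6
        · have h7 : rk (pts V q) i (dst (pts V q) i e) = 0 := h6.rk_eq_zero
          omega
        · obtain ⟨τ', g1, g2, g3, g4⟩ := asg_edge_spec (A := A) (s := (τ, s.2)) h2
            (h5.pr_eq.trans (by rw [hf]))
          exact ⟨τ', _, g1, g2.trans h3, Or.inl ⟨f, g4, g3.trans h4, rfl, (h6.rk_eq h).1,
            h6.pot_lt h ho (fun _ => hlt) fun h0 => absurd (oProper_some.2 he) h0⟩⟩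
      · rw [run_cond_neg (s := (τ, s.2)) t2 hlt]
        have hset : Settled (pts V q) K i e := by
          refine ⟨he, ?_⟩
          rcases (not_lt.1 hlt).lt_or_eq with h6 | h6
          · refine Or.inr ⟨h6, ?_⟩
            have h7 : su = none := by
              by_contra h8; exact hs ⟨h6, h8⟩
            have h8 := h5.isSucc
            rw [h7] at h8
            exact h8.above_eq_zero
          · exact Or.inl h6
        obtain ⟨l, g1, g2⟩ := report_spec hA h (s := (τ, s.2)) h2 h5 tk hc hset
        rw [Cmd.run, g1]
        obtain ⟨τ', f1, f2, f3⟩ := advance_spec hA (s := (τ, s.2 ++ l.flatMap reportWords)) h2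
          h5.nxt_eq
        refine ⟨τ', _, f1, f2.trans h3, Or.inr ⟨e, l, nxt, rfl, hset, rfl, g2, h5.isBest, ?_⟩⟩
        rcases f3 with f3 | ⟨t, f3, f4, f5⟩
        · exact Or.inl f3
        · exact Or.inr ⟨t, f3, f4.trans h4, f5⟩
  · rw [run_cond_neg (s := (τ, s.2)) tprop hop]
    have h6 := h5.isSucc
    rcases Option.eq_none_or_eq_some su with hf | ⟨f, hf⟩ <;> rw [hf] at h6
    · rw [run_cond_neg (s := (τ, s.2)) tsu (by simp [hf])]
      have h7 := h5.isPred
      rcases Option.eq_none_or_eq_some pr with hg | ⟨g, hg⟩ <;> rw [hg] at h7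
      -- Without a neighbour on either side every crossing edge would be at the current distance,
      -- but a position off the crossing edges shares its distance with none of them.
      · exfalso
        obtain ⟨f, hf'⟩ := hex
        have h8 := h6.1 rfl f
        have h9 := h7.1 rfl f
        simp only [hf', true_and, not_lt] at h8 h9
        have h10 : odst (pts V q) i o = dst (pts V q) i f := le_antisymm h9 h8
        rcases Option.eq_none_or_eq_some o with rfl | ⟨e, rfl⟩
        · exact (dst_pos h hf'.inCone).ne h10
        · have hef : e ≠ f := by
            rintro rfl; exact hop (oProper_some.2 hf')
          exact dst_ne h hef (ho e rfl) hf' h10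
      · obtain ⟨τ', g1, g2, g3, g4⟩ := asg_edge_spec (A := A) (s := (τ, s.2)) h2
          (h5.pr_eq.trans (by rw [hg]))
        exact ⟨τ', _, g1, g2.trans h3, Or.inl ⟨g, g4, g3.trans h4, rfl, (h7.rk_eq h).1,
          h7.pot_lt h ho (fun h0 => absurd h0 hop) fun _ => h6.above_eq_zero⟩⟩
    · rw [run_cond_pos (s := (τ, s.2)) tsu (by simp [hf])]
      obtain ⟨τ', g1, g2, g3, g4⟩ := asg_edge_spec (A := A) (s := (τ, s.2)) h2
        (h5.su_eq.trans (by rw [hf]))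
      exact ⟨τ', _, g1, g2.trans h3, Or.inl ⟨f, g4, g3.trans h4, rfl, (h6.rk_eq h).1,
        h6.pot_lt h ho fun h0 => absurd h0 hop⟩⟩

theorem card_filter_val_lt (n c : ℕ) :
    (Finset.univ.filter fun m : Fin n => (m : ℕ) < c).card = min n c := by
  rw [← Fintype.card_subtype, ← Nat.card_eq_fintype_card]
  have : (Finset.univ.filter fun m : Fin n => (m : ℕ) < c).map Fin.valEmbedding =
      Finset.range (min n c) := by
    ext x
    simp only [Finset.mem_map, Finset.mem_filter, Finset.mem_univ, true_and, Fin.valEmbedding_apply,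
      Finset.mem_range, lt_min_iff]
    exact ⟨fun ⟨m, h1, h2⟩ => ⟨by rw [← h2]; exact m.2, by rw [← h2]; exact h1⟩,
      fun h1 => ⟨⟨x, h1.1⟩, h1.2, rfl⟩⟩
  rw [Nat.card_eq_fintype_card, Fintype.card_subtype, ← Finset.card_map Fin.valEmbedding, this,
    Finset.card_range]

/-- A variable can only hold array addresses, whereas `k` may be much larger. Therefore `k / 2` is
truncated at `n`, by counting the indices below it, which also avoids a division. -/
theorem start_spec (hA : Reads A V q k) (h3 : 3 ≤ n) (s : Store × List ℤ) :
    ∃ τ oz, (Cmd.start).run A n s = (τ, s.2) ∧ τ .k = ((2 * min n (k / 2) : ℕ) : ℤ) ∧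
      IsBest (Crit (pts V q)) (fun _ _ => False) oz ∧
      ((oz = none ∧ τ .flag = 0) ∨ ∃ z, oz = some z ∧ τ .flag = 1 ∧ Pos τ z none z) := by
  classical
  obtain ⟨τ1, oz, a1, b1, c1, d1⟩ := run_best (A := A) (n := n) (y := .z) (by decide) (s := s)
    (hA.eval_num) (a := .crit (.var .j)) (b := .lit 0) (p := Crit (pts V q))
    (lt := fun _ _ => False) (by simp) (by simp)
    (fun τ _ m hm => hA.crit (show Den A _ (.var .j) m from hm)) (fun τ _ m c _ _ _ _ => tst_false)
  obtain ⟨τ2, a2, b2, c2⟩ := run_count (A := A) (n := n) (y := .k) (by decide) (s := (τ1, s.2))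
    (a := .lt (.add (.add (.var .j) (.var .j)) (.lit 1)) (.rd (.lit 1)))
    (p := fun m => (m : ℕ) < k / 2) (by
      intro τ _ m hm
      -- For integers, `2 * m + 1 < k` is equivalent to `m < k / 2` with rounding down.
      refine tst_lt ?_
      simp only [Ex.eval]
      rw [hA.rank, hm]
      omega)
  have hcard : (Finset.univ.filter fun m : Fin n => (m : ℕ) < k / 2).card = min n (k / 2) :=
    card_filter_val_lt n (k / 2)
  replace c2 : τ2 .k = ((min n (k / 2) : ℕ) : ℤ) := by
    rw [c2, ← hcard]; congr!
  set σ3 := Function.update τ2 .k (clip n ((Ex.add (.var .k) (.var .k)).eval A τ2)) with hσ3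
  set σ4 := Function.update σ3 .i (clip n ((Ex.var .z).eval A σ3)) with hσ4
  set σ5 := Function.update σ4 .e (clip n (Ex.num.eval A σ4)) with hσ5
  have hz2 : τ2 .z = code oz := (b2 _ (by decide) (by decide)).trans c1
  have hz5 : σ5 .z = code oz := by
    rw [hσ5, Function.update_of_ne (by decide), hσ4, Function.update_of_ne (by decide), hσ3,
      Function.update_of_ne (by decide), hz2]
  have hk5 : σ5 .k = ((2 * min n (k / 2) : ℕ) : ℤ) := by
    rw [hσ5, Function.update_of_ne (by decide), hσ4, Function.update_of_ne (by decide), hσ3,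
      Function.update_self]
    simp only [Ex.eval]
    rw [c2, clip_of_mem (by omega) (by omega)]
    push_cast; ring
  have he5 : σ5 .e = n := by
    rw [hσ5, Function.update_self, hA.eval_num]
    exact clip_code (none : Option (Fin n))
  have hi5 : σ5 .i = code oz := by
    rw [hσ5, Function.update_of_ne (by decide), hσ4, Function.update_self]
    simp only [Ex.eval]
    rw [hσ3, Function.update_of_ne (by decide), hz2]
    exact clip_code _
  have hrun : (Cmd.start).run A n s = (Cmd.cond (.lt (.var .z) .num) (.asg .flag (.lit 1))
      (.asg .flag (.lit 0) : Cmd true)).run A n (σ5, s.2) := by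
    simp only [Cmd.start, Cmd.run] at a1 a2 ⊢
    rw [a1, a2]
  have ht : Tst A σ5 (.lt (.var .z) .num) (oz ≠ none) := tst_lt_num (hA.eval_num _) hz5
  rw [hrun]
  rcases Option.eq_none_or_eq_some oz with hoz | ⟨z, hoz⟩
  · rw [run_cond_neg (s := (σ5, s.2)) ht (by simp [hoz])]
    refine ⟨_, oz, rfl, (Function.update_of_ne (by decide) _ _).trans hk5, d1, Or.inl ⟨hoz, ?_⟩⟩
    rw [Function.update_self]
    exact clip_of_mem (le_refl (0 : ℤ)) (show (0 : ℤ) < 2 * n + 4 by omega)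
  · rw [run_cond_pos (s := (σ5, s.2)) ht (by simp [hoz])]
    rw [hoz] at hz5 hi5
    refine ⟨_, oz, rfl, (Function.update_of_ne (by decide) _ _).trans hk5, d1,
      Or.inr ⟨z, hoz, ?_, ?_, ?_, ?_⟩⟩
    · rw [Function.update_self]
      exact clip_of_mem (by simp [Ex.eval]) (by simp only [Ex.eval]; omega)
    · exact (Function.update_of_ne (by decide) _ _).trans hi5
    · exact (Function.update_of_ne (by decide) _ _).trans he5
    · exact (Function.update_of_ne (by decide) _ _).trans hz5

end sweep

/-! ### The invariant of the sweep -/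

section invariant

variable {n : ℕ}

/-- The list consists of the endpoints of the windows on the rays through the vertices in `S`. -/
def Covers (u : Fin n → ℂ) (K : ℕ) (S : Set (Fin n)) (L : List (Fin n × Fin n × WindowType)) :
    Prop :=
  L.Nodup ∧ ∀ w, w ∈ L ↔ ∃ j ∈ S, ∃ a b, Win u K j a b ∧ w ∈ triples u j a b

theorem mem_triples_fst {u : Fin n → ℂ} {i a b : Fin n} {w : Fin n × Fin n × WindowType}
    (h : w ∈ triples u i a b) : w.1 = i := by
  simp only [triples, List.mem_cons, List.not_mem_nil, or_false] at h
  rcases h with rfl | rfl <;> rfl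

/-- Triples of different rays differ in the vertex, and the two triples of one window differ in the
edge, so nothing is reported twice. -/
theorem Covers.append {P : Polygon ℂ n} {q : ℂ} (h : Star (rel P q)) {K : ℕ} {S : Set (Fin n)}
    {L l : List (Fin n × Fin n × WindowType)} (hL : Covers (rel P q) K S L) {i : Fin n}
    (hi : i ∉ S) (hl : Reports (rel P q) K i l) : Covers (rel P q) K (insert i S) (L ++ l) := by
  have hmem : ∀ w, w ∈ l ↔ ∃ a b, Win (rel P q) K i a b ∧ w ∈ triples (rel P q) i a b := by
    intro w
    rcases hl with ⟨rfl, h1⟩ | ⟨a, b, h1, rfl⟩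
    · simp [h1]
    · constructor
      · exact fun h2 => ⟨a, b, h1, h2⟩
      · rintro ⟨a', b', h2, h3⟩
        obtain ⟨rfl, rfl⟩ := h1.right_unique h h2
        exact h3
  constructor
  · rw [List.nodup_append]
    refine ⟨hL.1, ?_, ?_⟩
    · rcases hl with ⟨rfl, -⟩ | ⟨a, b, h1, rfl⟩
      · exact List.nodup_nil
      · have hab : b ≠ a := by
          rintro rfl; exact lt_irrefl _ (h1.one_le_dst h).2.1
        simp [triples, hab]
    · rintro w hw w' hw' rfl
      obtain ⟨j, hj, a, b, -, h2⟩ := (hL.2 w).1 hw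
      obtain ⟨a', b', -, h3⟩ := (hmem w).1 hw'
      rw [← mem_triples_fst h3, mem_triples_fst h2] at hi
      exact hi hj
  · intro w
    rw [List.mem_append, hL.2 w, hmem w]
    constructor
    · rintro (⟨j, hj, h1⟩ | h1)
      · exact ⟨j, Set.mem_insert_of_mem _ hj, h1⟩
      · exact ⟨i, Set.mem_insert _ _, h1⟩
    · rintro ⟨j, rfl | hj, h1⟩
      · exact Or.inr h1
      · exact Or.inl ⟨j, hj, h1⟩

open Classical in
/-- The invariant of the sweep; `m` bounds the number of remaining steps. -/
def Inv (u : Fin n → ℂ) (K m : ℕ) (p : Store × List ℤ) : Prop :=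
  p.1 .k = K ∧ ∃ L, p.2 = L.flatMap reportWords ∧
    ((p.1 .flag = 0 ∧ Covers u K {j | Crit u j} L) ∨
      ∃ i o z, 0 < p.1 .flag ∧ Pos p.1 i o z ∧ OnRay u i o ∧ Crit u i ∧
        Covers u K {j | Crit u j ∧ Lt u z j i} L ∧
        pot u K i o + 21 * (Finset.univ.filter fun j => Crit u j ∧ Lt u z i j).card + 1 ≤ m)

/-- A move on a ray lowers the potential. A new ray costs at most `20` for the potential after the
walk and `1` for the passage, which is paid for by the weight `21` of a critical vertex. -/
theorem inv_sweep {A : List ℤ} {V : Fin n → ℤ × ℤ} {q : ℤ × ℤ} {k : ℕ} (hA : Reads A V q k)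
    (h : Star (pts V q)) (hq : toPlane q ∈ region (polygon V)) {K m : ℕ} {p : Store × List ℤ}
    (hI : Inv (pts V q) K m p) (hf : 0 < p.1 .flag) :
    ∃ m' < m, Inv (pts V q) K m' ((Cmd.sweep).run A n p) := by
  classical
  obtain ⟨hK, L, hL, ⟨h1, -⟩ | ⟨i, o, z, -, hp, ho, hc, hcov, hm⟩⟩ := hI
  · omega
  obtain ⟨τ, out, e1, e2, e3⟩ := sweep_spec hA h hp hK ho hc (exists_proper h hq hc)
  rw [e1]
  refine ⟨m - 1, by omega, e2.trans hK, ?_⟩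
  rcases e3 with ⟨f, g1, g2, g3, g4, g5⟩ | ⟨e, l, nxt, rfl, g1, g2, g3, g4, g5⟩
  · exact ⟨L, g3.trans hL, Or.inr ⟨i, some f, z, hf.trans_eq g2.symm, g1, onRay_some g4.inCone, hc, hcov, by omega⟩⟩
  · have hcov' := hcov.append h (i := i) (fun h0 => Lt.irrefl h0.2) g3
    refine ⟨L ++ l, by rw [g2, hL, List.flatMap_append], ?_⟩
    rcases g5 with ⟨rfl, g6⟩ | ⟨t, rfl, g6, g7⟩
    · refine Or.inl ⟨g6, ?_⟩
      convert hcov' using 1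
      ext j
      simp only [Set.mem_ofPred_eq, Set.mem_insert_iff]
      constructor
      · intro hj
        by_cases hji : j = i
        · exact Or.inl hji
        · refine Or.inr ⟨hj, (lt_or_lt h hji).resolve_right fun h0 => g4.1 rfl j ⟨hj, h0⟩⟩
      · rintro (rfl | h0)
        exacts [hc, h0.1]
    -- Since `t` is the first critical vertex after `i`, the walk meets no critical vertex in
    -- between, and the vertices before `t` are `i` and those before `i`.
    · obtain ⟨⟨c1, c2⟩, c3⟩ := g4.2 t rfl
      obtain ⟨w1, w2⟩ := pot_walk_le h g1 c2 fun v h0 h0' hv => c3 v ⟨hv, h0⟩ h0'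
      refine Or.inr ⟨t, _, z, hf.trans_eq g6.symm, g7, w1, c1, ?_, ?_⟩
      · convert hcov' using 1
        ext j
        simp only [Set.mem_ofPred_eq, Set.mem_insert_iff]
        constructor
        · rintro ⟨hj, hjt⟩
          by_cases hji : j = i
          · exact Or.inl hji
          · exact Or.inr ⟨hj, (lt_or_lt h hji).resolve_right fun h0 => c3 j ⟨hj, h0⟩ hjt⟩
        · rintro (rfl | h0)
          · exact ⟨hc, c2⟩
          · exact ⟨h0.1, h0.2.trans h c2⟩
      · have hlt : (Finset.univ.filter fun j => Crit (pts V q) j ∧ Lt (pts V q) z t j).card <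
            (Finset.univ.filter fun j => Crit (pts V q) j ∧ Lt (pts V q) z i j).card := by
          apply Finset.card_lt_card
          rw [Finset.ssubset_iff_of_subset]
          · exact ⟨t, by simp [c1, c2], by simp [Lt.irrefl]⟩
          · intro j hj
            simp only [Finset.mem_filter, Finset.mem_univ, true_and] at hj ⊢
            exact ⟨hj.1, c2.trans h hj.2⟩
        omega

/-- The sweep starts at the origin on the first ray, where the rank is `0`, so the potential is at
most `K + 2`. The base vertex is first in its own order, so nothing has to have been reported. -/
theorem inv_start {A : List ℤ} {V : Fin n → ℤ × ℤ} {q : ℤ × ℤ} {k : ℕ} (hA : Reads A V q k)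
    (h : Star (pts V q)) : Inv (pts V q) (2 * min n (k / 2))
      (2 * min n (k / 2) + 21 * {j | Crit (pts V q) j}.ncard + 3)
      ((Cmd.start).run A n (fun _ => 0, [])) := by
  classical
  obtain ⟨τ, oz, e1, e2, e3, e4⟩ := start_spec hA h.three_le (fun _ => 0, [])
  rw [e1]
  refine ⟨e2, [], rfl, ?_⟩
  rcases e4 with ⟨rfl, g1⟩ | ⟨z, rfl, g1, g2⟩
  · refine Or.inl ⟨g1, List.nodup_nil, fun w => ?_⟩
    simp only [List.not_mem_nil, false_iff]
    rintro ⟨j, hj, -⟩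
    exact e3.1 rfl j hj
  · refine Or.inr ⟨z, none, z, one_pos.trans_eq g1.symm, g2, onRay_none, (e3.2 z rfl).1, ⟨List.nodup_nil, fun w => ?_⟩, ?_⟩
    · simp only [List.not_mem_nil, false_iff]
      rintro ⟨j, ⟨-, hj⟩, -⟩
      exact (lt_base h hj.ne).asymm h hj
    · have h1 : rk (pts V q) z (odst (pts V q) z none) = 0 := by
        rw [rk, Finset.card_eq_zero, Finset.filter_eq_empty_iff]
        intro f hf
        exact not_lt.2 (dst_pos h (mem_crossing.1 hf).inCone).le
      have h2 : (Finset.univ.filter fun j => Crit (pts V q) j ∧ Lt (pts V q) z z j).card ≤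
          {j | Crit (pts V q) j}.ncard := by
        rw [← Set.ncard_coe_finset]
        refine Set.ncard_le_ncard (fun j hj => ?_) (Set.toFinite _)
        simp only [Finset.coe_filter, Finset.mem_univ, true_and, Set.mem_ofPred_eq] at hj
        exact hj.1
      unfold pot
      rw [h1]
      split_ifs <;> omega

end invariant

/-! ### From the reported list to the set of window endpoints -/

section report

variable {n : ℕ} {P : Polygon ℂ n} {q : ℂ}

theorem angle_injective (h : Star (rel P q)) {i j : Fin n} (hij : angle q (P i) = angle q (P j)) :
    i = j := by
  apply h.eq_of_X
  rw [X, ← smul_unit_angle i, ← smul_unit_angle j, hij, cross_smul_left, cross_smul_right,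
    cross_self, mul_zero, mul_zero]

theorem reported_injective (h : Star (rel P q)) : Function.Injective (reported P q) := by
  rintro ⟨i, e, y⟩ ⟨j, f, y'⟩ hw
  simp only [reported, Prod.mk.injEq] at hw
  rw [angle_injective h hw.1, hw.2.1, hw.2.2]

/-- Ranks are at most `n - 2`, so for `K ≥ n` there are no windows and the truncation of `k / 2` at
`n` is harmless. -/
theorem win_min_iff (h : Star (rel P q)) {k : ℕ} {i a b : Fin n} :
    Win (rel P q) (2 * min n (k / 2)) i a b ↔ Win (rel P q) (2 * (k / 2)) i a b := by
  rcases le_total (k / 2) n with h1 | h1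
  · rw [min_eq_right h1]
  · have key : ∀ K, n ≤ K → ¬ Win (rel P q) K i a b := by
      rintro K hK ⟨-, -, ⟨h2, h3⟩, -⟩
      have := rk_add_two_le h h2
      omega
    rw [min_eq_left h1]
    exact iff_of_false (key _ (by omega)) (key _ (by omega))

theorem mem_windowEndpoints_iff (h : Star (rel P q)) (hq : q ∈ region P) {k : ℕ}
    {L : List (Fin n × Fin n × WindowType)}
    (hL : Covers (rel P q) (2 * min n (k / 2)) {j | Crit (rel P q) j} L)
    (w : ℝ × Fin n × WindowType) :
    w ∈ L.map (reported P q) ↔ w ∈ windowEndpoints P q k := by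
  rw [List.mem_map, windowEndpoints, windowEndpointsEven, Set.mem_ofPred_eq]
  constructor
  · rintro ⟨x, hx, rfl⟩
    obtain ⟨j, -, a, b, h1, h2⟩ := (hL.2 x).1 hx
    rw [win_min_iff h] at h1
    refine ⟨j, a, b, (hasWindow_iff h).2 h1, ?_, ?_, ?_⟩
    · rw [reported, mem_triples_fst h2]
    · simp only [triples, List.mem_cons, List.not_mem_nil, or_false] at h2
      rcases h2 with rfl | rfl
      exacts [Or.inr rfl, Or.inl rfl]
    · rw [regionOnLeft_iff h hq (even_two_mul _) h1]
      simp only [triples, List.mem_cons, List.not_mem_nil, or_false] at h2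
      rcases h2 with rfl | rfl <;> simp [reported]
  · rintro ⟨i, a, b, h1, h2, h3, h4⟩
    rw [hasWindow_iff h] at h1
    rw [regionOnLeft_iff h hq (even_two_mul _) h1] at h4
    obtain ⟨θ, e, y⟩ := w
    dsimp only at h2 h3 h4
    refine ⟨(i, e, y), (hL.2 _).2 ⟨i, h1.1, a, b, (win_min_iff h).2 h1, ?_⟩, by rw [reported, h2]⟩
    have hy : y = if X (rel P q) i (nx i) < 0 then WindowType.ccw else .cw := by
      split_ifs with h5
      · exact h4.2 h5
      · cases y
        · exact absurd (h4.1 rfl) h5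
        · rfl
    simp only [triples, List.mem_cons, List.not_mem_nil, or_false, Prod.mk.injEq, true_and]
    rw [hy]
    rcases h3 with rfl | rfl
    · exact Or.inr ⟨rfl, by congr!⟩
    · exact Or.inl ⟨rfl, by congr!⟩

/-- The registers of the program. -/
def numReg : ℕ := tmp + Cmd.start.height + Cmd.sweep.height

/-- The constant of the word size and of the time bound. -/
def bound : ℕ := 2 + Cmd.start.width + Cmd.sweep.width + 50 * (Cmd.start.time + Cmd.sweep.time + 6)

/-- Uses `n + 1 ≤ 2 * n` and `2 * min n (k / 2) ≤ k`; the constants `21 + 4` are absorbed by `25 *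
max 1 c`, which also covers the case without critical vertices. -/
theorem time_le {n k c t D : ℕ} (hn : 1 ≤ n)
    (ht : t ≤ D * ((n + 1) * (2 * min n (k / 2) + 21 * c + 3 + 1))) :
    t ≤ 50 * D * (k * n + max 1 c * n) := by
  have h1 : 2 * min n (k / 2) + 21 * c + 3 + 1 ≤ 25 * (k + max 1 c) := by omega
  calc t ≤ D * ((n + n) * (25 * (k + max 1 c))) := by
        refine ht.trans ?_
        gcongr
    _ = 50 * D * (k * n + max 1 c * n) := by ring

end report

end KVis

/-- One program with a constant number of registers reports `W_k(P,q)`, each endpoint once. If the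
input numbers fit in `b` bits, it works with words of `C * b` bits, and it takes
`O(kn + cn)` time, where `c` is the number of critical vertices (`O(kn + n)` if there is none). -/
theorem theorem1 :
    ∃ (R : ℕ) (prog : KVis.Prog R) (C : ℕ),
      ∀ (n : ℕ) (V : Fin n → ℤ × ℤ) (q : ℤ × ℤ) (k b : ℕ),
        KVis.IsSimple (KVis.polygon V) →
        KVis.toPlane q ∈ KVis.region (KVis.polygon V) →
        KVis.WeakGeneralPosition (KVis.polygon V) (KVis.toPlane q) →
        (∀ x ∈ KVis.inputArray V q k, KVis.Fits b x) →
        ∃ (T : ℕ) (s : KVis.State R) (L : List (Fin n × Fin n × KVis.WindowType)),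
          KVis.Exec (KVis.inputArray V q k) (C * b) prog (KVis.State.init R) T s ∧
          T ≤ C * (k * n + max 1 (KVis.numCritical (KVis.polygon V) (KVis.toPlane q)) * n) ∧
          s.out = L.flatMap KVis.reportWords ∧
          (L.map (KVis.reported (KVis.polygon V) (KVis.toPlane q))).Nodup ∧
          ∀ w, w ∈ L.map (KVis.reported (KVis.polygon V) (KVis.toPlane q)) ↔
            w ∈ KVis.windowEndpoints (KVis.polygon V) (KVis.toPlane q) k := by
  open KVis in
  refine ⟨numReg + 1, mainProg numReg Cmd.start Cmd.sweep, bound, fun n V q k b hs hq hw hfit => ?_⟩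
  have h : Star (pts V q) := star_rel hs hw
  obtain ⟨hA, hlen⟩ := readAt_inputArray V q k
  have hmem : (n : ℤ) ∈ inputArray V q k := by simp [inputArray]
  have hcrit : numCritical (polygon V) (toPlane q) = {j | Crit (pts V q) j}.ncard := by
    simp only [numCritical, isCritical_iff]
  -- The bound on `n` in terms of `b` comes from `n` itself being an input word.
  let ε : Env := ⟨inputArray V q k, n, b, hs.1, hlen, hfit, (le_abs_self _).trans_lt (hfit _ hmem)⟩
  obtain ⟨t, s, p, h1, h2, h3, h4, m, -, L, h5, h6⟩ := mainProg_spec ε (Q := numReg) (W := bound)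
    (by unfold bound; omega) Cmd.start Cmd.sweep (by unfold numReg; omega) (by unfold numReg; omega)
    (by unfold bound; omega) (by unfold bound; omega) rfl (inv_start hA h)
    (fun m p _ hI hf => inv_sweep hA h hq hI hf)
  -- The outer loop has stopped, so the flag is not positive and the invariant is in its final
  -- alternative: all critical vertices have been treated.
  have hcov : Covers (pts V q) (2 * min n (k / 2)) {j | Crit (pts V q) j} L := by
    rcases h6 with ⟨-, h6⟩ | ⟨i, o, z, h7, -⟩
    · exact h6
    · exact absurd h7 h4
  refine ⟨t, s, L, h1, ?_, h3.trans h5, hcov.1.map (reported_injective h),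
    mem_windowEndpoints_iff h hq hcov⟩
  rw [hcrit]
  refine (time_le (n := n) (by have := hs.1; omega) h2).trans (Nat.mul_le_mul_right _ ?_)
  unfold bound
  omega
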